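/- **Setting.** Let $1\le p<\infty$, let $M'$ be a compact smooth Riemannian manifold (without boundary, not necessarily connected) and let $N$ be a smooth Riemannian manifold, isometrically embedded in a Euclidean space $\mathbb{R}^\nu$. For an open set $G\subseteq M'$, $\dot W^{1,p}(G\times(0,1),N)$ denotes the set of maps $U\colon G\times(0,1)\to N$ that, regarded as maps into $\mathbb{R}^\nu$, are weakly differentiable in local charts (that is, locally integrable with a locally integrable weak derivative $\mathrm{D}U$) and satisfy $\int_{G\times(0,1)}|\mathrm{D}U|^p<\infty$; the measure and the norm are those of the product Riemannian metric. The trace $\operatorname{tr}_{G\times\{0\}}U$ is the function $u\colon G\to\mathbb{R}^\nu$, unique up to equality almost everywhere, such that $\lim_{\varepsilon\to0}\frac1\varepsilon\int_0^\varepsilon\int_K|U(x,t)-u(x)|\,\mathrm{d}x\,\mathrm{d}t=0$ for every compact $K\subseteq G$. **Proposition 2.2.** Let $M'$ and $p$ be as above and let $(G_i)_{i\in I}$ be a finite covering of $M'$ by open sets. There is a constant $C$, depending only on $p$ and on the covering $(G_i)_{i\in I}$ of the Riemannian manifold $M'$, such that the following holds for every such $N\subseteq\mathbb{R}^\nu$.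 Let $U_i\in\dot W^{1,p}(G_i\times(0,1),N)$ for each $i\in I$, and assume that for all $i,j\in I$ $$\operatorname{tr}_{(G_i\cap G_j)\times\{0\}}U_i=\operatorname{tr}_{(G_i\cap G_j)\times\{0\}}U_j .$$ Then there exists $U\in\dot W^{1,p}(M'\times(0,1),N)$ such that $\operatorname{tr}_{G_i\times\{0\}}U=\operatorname{tr}_{G_i\times\{0\}}U_i$ for every $i\in I$ and $$\int_{M'\times(0,1)}|\mathrm{D}U|^p\le C\sum_{i\in I}\int_{G_i\times(0,1)}|\mathrm{D}U_i|^p .$$ -/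

import Mathlib

open MeasureTheory Set Filter Topology Bundle Manifold
open scoped ENNReal NNReal ContDiff

noncomputable section

namespace FoldingSobolev

/-! ### Weak derivatives on open subsets of a Euclidean space -/

/-- `f'` is the weak derivative of `f` on the open set `Ω`: both are locally integrable on `Ω`,
and they satisfy the integration by parts formula against all smooth test functions that are
compactly supported in `Ω`. -/
structure HasWeakFDerivOn {E F : Type*} [NormedAddCommGroup E] [NormedSpace ℝ E]
    [MeasureSpace E] [NormedAddCommGroup F] [NormedSpace ℝ F]
    (f : E → F) (f' : E → E →L[ℝ] F) (Ω : Set E) : Prop where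
  locallyIntegrableOn : LocallyIntegrableOn f Ω
  locallyIntegrableOn_deriv : LocallyIntegrableOn f' Ω
  integral_eq : ∀ ψ : E → ℝ, ContDiff ℝ ∞ ψ → HasCompactSupport ψ → tsupport ψ ⊆ Ω →
    ∀ v : E, ∫ z, fderiv ℝ ψ z v • f z = - ∫ z, ψ z • f' z v

/-! ### The Riemannian volume -/

section Riemannian

variable {n : ℕ} {M : Type*} [TopologicalSpace M] [ChartedSpace (EuclideanSpace ℝ (Fin n)) M]

/-- The coordinate vector field `∂ₖ` of the chart at `x₀`, at the point with coordinates `y`. -/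
def coordVector (x₀ : M) (y : EuclideanSpace ℝ (Fin n)) (k : Fin n) :
    TangentSpace (𝓡 n) ((chartAt (EuclideanSpace ℝ (Fin n)) x₀).symm y) :=
  mfderiv (𝓡 n) (𝓡 n) (chartAt (EuclideanSpace ℝ (Fin n)) x₀).symm y
    (EuclideanSpace.single k (1 : ℝ) : EuclideanSpace ℝ (Fin n))

variable [RiemannianBundle (fun x : M ↦ TangentSpace (𝓡 n) x)]

/-- The matrix `(g_{kl})` of the Riemannian metric in the chart at `x₀`, at coordinates `y`. -/
def gramMatrix (x₀ : M) (y : EuclideanSpace ℝ (Fin n)) : Matrix (Fin n) (Fin n) ℝ :=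
  Matrix.of fun k l ↦ inner ℝ (coordVector x₀ y k) (coordVector x₀ y l)

variable [MeasurableSpace M]

/-- The measure `√(det g) dy` of the chart at `x₀`, as a measure on the manifold
that is carried by the domain of this chart. -/
def chartVolume (x₀ : M) : Measure M :=
  ((volume.restrict (chartAt (EuclideanSpace ℝ (Fin n)) x₀).target).withDensity
    fun y ↦ ENNReal.ofReal (√(gramMatrix x₀ y).det)).map
      (chartAt (EuclideanSpace ℝ (Fin n)) x₀).symm

variable (n M) in
/-- The Riemannian volume measure, given by `√(det g) dy` in every chart: the measures `√(det g) dy`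
of two charts agree on the overlap of their domains (change of variables), so that the least
measure above all of them restricts to each of them on the domain of the chart. -/
def riemannianVolume : Measure M := ⨆ x₀ : M, chartVolume (n := n) x₀

/-! ### Sobolev maps on the cylinders `G × (0, 1)` -/

/-- The (Frobenius) norm of a linear map on the tangent space `T_x M × ℝ` of the cylinder, with
respect to the product metric: the square root of the sum of `‖A e‖²` over an orthonormal basis. -/
def derivNorm {F : Type*} [NormedAddCommGroup F] [NormedSpace ℝ F] {x : M}
    (A : TangentSpace (𝓡 n) x × ℝ →L[ℝ] F) : ℝ :=
  haveI : FiniteDimensional ℝ (TangentSpace (𝓡 n) x) :=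
    inferInstanceAs (FiniteDimensional ℝ (EuclideanSpace ℝ (Fin n)))
  √((∑ k, ‖A (stdOrthonormalBasis ℝ (TangentSpace (𝓡 n) x) k, 0)‖ ^ 2) + ‖A (0, 1)‖ ^ 2)

end Riemannian

section Sobolev

variable {n : ℕ} {M : Type*} [TopologicalSpace M] [ChartedSpace (EuclideanSpace ℝ (Fin n)) M]
  {F : Type*} [NormedAddCommGroup F] [NormedSpace ℝ F]

/-- `DU` is the weak derivative of `U` on the cylinder `G × (0, 1)`, that is, the representative
of `U` in every local chart is weakly differentiable and its weak derivative is the representative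
of `DU`. Values outside of `G × (0, 1)` play no role. -/
def HasWeakDeriv (G : Set M) (U : M × ℝ → F)
    (DU : ∀ z : M × ℝ, TangentSpace (𝓡 n) z.1 × ℝ →L[ℝ] F) : Prop :=
  ∀ x₀ : M, HasWeakFDerivOn (E := EuclideanSpace ℝ (Fin n) × ℝ)
    (fun z ↦ U ((chartAt (EuclideanSpace ℝ (Fin n)) x₀).symm z.1, z.2))
    (fun z ↦ (DU ((chartAt (EuclideanSpace ℝ (Fin n)) x₀).symm z.1, z.2)).comp
      ((mfderiv (𝓡 n) (𝓡 n) (chartAt (EuclideanSpace ℝ (Fin n)) x₀).symm z.1).prodMap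
        (ContinuousLinearMap.id ℝ ℝ)))
    (((chartAt (EuclideanSpace ℝ (Fin n)) x₀).target ∩
      (chartAt (EuclideanSpace ℝ (Fin n)) x₀).symm ⁻¹' G) ×ˢ Ioo (0 : ℝ) 1)

variable [RiemannianBundle (fun x : M ↦ TangentSpace (𝓡 n) x)] [MeasurableSpace M]

/-- The energy `∫_{G × (0, 1)} |DU|^p`. -/
def energy (p : ℝ) (G : Set M)
    (DU : ∀ z : M × ℝ, TangentSpace (𝓡 n) z.1 × ℝ →L[ℝ] F) : ℝ≥0∞ :=
  ∫⁻ z in G ×ˢ Ioo (0 : ℝ) 1, ENNReal.ofReal (derivNorm (DU z) ^ p)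
    ∂((riemannianVolume n M).prod volume)

/-- `U` belongs to the homogeneous Sobolev space of order one on `G × (0, 1)`, with weak
derivative `DU` (which is determined by `U` almost everywhere on `G × (0, 1)`). -/
structure HasSobolevDeriv (p : ℝ) (G : Set M) (U : M × ℝ → F)
    (DU : ∀ z : M × ℝ, TangentSpace (𝓡 n) z.1 × ℝ →L[ℝ] F) : Prop where
  hasWeakDeriv : HasWeakDeriv G U DU
  energy_lt_top : energy p G DU < ⊤

variable (n) in
/-- `u` is the trace of `U` on `G × {0}`: the averages of `|U - u|` on the thin layers
`K × (0, ε)` tend to `0` for every compact subset `K` of `G`. Such a `u` is unique up to equality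
almost everywhere on `G`, and it is the restriction of `U` to `G × {0}`
if `U` is continuous up to `G × {0}`. -/
structure HasTrace (G : Set M) (U : M × ℝ → F) (u : M → F) : Prop where
  aestronglyMeasurable : AEStronglyMeasurable u ((riemannianVolume n M).restrict G)
  tendsto : ∀ K ⊆ G, IsCompact K →
    Tendsto (fun ε : ℝ ↦ ENNReal.ofReal ε⁻¹ *
        ∫⁻ z in K ×ˢ Ioo (0 : ℝ) ε, ‖U z - u z.1‖ₑ ∂((riemannianVolume n M).prod volume))
      (𝓝[>] 0) (𝓝 0)

end Sobolev

/-! ### The target manifold -/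

/-- `e` is a smooth isometric embedding of the Riemannian manifold `N` into a Euclidean space. -/
structure IsIsometricEmbedding {d ν : ℕ} {N : Type*} [TopologicalSpace N]
    [ChartedSpace (EuclideanSpace ℝ (Fin d)) N]
    [RiemannianBundle (fun y : N ↦ TangentSpace (𝓡 d) y)]
    (e : N → EuclideanSpace ℝ (Fin ν)) : Prop where
  contMDiff : ContMDiff (𝓡 d) (𝓡 ν) ∞ e
  isEmbedding : IsEmbedding e
  inner_mfderiv : ∀ (y : N) (v w : TangentSpace (𝓡 d) y),
    inner ℝ (show EuclideanSpace ℝ (Fin ν) from mfderiv (𝓡 d) (𝓡 ν) e y v)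
      (show EuclideanSpace ℝ (Fin ν) from mfderiv (𝓡 d) (𝓡 ν) e y w) = inner ℝ v w

end FoldingSobolev

end

/-!
# Gluing Sobolev maps along their traces

The maps are glued one after the other, so that the question is how to glue a map `f` on
`O × (0, 1)` to a map `g` on `G × (0, 1)` with the same trace `u` on the bottom, without leaving
the target manifold. As averaging is impossible there, the gluing is done by reparametrizing the
vertical fibres. Let `r ≥ 0` be a smooth function on the base with support in `G`. On the
fibre above `x`, the map `glueMap r f g` runs at unit speed through `g` from height `0` up to
height `r x / 2`, then back through `g` down to height `0`, and then through `f`, upwards from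
height `0`. Its values are values of `f` and `g`; it is equal to `f` where `r = 0` and does not
depend on `f` where `r ≥ 2`, so that it is defined above `O ∪ {r > 2}`. It is weakly
differentiable: it is so across the height `r x / 2` as an even reflection of `g`, and across the
height `r x` because the traces of `f` and `g` agree (`HasWeakFDerivOn.glue_hyperplane`, through
`HasWeakFDerivOn.glueMap`). Each of its three pieces is the composition of `f` or `g` with a shear
`(x, t) ↦ (x, ± t + ρ x)`, which preserves the measure and has a derivative bounded in terms of
that of `r`. This gives the bound of the energy (`exists_energy_glueDeriv_le`), and it also
shows that the trace is still `u` (`HasTrace.glueMap`).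

Gluing with cut-off functions taken from a partition of unity subordinate to the covering, in
finitely many steps, one covers the whole manifold (`exists_glue_finset`). The function `u` is built
beforehand. Every map of the family has a trace (`HasSobolevDeriv.exists_hasTrace`), because on
almost every fibre it is, almost everywhere, a constant plus the integral of its vertical
derivative. These traces are assembled along a partition of the manifold subordinate to a compact
refinement of the covering (`exists_common_trace`), so that the uniqueness of traces is not needed.

The passage between the manifold and its charts rests on `riemannianVolume_apply`: the Riemannian
volume has the density `√(det g)` in every chart, by the change of variables formula. On compact
parts of a chart, it is therefore comparable to the Lebesgue measure
(`exists_lintegral_chart_le`).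
-/

set_option linter.unusedSectionVars false

noncomputable section

namespace FoldingSobolev

/-! ### Calculus of weak derivatives -/

section WeakDeriv

variable {E F : Type*} [NormedAddCommGroup E] [NormedSpace ℝ E] [FiniteDimensional ℝ E]
  [MeasureSpace E] [BorelSpace E] [NormedAddCommGroup F] [NormedSpace ℝ F]

lemma integrable_smul_of_locallyIntegrableOn {f : E → F} {Ω : Set E}
    (hf : LocallyIntegrableOn f Ω) {φ : E → ℝ} (hφ : Continuous φ)
    (hc : HasCompactSupport φ) (hs : tsupport φ ⊆ Ω) :
    Integrable fun z ↦ φ z • f z := by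
  have h1 : IntegrableOn f (tsupport φ) := hf.integrableOn_compact_subset hs hc
  have h2 : IntegrableOn (fun z ↦ φ z • f z) (tsupport φ) :=
    h1.continuousOn_smul hφ.continuousOn hc
  refine (integrableOn_iff_integrable_of_support_subset ?_).1 h2
  intro z hz
  refine subset_tsupport φ ?_
  intro h0
  exact hz (by simp [h0])

lemma tsupport_fderiv_apply_subset' (ψ : E → ℝ) (v : E) :
    tsupport (fun z ↦ fderiv ℝ ψ z v) ⊆ tsupport ψ := by
  refine closure_minimal ?_ (isClosed_tsupport ψ)
  intro z hz
  refine support_fderiv_subset ℝ ?_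
  intro h0
  exact hz (by simp [h0])

lemma HasCompactSupport.fderiv_apply' {ψ : E → ℝ} (hc : HasCompactSupport ψ) (v : E) :
    HasCompactSupport (fun z ↦ fderiv ℝ ψ z v) :=
  hc.of_isClosed_subset (isClosed_tsupport _) (tsupport_fderiv_apply_subset' ψ v)

lemma continuous_fderiv_apply' {ψ : E → ℝ} (hψ : ContDiff ℝ ∞ ψ) (v : E) :
    Continuous fun z ↦ fderiv ℝ ψ z v :=
  (hψ.continuous_fderiv (by simp)).clm_apply continuous_const

lemma integrable_fderiv_smul {f : E → F} {Ω : Set E}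
    (hf : LocallyIntegrableOn f Ω) {ψ : E → ℝ} (hψ : ContDiff ℝ ∞ ψ)
    (hc : HasCompactSupport ψ) (hs : tsupport ψ ⊆ Ω) (v : E) :
    Integrable fun z ↦ fderiv ℝ ψ z v • f z :=
  integrable_smul_of_locallyIntegrableOn hf (continuous_fderiv_apply' hψ v)
    (HasCompactSupport.fderiv_apply' hc v) ((tsupport_fderiv_apply_subset' ψ v).trans hs)

lemma LocallyIntegrableOn.clm_apply_const {f' : E → E →L[ℝ] F} {Ω : Set E}
    (hf : LocallyIntegrableOn f' Ω) (v : E) : LocallyIntegrableOn (fun z ↦ f' z v) Ω := by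
  intro x hx
  obtain ⟨s, hs, hi⟩ := hf x hx
  exact ⟨s, hs, hi.apply_continuousLinearMap v⟩

lemma integrable_smul_deriv {f' : E → E →L[ℝ] F} {Ω : Set E}
    (hf : LocallyIntegrableOn f' Ω) {ψ : E → ℝ} (hψ : ContDiff ℝ ∞ ψ)
    (hc : HasCompactSupport ψ) (hs : tsupport ψ ⊆ Ω) (v : E) :
    Integrable fun z ↦ ψ z • f' z v :=
  integrable_smul_of_locallyIntegrableOn (LocallyIntegrableOn.clm_apply_const hf v)
    hψ.continuous hc hs

lemma HasWeakFDerivOn.mono {f : E → F} {f' : E → E →L[ℝ] F} {Ω Ω' : Set E}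
    (h : HasWeakFDerivOn f f' Ω) (hs : Ω' ⊆ Ω) : HasWeakFDerivOn f f' Ω' :=
  ⟨h.1.mono_set hs, h.2.mono_set hs, fun ψ h1 h2 h3 v ↦ h.3 ψ h1 h2 (h3.trans hs) v⟩

lemma LocallyIntegrableOn.congr_on {G : Type*} [NormedAddCommGroup G] {f g : E → G} {Ω : Set E}
    (hΩ : IsOpen Ω)
    (h : LocallyIntegrableOn f Ω) (hfg : EqOn f g Ω) : LocallyIntegrableOn g Ω := by
  intro x hx
  obtain ⟨s, hs, hi⟩ := h x hx
  refine ⟨s ∩ Ω, inter_mem hs self_mem_nhdsWithin, ?_⟩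
  have h2 : EqOn f g (s ∩ Ω) := fun z hz ↦ hfg hz.2
  have h3 : f =ᵐ[volume.restrict (s ∩ Ω)] g := by
    have : f =ᵐ[(volume.restrict s).restrict Ω] g := by
      filter_upwards [ae_restrict_mem hΩ.measurableSet] with z hz using hfg hz
    rwa [Measure.restrict_restrict hΩ.measurableSet, inter_comm] at this
  exact (hi.mono_set inter_subset_left).congr h3

/-- A weak derivative on `Ω` only depends on the restrictions of both functions to `Ω`. -/
lemma HasWeakFDerivOn.congr {f g : E → F} {f' g' : E → E →L[ℝ] F} {Ω : Set E} (hΩ : IsOpen Ω)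
    (h : HasWeakFDerivOn f f' Ω) (hf : EqOn f g Ω) (hf' : EqOn f' g' Ω) :
    HasWeakFDerivOn g g' Ω := by
  refine ⟨LocallyIntegrableOn.congr_on hΩ h.1 hf, LocallyIntegrableOn.congr_on hΩ h.2 hf', ?_⟩
  intro ψ h1 h2 h3 v
  have e1 : ∀ z, fderiv ℝ ψ z v • g z = fderiv ℝ ψ z v • f z := by
    intro z
    by_cases hz : z ∈ Ω
    · rw [hf hz]
    · have : fderiv ℝ ψ z v = 0 := by
        by_contra h0
        exact hz (h3 (tsupport_fderiv_apply_subset' ψ v (subset_tsupport _ h0)))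
      simp [this]
  have e2 : ∀ z, ψ z • g' z v = ψ z • f' z v := by
    intro z
    by_cases hz : z ∈ Ω
    · rw [hf' hz]
    · have : ψ z = 0 := by
        by_contra h0
        exact hz (h3 (subset_tsupport _ h0))
      simp [this]
  simp only [e1, e2]
  exact h.3 ψ h1 h2 h3 v

/-- Weak differentiability is a local property: test functions are decomposed by means of a
smooth partition of unity. -/
lemma hasWeakFDerivOn_of_locally {f : E → F} {f' : E → E →L[ℝ] F} {Ω : Set E}
    (h : ∀ z ∈ Ω, ∃ O : Set E, IsOpen O ∧ z ∈ O ∧ HasWeakFDerivOn f f' O) :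
    HasWeakFDerivOn f f' Ω := by
  have hl1 : LocallyIntegrableOn f Ω := by
    intro z hz
    obtain ⟨O, hO, hzO, hw⟩ := h z hz
    obtain ⟨s, hs, hi⟩ := hw.1 z hzO
    rw [hO.nhdsWithin_eq hzO] at hs
    exact ⟨s, mem_nhdsWithin_of_mem_nhds hs, hi⟩
  have hl2 : LocallyIntegrableOn f' Ω := by
    intro z hz
    obtain ⟨O, hO, hzO, hw⟩ := h z hz
    obtain ⟨s, hs, hi⟩ := hw.2 z hzO
    rw [hO.nhdsWithin_eq hzO] at hs
    exact ⟨s, mem_nhdsWithin_of_mem_nhds hs, hi⟩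
  refine ⟨hl1, hl2, ?_⟩
  intro ψ hψ hc hs v
  choose! O hO hzO hw using h
  obtain ⟨t, htc⟩ := hc.isCompact.elim_nhds_subcover' (fun z _ ↦ O z)
    (fun z hz ↦ (hO z (hs hz)).mem_nhds (hzO z (hs hz)))
  obtain ⟨ρ, hρ⟩ := SmoothPartitionOfUnity.exists_isSubordinate 𝓘(ℝ, E) (isClosed_tsupport ψ)
    (fun i : t ↦ O i.1) (fun i ↦ hO _ (hs i.1.2)) (by
      intro z hz
      have := htc hz
      simp only [mem_iUnion] at this ⊢
      obtain ⟨i, hi, hzi⟩ := this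
      exact ⟨⟨i, hi⟩, hzi⟩)
  have hsm : ∀ i, ContDiff ℝ ∞ fun z ↦ ρ i z * ψ z := fun i ↦
    (contMDiff_iff_contDiff.1 (ρ i).contMDiff).mul hψ
  have hcs : ∀ i, HasCompactSupport fun z ↦ ρ i z * ψ z := fun i ↦ hc.mul_left
  have hsub : ∀ i, tsupport (fun z ↦ ρ i z * ψ z) ⊆ O i.1 := fun i ↦
    (tsupport_mul_subset_left).trans (hρ i)
  have hsub' : ∀ i, tsupport (fun z ↦ ρ i z * ψ z) ⊆ Ω := fun i ↦
    (tsupport_mul_subset_right).trans hs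
  have hsum : ψ = fun z ↦ ∑ i, ρ i z * ψ z := by
    funext z
    by_cases hz : z ∈ tsupport ψ
    · have := ρ.sum_eq_one hz
      rw [finsum_eq_sum_of_fintype] at this
      rw [← Finset.sum_mul, this, one_mul]
    · simp [image_eq_zero_of_notMem_tsupport hz]
  have hder : ∀ z, fderiv ℝ ψ z v = ∑ i, fderiv ℝ (fun z ↦ ρ i z * ψ z) z v := by
    intro z
    conv_lhs => rw [hsum]
    rw [fderiv_fun_sum (fun i _ ↦ ((hsm i).differentiable (by simp)).differentiableAt)]
    simp
  have e1 : ∫ z, fderiv ℝ ψ z v • f z =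
      ∑ i, ∫ z, fderiv ℝ (fun z ↦ ρ i z * ψ z) z v • f z := by
    rw [← integral_finsetSum _ (fun i _ ↦ integrable_fderiv_smul hl1 (hsm i) (hcs i) (hsub' i) v)]
    refine integral_congr_ae (Eventually.of_forall fun z ↦ ?_)
    simp only [hder z, Finset.sum_smul]
  have e2 : ∫ z, ψ z • f' z v = ∑ i, ∫ z, (ρ i z * ψ z) • f' z v := by
    rw [← integral_finsetSum _ (fun i _ ↦ integrable_smul_deriv hl2 (hsm i) (hcs i) (hsub' i) v)]
    refine integral_congr_ae (Eventually.of_forall fun z ↦ ?_)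
    simp only
    conv_lhs => rw [hsum]
    simp only [Finset.sum_smul]
  rw [e1, e2, ← Finset.sum_neg_distrib]
  exact Finset.sum_congr rfl fun i _ ↦ (hw i.1 (hs i.1.2)).3 _ (hsm i) (hcs i) (hsub i) v

end WeakDeriv

/-! ### Vertical shears and reflections of a cylinder -/

section Shear

variable {X : Type*}

/-- The vertical shear `(x, t) ↦ (x, σ t + ρ x)` of a cylinder; it is used for `σ = 1`
and for `σ = -1`, when it includes a reflection. -/
def fiberShear (σ : ℝ) (ρ : X → ℝ) (z : X × ℝ) : X × ℝ := (z.1, σ * z.2 + ρ z.1)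

lemma fiberShear_leftInverse {σ : ℝ} (hσ : σ * σ = 1) (ρ : X → ℝ) (z : X × ℝ) :
    fiberShear σ (fun x ↦ -σ * ρ x) (fiberShear σ ρ z) = z := by
  ext
  · rfl
  · simp only [fiberShear]
    linear_combination z.2 * hσ

lemma fiberShear_rightInverse {σ : ℝ} (hσ : σ * σ = 1) (ρ : X → ℝ) (z : X × ℝ) :
    fiberShear σ ρ (fiberShear σ (fun x ↦ -σ * ρ x) z) = z := by
  ext
  · rfl
  · simp only [fiberShear]
    linear_combination (z.2 - ρ z.1) * hσ

variable [MeasurableSpace X]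

lemma measurable_fiberShear (σ : ℝ) {ρ : X → ℝ} (hρ : Measurable ρ) :
    Measurable (fiberShear σ ρ) :=
  measurable_fst.prodMk ((measurable_snd.const_mul σ).add (hρ.comp measurable_fst))

lemma measurableEmbedding_fiberShear {σ : ℝ} (hσ : σ * σ = 1) {ρ : X → ℝ} (hρ : Measurable ρ) :
    MeasurableEmbedding (fiberShear σ ρ) :=
  (MeasurableEquiv.mk ⟨fiberShear σ ρ, fiberShear σ (fun x ↦ -σ * ρ x),
    fiberShear_leftInverse hσ ρ, fiberShear_rightInverse hσ ρ⟩ (measurable_fiberShear σ hρ)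
    (measurable_fiberShear σ (hρ.const_mul _))).measurableEmbedding

lemma measurePreserving_fiberShear {σ : ℝ} (hσ : σ * σ = 1) {ρ : X → ℝ} (hρ : Measurable ρ)
    (μ : Measure X) [SFinite μ] :
    MeasurePreserving (fiberShear σ ρ) (μ.prod volume) (μ.prod volume) := by
  refine (MeasurePreserving.id μ).skew_product (g := fun x t ↦ σ * t + ρ x)
    ((measurable_snd.const_mul σ).add (hρ.comp measurable_fst)) (Eventually.of_forall fun x ↦ ?_)
  have h1 : Measure.map (fun t : ℝ ↦ σ * t) volume = volume := by
    have hσ0 : σ ≠ 0 := by rintro rfl; simp at hσ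
    have h2 : |σ⁻¹| = 1 := by
      have : |σ| = 1 := by
        have h3 : |σ| * |σ| = 1 := by rw [← abs_mul, hσ, abs_one]
        nlinarith [abs_nonneg σ]
      rw [abs_inv, this, inv_one]
    have := Real.map_volume_mul_left hσ0
    rw [this, h2]
    simp
  have h2 : (fun t : ℝ ↦ σ * t + ρ x) = (fun s ↦ s + ρ x) ∘ fun t ↦ σ * t := rfl
  rw [h2, ← Measure.map_map (measurable_add_const _) (measurable_const_mul _), h1]
  exact (measurePreserving_add_right volume (ρ x)).map_eq

end Shear

section WeakDerivShear

variable {E F : Type*} [NormedAddCommGroup E] [NormedSpace ℝ E] [FiniteDimensional ℝ E]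
  [NormedAddCommGroup F] [NormedSpace ℝ F]

lemma contDiff_fiberShear (σ : ℝ) {ρ : E → ℝ} (hρ : ContDiff ℝ ∞ ρ) :
    ContDiff ℝ ∞ (fiberShear σ ρ) :=
  contDiff_fst.prodMk ((contDiff_const.mul contDiff_snd).add (hρ.comp contDiff_fst))

/-- The derivative of the vertical shear `(x, t) ↦ (x, σ t + ρ x)` at a point where the derivative
of `ρ` is `dρ`. -/
def shearDeriv {T : Type*} [AddCommGroup T] [Module ℝ T] [TopologicalSpace T]
    (σ : ℝ) (dρ : T →L[ℝ] ℝ) : T × ℝ →L[ℝ] T × ℝ :=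
  (ContinuousLinearMap.fst ℝ T ℝ).prod
    (σ • ContinuousLinearMap.snd ℝ T ℝ + dρ.comp (ContinuousLinearMap.fst ℝ T ℝ))

@[simp] lemma shearDeriv_apply {T : Type*} [AddCommGroup T] [Module ℝ T] [TopologicalSpace T]
    (σ : ℝ) (dρ : T →L[ℝ] ℝ) (v : T × ℝ) : shearDeriv σ dρ v = (v.1, σ * v.2 + dρ v.1) := by
  simp [shearDeriv]

lemma hasFDerivAt_fiberShear (σ : ℝ) {ρ : E → ℝ} (hρ : ContDiff ℝ ∞ ρ) (z : E × ℝ) :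
    HasFDerivAt (fiberShear σ ρ) (shearDeriv σ (fderiv ℝ ρ z.1)) z := by
  have h1 : HasFDerivAt ρ (fderiv ℝ ρ z.1) z.1 :=
    (hρ.differentiable (by simp)).differentiableAt.hasFDerivAt
  exact hasFDerivAt_fst.prodMk ((hasFDerivAt_snd.const_mul σ).add (h1.comp z hasFDerivAt_fst))

variable [MeasureSpace E] [BorelSpace E] [SFinite (volume : Measure E)]

lemma integrableOn_clm_comp {f' : E → E →L[ℝ] F} {D : E → E →L[ℝ] E} {K : Set E}
    (hK : IsCompact K) (hf : IntegrableOn f' K) (hD : Continuous D) :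
    IntegrableOn (fun z ↦ (f' z).comp (D z)) K := by
  obtain ⟨C, hC⟩ := hK.exists_bound_of_continuousOn hD.continuousOn
  refine (hf.norm.const_mul C).mono' ?_ ?_
  · exact (ContinuousLinearMap.compL ℝ E E F).aestronglyMeasurable_comp₂ hf.1
      (hD.aestronglyMeasurable)
  · filter_upwards [ae_restrict_mem hK.measurableSet] with z hz
    calc ‖(f' z).comp (D z)‖ ≤ ‖f' z‖ * ‖D z‖ := ContinuousLinearMap.opNorm_comp_le _ _
      _ ≤ C * ‖f' z‖ := by
        rw [mul_comm]; exact mul_le_mul_of_nonneg_right (hC z hz) (norm_nonneg _)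

lemma locallyIntegrableOn_comp_fiberShear {G : Type*} [NormedAddCommGroup G]
    {f : E × ℝ → G} {Ω : Set (E × ℝ)}
    (hf : LocallyIntegrableOn f Ω) {σ : ℝ} (hσ : σ * σ = 1)
    {ρ : E → ℝ} (hρ : Continuous ρ) :
    LocallyIntegrableOn (f ∘ fiberShear σ ρ) (fiberShear σ ρ ⁻¹' Ω) := by
  intro z hz
  obtain ⟨s, hs, hi⟩ := hf _ hz
  have hc : Continuous (fiberShear σ ρ) :=
    continuous_fst.prodMk ((continuous_const.mul continuous_snd).add (hρ.comp continuous_fst))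
  refine ⟨fiberShear σ ρ ⁻¹' s, ?_, ?_⟩
  · exact hc.continuousWithinAt.preimage_mem_nhdsWithin' (by
      exact nhdsWithin_mono _ (image_preimage_subset _ _) hs)
  · exact ((measurePreserving_fiberShear hσ hρ.measurable volume).integrableOn_comp_preimage
      (measurableEmbedding_fiberShear hσ hρ.measurable)).2 hi

/-- Chain rule for the composition with a smooth vertical shear, by transport of the test
functions. -/
lemma HasWeakFDerivOn.comp_fiberShear {f : E × ℝ → F} {f' : E × ℝ → E × ℝ →L[ℝ] F}
    {Ω : Set (E × ℝ)} (hΩ : IsOpen Ω)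
    (h : HasWeakFDerivOn f f' Ω) {σ : ℝ} (hσ : σ * σ = 1) {ρ : E → ℝ} (hρ : ContDiff ℝ ∞ ρ) :
    HasWeakFDerivOn (f ∘ fiberShear σ ρ)
      (fun z ↦ (f' (fiberShear σ ρ z)).comp (shearDeriv σ (fderiv ℝ ρ z.1)))
      (fiberShear σ ρ ⁻¹' Ω) := by
  have hcΦ : Continuous (fiberShear σ ρ) := (contDiff_fiberShear σ hρ).continuous
  have hρ' : ContDiff ℝ ∞ fun x ↦ -σ * ρ x := contDiff_const.mul hρ
  have hdρ : ContDiff ℝ ∞ (fderiv ℝ ρ) := hρ.fderiv_right (by simp)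
  have hl' := locallyIntegrableOn_comp_fiberShear h.2 hσ hρ.continuous
  refine ⟨locallyIntegrableOn_comp_fiberShear h.1 hσ hρ.continuous, ?_, ?_⟩
  · refine (locallyIntegrableOn_iff (hΩ.preimage hcΦ).isLocallyClosed).2 fun K hK hKc ↦ ?_
    refine integrableOn_clm_comp hKc (hl'.integrableOn_compact_subset hK hKc) ?_
    refine ((contDiff_fiberShear σ hρ).continuous_fderiv (by simp)).congr fun z ↦ ?_
    exact (hasFDerivAt_fiberShear σ hρ z).fderiv
  · intro ψ hψ hc hs v
    set Ψ := fiberShear σ (fun x ↦ -σ * ρ x) with hΨ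
    have hcd : ContDiff ℝ ∞ (ψ ∘ Ψ) := hψ.comp (contDiff_fiberShear σ hρ')
    let e : E × ℝ ≃ₜ E × ℝ := ⟨⟨Ψ, fiberShear σ ρ, fiberShear_rightInverse hσ ρ,
      fiberShear_leftInverse hσ ρ⟩, (contDiff_fiberShear σ hρ').continuous, hcΦ⟩
    have hcs : HasCompactSupport (ψ ∘ Ψ) := hc.comp_homeomorph e
    have hts : tsupport (ψ ∘ Ψ) ⊆ Ω := by
      have := tsupport_comp_eq_preimage ψ e
      change tsupport (ψ ∘ e) ⊆ Ω
      rw [this]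
      intro w hw
      have := hs hw
      change fiberShear σ ρ (Ψ w) ∈ Ω at this
      rwa [hΨ, fiberShear_rightInverse hσ] at this
    -- the derivative of `ψ` in the direction `v` is the derivative of `ψ ∘ Ψ` in a direction
    -- whose last component depends on the base point only
    have hψe : ψ = (ψ ∘ Ψ) ∘ fiberShear σ ρ := by
      funext z
      exact (congrArg ψ (fiberShear_leftInverse hσ ρ z)).symm
    set c : E × ℝ → ℝ := fun w ↦ fderiv ℝ ρ w.1 v.1 with hcdef
    have hccd : ContDiff ℝ ∞ c := (hdρ.comp contDiff_fst).clm_apply contDiff_const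
    set η : E × ℝ → ℝ := fun w ↦ c w * (ψ ∘ Ψ) w with hη
    have hηcd : ContDiff ℝ ∞ η := hccd.mul hcd
    have hηc : HasCompactSupport η := hcs.mul_left
    have hηs : tsupport η ⊆ Ω := tsupport_mul_subset_right.trans hts
    have hηd : ∀ w, fderiv ℝ η w (0, 1) = c w * fderiv ℝ (ψ ∘ Ψ) w (0, 1) := by
      intro w
      have h1 : HasFDerivAt (ψ ∘ Ψ) (fderiv ℝ (ψ ∘ Ψ) w) w :=
        (hcd.differentiable (by simp)).differentiableAt.hasFDerivAt
      have h2 : HasFDerivAt c (fderiv ℝ c w) w :=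
        (hccd.differentiable (by simp)).differentiableAt.hasFDerivAt
      have h3 : fderiv ℝ c w (0, 1) = 0 := by
        have h4 : c = (fun x ↦ fderiv ℝ ρ x v.1) ∘ Prod.fst := rfl
        have h5 : DifferentiableAt ℝ (fun x ↦ fderiv ℝ ρ x v.1) w.1 :=
          ((hdρ.differentiable (by simp)).differentiableAt).clm_apply
            (differentiableAt_const _)
        rw [h4, fderiv_comp _ h5 differentiableAt_fst, fderiv_fst]
        simp
      have h4 := (h2.mul h1).fderiv
      change fderiv ℝ η w = _ at h4
      rw [h4]
      simp [h3]
    have hD : ∀ z, fderiv ℝ ψ z v = fderiv ℝ (ψ ∘ Ψ) (fiberShear σ ρ z) (v.1, σ * v.2) +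
        fderiv ℝ η (fiberShear σ ρ z) (0, 1) := by
      intro z
      have h1 : HasFDerivAt (ψ ∘ Ψ) (fderiv ℝ (ψ ∘ Ψ) (fiberShear σ ρ z)) (fiberShear σ ρ z) :=
        (hcd.differentiable (by simp)).differentiableAt.hasFDerivAt
      have h2 := (h1.comp z (hasFDerivAt_fiberShear σ hρ z)).fderiv
      rw [← hψe] at h2
      rw [h2, hηd]
      simp only [ContinuousLinearMap.comp_apply, shearDeriv_apply]
      have h6 : ((v.1, σ * v.2 + fderiv ℝ ρ z.1 v.1) : E × ℝ) =
          (v.1, σ * v.2) + (fderiv ℝ ρ z.1 v.1) • (0, 1) := by simp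
      rw [h6, map_add, map_smul]
      rfl
    have hmp : MeasurePreserving (fiberShear σ ρ) (volume : Measure (E × ℝ)) volume :=
      measurePreserving_fiberShear hσ hρ.continuous.measurable volume
    have hme := measurableEmbedding_fiberShear hσ hρ.continuous.measurable
    have e1 : ∫ z, fderiv ℝ ψ z v • (f ∘ fiberShear σ ρ) z =
        ∫ w, (fderiv ℝ (ψ ∘ Ψ) w (v.1, σ * v.2) + fderiv ℝ η w (0, 1)) • f w := by
      refine Eq.trans ?_ (hmp.integral_comp hme _)
      simp only [hD]
      rfl
    have e2 : ∫ z, ψ z • ((f' (fiberShear σ ρ z)).comp (shearDeriv σ (fderiv ℝ ρ z.1))) v =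
        ∫ w, ((ψ ∘ Ψ) w • f' w (v.1, σ * v.2) + η w • f' w (0, 1)) := by
      refine Eq.trans ?_ (hmp.integral_comp hme _)
      refine integral_congr_ae (Eventually.of_forall fun z ↦ ?_)
      have h6 : ((v.1, σ * v.2 + fderiv ℝ ρ z.1 v.1) : E × ℝ) =
          (v.1, σ * v.2) + (fderiv ℝ ρ z.1 v.1) • (0, 1) := by simp
      have h7 : (ψ ∘ Ψ) (fiberShear σ ρ z) = ψ z := (congrFun hψe z).symm
      have h8 : c (fiberShear σ ρ z) = fderiv ℝ ρ z.1 v.1 := rfl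
      simp only [ContinuousLinearMap.comp_apply, shearDeriv_apply, hη, h7, h8]
      rw [h6, map_add, map_smul, smul_add, smul_smul, mul_comm (ψ z)]
    rw [e1, e2, integral_add (integrable_smul_deriv h.2 hcd hcs hts _)
      (integrable_smul_deriv h.2 hηcd hηc hηs _)]
    simp only [add_smul]
    rw [integral_add (integrable_fderiv_smul h.1 hcd hcs hts _)
      (integrable_fderiv_smul h.1 hηcd hηc hηs _),
      h.3 _ hcd hcs hts, h.3 _ hηcd hηc hηs, neg_add]

end WeakDerivShear

/-! ### Gluing weakly differentiable functions along a hyperplane -/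

section Cutoff

/-- A smooth even bump function on the line, equal to `1` near `0` and supported in `[-1, 1]`. -/
def lineBump : ContDiffBump (0 : ℝ) := ⟨1 / 2, 1, by norm_num, by norm_num⟩

lemma lineBump_neg (t : ℝ) : lineBump (-t) = lineBump t := lineBump.neg t

lemma contDiff_lineBump : ContDiff ℝ ∞ lineBump := lineBump.contDiff

lemma hasDerivAt_lineBump (t : ℝ) : HasDerivAt lineBump (deriv lineBump t) t :=
  (contDiff_lineBump.differentiable (by simp)).differentiableAt.hasDerivAt

lemma deriv_lineBump_neg (t : ℝ) : deriv lineBump (-t) = -deriv lineBump t := by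
  have h1 : (fun s ↦ lineBump (-s)) = lineBump := funext lineBump_neg
  have h2 := deriv_comp_neg (f := (lineBump : ℝ → ℝ)) t
  rw [h1] at h2
  rw [h2, neg_neg]

lemma lineBump_eq_zero {t : ℝ} (ht : 1 ≤ |t|) : lineBump t = 0 := by
  apply lineBump.zero_of_le_dist
  rwa [Real.dist_eq, sub_zero]

lemma deriv_lineBump_eq_zero {t : ℝ} (ht : 1 ≤ |t|) : deriv lineBump t = 0 := by
  have h1 : IsLocalMin lineBump t := Eventually.of_forall fun s ↦ by
    rw [lineBump_eq_zero ht]; exact lineBump.nonneg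
  exact h1.deriv_eq_zero

lemma exists_bound_deriv_lineBump : ∃ C : ℝ, 0 ≤ C ∧ ∀ t, |deriv lineBump t| ≤ C := by
  have h1 : Continuous (deriv lineBump) := contDiff_lineBump.continuous_deriv (by simp)
  have h2 : HasCompactSupport (deriv (lineBump : ℝ → ℝ)) :=
    HasCompactSupport.deriv (lineBump.hasCompactSupport)
  obtain ⟨C, hC⟩ := h1.bounded_above_of_compact_support h2
  exact ⟨C, (norm_nonneg _).trans (hC 0), hC⟩

lemma lineBump_eq_one {t : ℝ} (ht : |t| ≤ 1 / 2) : lineBump t = 1 := by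
  apply lineBump.one_of_mem_closedBall
  rw [Metric.mem_closedBall, Real.dist_eq, sub_zero]
  exact ht

end Cutoff

section Glue

variable {E F : Type*} [NormedAddCommGroup E] [NormedSpace ℝ E] [FiniteDimensional ℝ E]
  [MeasureSpace E] [BorelSpace E] [SFinite (volume : Measure E)]
  [IsFiniteMeasureOnCompacts (volume : Measure E)]
  [NormedAddCommGroup F] [NormedSpace ℝ F]

lemma setLIntegral_reflect (A : Set (E × ℝ)) (g : E × ℝ → ℝ≥0∞) :
    ∫⁻ z in (fun z : E × ℝ ↦ (z.1, -z.2)) ⁻¹' A, g (z.1, -z.2) = ∫⁻ z in A, g z := by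
  have h1 : fiberShear (-1) (fun _ : E ↦ 0) = fun z : E × ℝ ↦ (z.1, -z.2) := by
    funext z; simp [fiberShear]
  have hmp : MeasurePreserving (fiberShear (-1) (fun _ : E ↦ 0)) (volume : Measure (E × ℝ)) volume :=
    measurePreserving_fiberShear (by norm_num) measurable_const volume
  have hme := measurableEmbedding_fiberShear (X := E) (σ := -1) (by norm_num)
    (measurable_const (a := (0 : ℝ)))
  rw [h1] at hmp hme
  exact hmp.setLIntegral_comp_preimage_emb hme g A

lemma integral_reflect (g : E × ℝ → F) :
    ∫ z : E × ℝ, g (z.1, -z.2) = ∫ z, g z := by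
  have h1 : fiberShear (-1) (fun _ : E ↦ 0) = fun z : E × ℝ ↦ (z.1, -z.2) := by
    funext z; simp [fiberShear]
  have hmp : MeasurePreserving (fiberShear (-1) (fun _ : E ↦ 0)) (volume : Measure (E × ℝ)) volume :=
    measurePreserving_fiberShear (by norm_num) measurable_const volume
  have hme := measurableEmbedding_fiberShear (X := E) (σ := -1) (by norm_num)
    (measurable_const (a := (0 : ℝ)))
  rw [h1] at hmp hme
  exact hmp.integral_comp hme g

lemma integrable_reflect {g : E × ℝ → F} (hg : Integrable g) :
    Integrable fun z : E × ℝ ↦ g (z.1, -z.2) := by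
  have h1 : fiberShear (-1) (fun _ : E ↦ 0) = fun z : E × ℝ ↦ (z.1, -z.2) := by
    funext z; simp [fiberShear]
  have hmp : MeasurePreserving (fiberShear (-1) (fun _ : E ↦ 0)) (volume : Measure (E × ℝ)) volume :=
    measurePreserving_fiberShear (by norm_num) measurable_const volume
  rw [h1] at hmp
  exact hmp.integrable_comp_of_integrable hg

lemma ae_snd_ne_zero : ∀ᵐ z : E × ℝ, z.2 ≠ 0 := by
  have h1 : ∀ᵐ t : ℝ, t ≠ 0 := by simp [ae_iff]
  exact Measure.quasiMeasurePreserving_snd.ae h1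

lemma tendsto_setLIntegral_slab {h : E × ℝ → F} {K : Set E} (hK : IsCompact K) {δ : ℝ}
    (hi : IntegrableOn h (K ×ˢ Icc (-δ) δ)) (hδ : 0 < δ) :
    Tendsto (fun ε : ℝ ↦ ∫⁻ z in K ×ˢ Ioo (-ε) ε, ‖h z‖ₑ) (𝓝[>] 0) (𝓝 0) := by
  have h1 : Tendsto (fun ε : ℝ ↦ (volume.restrict (K ×ˢ Icc (-δ) δ)) (K ×ˢ Ioo (-ε) ε))
      (𝓝[>] 0) (𝓝 0) := by
    have h2 : Tendsto (fun ε : ℝ ↦ volume K * ENNReal.ofReal (2 * ε)) (𝓝[>] 0) (𝓝 0) := by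
      have : Tendsto (fun ε : ℝ ↦ ENNReal.ofReal (2 * ε)) (𝓝[>] 0) (𝓝 0) := by
        have h3 : Tendsto (fun ε : ℝ ↦ ENNReal.ofReal (2 * ε)) (𝓝 0)
            (𝓝 (ENNReal.ofReal (2 * 0))) :=
          (ENNReal.continuous_ofReal.comp (continuous_const.mul continuous_id)).tendsto 0
        simp only [mul_zero, ENNReal.ofReal_zero] at h3
        exact h3.mono_left nhdsWithin_le_nhds
      have h4 := ENNReal.Tendsto.const_mul this (Or.inr (hK.measure_lt_top (μ := (volume : Measure E))).ne)
      rwa [mul_zero] at h4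
    refine tendsto_of_tendsto_of_tendsto_of_le_of_le tendsto_const_nhds h2 (fun _ ↦ zero_le)
      fun ε ↦ ?_
    refine (Measure.restrict_apply_le (K ×ˢ Icc (-δ) δ) (K ×ˢ Ioo (-ε) ε)).trans ?_
    rw [Measure.volume_eq_prod, Measure.prod_prod, Real.volume_Ioo]
    rw [show ε - -ε = 2 * ε by ring]
  have h5 := tendsto_setLIntegral_zero (f := fun z ↦ ‖h z‖ₑ) hi.2.ne h1
  refine h5.congr' ?_
  filter_upwards [Ioo_mem_nhdsGT hδ] with ε hε
  rw [Measure.restrict_restrict (hK.measurableSet.prod measurableSet_Ioo)]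
  rw [inter_eq_left.2]
  exact prod_mono le_rfl (Ioo_subset_Icc_self.trans (Icc_subset_Icc (by linarith [hε.2]) hε.2.le))

/-- Gluing along the hyperplane `{t = 0}`: a function which is weakly differentiable on both sides
is weakly differentiable across it if its jump tends to `0` in the sense of averages on thin
layers. The test function is multiplied by an even cutoff function of `t / ε`. -/
lemma HasWeakFDerivOn.glue_hyperplane {h : E × ℝ → F} {h' : E × ℝ → E × ℝ →L[ℝ] F} {Ω : Set E}
    (hΩ : IsOpen Ω) {δ : ℝ}
    (hl : LocallyIntegrableOn h (Ω ×ˢ Ioo (-δ) δ)) (hl' : LocallyIntegrableOn h' (Ω ×ˢ Ioo (-δ) δ))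
    (hpos : HasWeakFDerivOn h h' (Ω ×ˢ Ioo 0 δ)) (hneg : HasWeakFDerivOn h h' (Ω ×ˢ Ioo (-δ) 0))
    (hjump : ∀ K ⊆ Ω, IsCompact K → Tendsto (fun ε : ℝ ↦ ENNReal.ofReal ε⁻¹ *
      ∫⁻ z in K ×ˢ Ioo (0 : ℝ) ε, ‖h z - h (z.1, -z.2)‖ₑ) (𝓝[>] 0) (𝓝 0)) :
    HasWeakFDerivOn h h' (Ω ×ˢ Ioo (-δ) δ) := by
  refine ⟨hl, hl', ?_⟩
  intro ψ hψ hc hs v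
  -- weak differentiability away from the hyperplane
  have hoff : HasWeakFDerivOn h h' ((Ω ×ˢ Ioo (-δ) δ) ∩ {z | z.2 ≠ 0}) := by
    refine hasWeakFDerivOn_of_locally fun z hz ↦ ?_
    rcases lt_or_gt_of_ne hz.2 with h0 | h0
    · exact ⟨_, hΩ.prod isOpen_Ioo, ⟨hz.1.1, hz.1.2.1, h0⟩, hneg⟩
    · exact ⟨_, hΩ.prod isOpen_Ioo, ⟨hz.1.1, h0, hz.1.2.2⟩, hpos⟩
  set K : Set E := Prod.fst '' tsupport ψ with hKdef
  have hK : IsCompact K := hc.isCompact.image continuous_fst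
  have hKΩ : K ⊆ Ω := by
    rintro _ ⟨z, hz, rfl⟩
    exact (hs hz).1
  by_cases hne : tsupport ψ = ∅
  · have : ψ = 0 := tsupport_eq_empty_iff.1 hne
    simp [this]
  have hδ : 0 < δ := by
    obtain ⟨z, hz⟩ := nonempty_iff_ne_empty.2 hne
    have := (hs hz).2
    linarith [this.1, this.2]
  have hi : IntegrableOn h (K ×ˢ Icc (-(δ / 2)) (δ / 2)) :=
    hl.integrableOn_compact_subset (prod_mono hKΩ (Icc_subset_Ioo (by linarith) (by linarith)))
      (hK.prod isCompact_Icc)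
  obtain ⟨A, hA⟩ := hψ.continuous.bounded_above_of_compact_support hc
  have hA0 : 0 ≤ A := (norm_nonneg _).trans (hA 0)
  obtain ⟨L, hL⟩ := ContDiff.lipschitzWith_of_hasCompactSupport hc hψ (by simp)
  obtain ⟨C, hC0, hC⟩ := exists_bound_deriv_lineBump
  set χ : ℝ → ℝ → ℝ := fun ε t ↦ 1 - lineBump (t / ε) with hχ
  set χ' : ℝ → ℝ → ℝ := fun ε t ↦ -(ε⁻¹ * deriv lineBump (t / ε)) with hχ'
  have hχd : ∀ ε t, HasDerivAt (χ ε) (χ' ε t) t := by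
    intro ε t
    have h1 : HasDerivAt (fun t ↦ t / ε) (1 / ε) t := (hasDerivAt_id t).div_const ε
    have h2 := ((hasDerivAt_lineBump (t / ε)).comp t h1).const_sub 1
    refine h2.congr_deriv ?_
    simp only [hχ']; ring
  have hχcd : ∀ ε, ContDiff ℝ ∞ (χ ε) := fun ε ↦
    contDiff_const.sub (contDiff_lineBump.comp (contDiff_id.div_const ε))
  have hχ1 : ∀ ε > 0, ∀ t, ε < |t| → χ ε t = 1 := by
    intro ε hε t ht
    have : 1 < |t / ε| := by rw [abs_div, abs_of_pos hε, one_lt_div hε]; exact ht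
    simp [hχ, lineBump_eq_zero this.le]
  have hχb : ∀ ε t, ‖χ ε t‖ ≤ 1 := by
    intro ε t
    rw [Real.norm_eq_abs, abs_le]
    have h1 := lineBump.nonneg (x := t / ε)
    have h2 := lineBump.le_one (x := t / ε)
    constructor <;> simp only [hχ] <;> linarith
  have hχtend : ∀ᵐ z : E × ℝ, ∀ᶠ ε in 𝓝[>] (0 : ℝ), χ ε z.2 = 1 := by
    filter_upwards [ae_snd_ne_zero] with z hz
    filter_upwards [Ioo_mem_nhdsGT (abs_pos.2 hz)] with ε hε
    exact hχ1 ε hε.1 _ hε.2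
  have hint1 := integrable_fderiv_smul hl hψ hc hs v
  have hint2 := integrable_smul_deriv hl' hψ hc hs v
  -- the identity for the truncated test functions
  have hid : ∀ ε > 0, (∫ z, χ ε z.2 • (fderiv ℝ ψ z v • h z)) +
      v.2 • ∫ z, (χ' ε z.2 * ψ z) • h z = -∫ z, χ ε z.2 • (ψ z • h' z v) := by
    intro ε hε
    set η : E × ℝ → ℝ := fun z ↦ χ ε z.2 * ψ z with hη
    have hηcd : ContDiff ℝ ∞ η := ((hχcd ε).comp contDiff_snd).mul hψ
    have hηc : HasCompactSupport η := hc.mul_left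
    have hηs : tsupport η ⊆ (Ω ×ˢ Ioo (-δ) δ) ∩ {z | z.2 ≠ 0} := by
      refine subset_inter (tsupport_mul_subset_right.trans hs) ?_
      have h1 : tsupport η ⊆ {z | ε / 2 ≤ |z.2|} := by
        refine closure_minimal ?_ (isClosed_le continuous_const continuous_snd.abs)
        intro z hz
        by_contra h2
        simp only [mem_ofPred_eq, not_le] at h2
        apply hz
        have h3 : |z.2 / ε| ≤ 1 / 2 := by
          rw [abs_div, abs_of_pos hε, div_le_iff₀ hε]; linarith
        simp [hη, hχ, lineBump_eq_one h3]
      intro z hz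
      have h2 := h1 hz
      simp only [mem_ofPred_eq] at h2 ⊢
      intro h3
      rw [h3, abs_zero] at h2
      linarith
    have hηd : ∀ z, fderiv ℝ η z v =
        χ ε z.2 * fderiv ℝ ψ z v + v.2 * (χ' ε z.2 * ψ z) := by
      intro z
      have h1 : HasFDerivAt ψ (fderiv ℝ ψ z) z :=
        (hψ.differentiable (by simp)).differentiableAt.hasFDerivAt
      have h2 := (hχd ε z.2).comp_hasFDerivAt z (hasFDerivAt_snd (𝕜 := ℝ) (E := E) (F := ℝ))
      have h3 := (h2.mul h1).fderiv
      change fderiv ℝ η z = _ at h3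
      rw [h3]
      simp
      ring
    have h1 := hoff.3 η hηcd hηc hηs v
    have hI1 : Integrable fun z : E × ℝ ↦ χ ε z.2 • (fderiv ℝ ψ z v • h z) := by
      refine hint1.bdd_smul 1 ?_ (Eventually.of_forall fun z ↦ hχb ε z.2)
      exact ((hχcd ε).continuous.comp continuous_snd).aestronglyMeasurable
    have hI2 : Integrable fun z : E × ℝ ↦ (χ' ε z.2 * ψ z) • h z := by
      refine integrable_smul_of_locallyIntegrableOn hl ?_ hc.mul_left
        (tsupport_mul_subset_right.trans hs)
      have h2 : Continuous (χ' ε) :=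
        (continuous_const.mul ((contDiff_lineBump.continuous_deriv (by simp)).comp
          (continuous_id.div_const ε))).neg
      exact (h2.comp continuous_snd).mul hψ.continuous
    have h2 : ∫ z, fderiv ℝ η z v • h z =
        ∫ z, (χ ε z.2 • (fderiv ℝ ψ z v • h z) + v.2 • ((χ' ε z.2 * ψ z) • h z)) := by
      refine integral_congr_ae (Eventually.of_forall fun z ↦ ?_)
      simp only [hηd, add_smul, mul_smul]
    have hI3 : Integrable fun z : E × ℝ ↦ v.2 • ((χ' ε z.2 * ψ z) • h z) := hI2.smul v.2
    rw [h2, integral_add hI1 hI3, integral_smul] at h1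
    rw [h1]
    congr 1
    refine integral_congr_ae (Eventually.of_forall fun z ↦ ?_)
    simp only [hη, mul_smul]
  have hlim1 : Tendsto (fun ε ↦ ∫ z, χ ε z.2 • (fderiv ℝ ψ z v • h z)) (𝓝[>] 0)
      (𝓝 (∫ z, fderiv ℝ ψ z v • h z)) := by
    refine tendsto_integral_filter_of_dominated_convergence
      (fun z ↦ ‖fderiv ℝ ψ z v • h z‖) ?_ ?_ hint1.norm ?_
    · exact Eventually.of_forall fun ε ↦
        (((hχcd ε).continuous.comp continuous_snd).aestronglyMeasurable).smul hint1.1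
    · refine Eventually.of_forall fun ε ↦ Eventually.of_forall fun z ↦ ?_
      rw [norm_smul]
      exact mul_le_of_le_one_left (norm_nonneg _) (hχb _ _)
    · filter_upwards [hχtend] with z hz
      refine tendsto_const_nhds.congr' ?_
      filter_upwards [hz] with ε hε
      rw [hε, one_smul]
  have hlim2 : Tendsto (fun ε ↦ ∫ z, χ ε z.2 • (ψ z • h' z v)) (𝓝[>] 0)
      (𝓝 (∫ z, ψ z • h' z v)) := by
    refine tendsto_integral_filter_of_dominated_convergence
      (fun z ↦ ‖ψ z • h' z v‖) ?_ ?_ hint2.norm ?_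
    · exact Eventually.of_forall fun ε ↦
        (((hχcd ε).continuous.comp continuous_snd).aestronglyMeasurable).smul hint2.1
    · refine Eventually.of_forall fun ε ↦ Eventually.of_forall fun z ↦ ?_
      rw [norm_smul]
      exact mul_le_of_le_one_left (norm_nonneg _) (hχb _ _)
    · filter_upwards [hχtend] with z hz
      refine tendsto_const_nhds.congr' ?_
      filter_upwards [hz] with ε hε
      rw [hε, one_smul]
  -- the layer term, rewritten by means of the reflection `t ↦ -t`
  have hlayer : ∀ ε > 0, ε < δ / 2 → ‖∫ z, (χ' ε z.2 * ψ z) • h z‖ₑ ≤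
      (ENNReal.ofReal (2 * C * A) * (ENNReal.ofReal ε⁻¹ *
        ∫⁻ z in K ×ˢ Ioo (0 : ℝ) ε, ‖h z - h (z.1, -z.2)‖ₑ)) +
      ENNReal.ofReal (2 * C * L) * ∫⁻ z in K ×ˢ Ioo (-ε) ε, ‖h z‖ₑ := by
    intro ε hε hεδ
    have hχ'n : ∀ t, χ' ε (-t) = -χ' ε t := by
      intro t
      simp only [hχ', neg_div, deriv_lineBump_neg]; ring
    have hχ'b : ∀ t, |χ' ε t| ≤ C * ε⁻¹ := by
      intro t
      simp only [hχ', abs_neg, abs_mul, abs_of_pos (inv_pos.2 hε)]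
      rw [mul_comm]
      exact mul_le_mul_of_nonneg_right (hC _) (inv_pos.2 hε).le
    have hχ'0 : ∀ t, ε ≤ |t| → χ' ε t = 0 := by
      intro t ht
      have : 1 ≤ |t / ε| := by rw [abs_div, abs_of_pos hε, one_le_div hε]; exact ht
      simp [hχ', deriv_lineBump_eq_zero this]
    have hI2 : Integrable fun z : E × ℝ ↦ (χ' ε z.2 * ψ z) • h z := by
      refine integrable_smul_of_locallyIntegrableOn hl ?_ hc.mul_left
        (tsupport_mul_subset_right.trans hs)
      have h2 : Continuous (χ' ε) :=
        (continuous_const.mul ((contDiff_lineBump.continuous_deriv (by simp)).comp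
          (continuous_id.div_const ε))).neg
      exact (h2.comp continuous_snd).mul hψ.continuous
    have hI3 := integrable_reflect hI2
    set S : Set (E × ℝ) := K ×ˢ Ioo (-ε) ε with hS
    have hSm : MeasurableSet S := hK.measurableSet.prod measurableSet_Ioo
    have hSr : (fun z : E × ℝ ↦ (z.1, -z.2)) ⁻¹' S = S := by
      ext z
      simp only [hS, mem_preimage, mem_prod, mem_Ioo]
      constructor <;> rintro ⟨h1, h2, h3⟩ <;> exact ⟨h1, by linarith, by linarith⟩
    have hSsub : S ⊆ K ×ˢ Icc (-(δ / 2)) (δ / 2) :=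
      prod_mono le_rfl (Ioo_subset_Icc_self.trans (Icc_subset_Icc (by linarith) (by linarith)))
    have hψK : ∀ z : E × ℝ, z.1 ∉ K → ψ z = 0 := by
      intro z hz
      refine image_eq_zero_of_notMem_tsupport fun h1 ↦ hz ⟨z, h1, rfl⟩
    have h2J : (2 : ℝ) • ∫ z, (χ' ε z.2 * ψ z) • h z =
        ∫ z : E × ℝ, χ' ε z.2 • (ψ z • h z - ψ (z.1, -z.2) • h (z.1, -z.2)) := by
      rw [two_smul]
      conv_lhs => rw [← integral_reflect (fun z : E × ℝ ↦ (χ' ε z.2 * ψ z) • h z)]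
      conv_lhs => rw [integral_reflect (fun z : E × ℝ ↦ (χ' ε z.2 * ψ z) • h z)]
      conv_lhs =>
        arg 2
        rw [← integral_reflect (fun z : E × ℝ ↦ (χ' ε z.2 * ψ z) • h z)]
      rw [← integral_add hI2 hI3]
      refine integral_congr_ae (Eventually.of_forall fun z ↦ ?_)
      simp only [hχ'n, smul_sub, mul_smul, neg_smul]
      abel
    have hpt : ∀ z ∈ S, ‖χ' ε z.2 • (ψ z • h z - ψ (z.1, -z.2) • h (z.1, -z.2))‖ₑ ≤
        ENNReal.ofReal (C * ε⁻¹ * A) * ‖h z - h (z.1, -z.2)‖ₑ +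
        ENNReal.ofReal (2 * C * L) * ‖h (z.1, -z.2)‖ₑ := by
      intro z hz
      have h1 : |ψ z - ψ (z.1, -z.2)| ≤ L * (2 * ε) := by
        have h2 := hL.dist_le_mul z (z.1, -z.2)
        rw [Real.dist_eq] at h2
        refine h2.trans (mul_le_mul_of_nonneg_left ?_ L.2)
        rw [Prod.dist_eq, dist_self, Real.dist_eq]
        refine max_le (by linarith) ?_
        rw [sub_neg_eq_add, abs_le]
        constructor <;> linarith [hz.2.1, hz.2.2]
      have h3 : ψ z • h z - ψ (z.1, -z.2) • h (z.1, -z.2) =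
          ψ z • (h z - h (z.1, -z.2)) + (ψ z - ψ (z.1, -z.2)) • h (z.1, -z.2) := by
        rw [smul_sub, sub_smul]; abel
      have h4 : ‖χ' ε z.2 • (ψ z • h z - ψ (z.1, -z.2) • h (z.1, -z.2))‖ ≤
          (C * ε⁻¹ * A) * ‖h z - h (z.1, -z.2)‖ + (2 * C * L) * ‖h (z.1, -z.2)‖ := by
        have hAz : ‖ψ z‖ ≤ A := hA z
        have hn1 := norm_nonneg (h z - h (z.1, -z.2))
        have hn2 := norm_nonneg (h (z.1, -z.2))
        rw [norm_smul, h3, Real.norm_eq_abs]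
        calc |χ' ε z.2| * ‖ψ z • (h z - h (z.1, -z.2)) + (ψ z - ψ (z.1, -z.2)) • h (z.1, -z.2)‖
            ≤ (C * ε⁻¹) * (A * ‖h z - h (z.1, -z.2)‖ + (L * (2 * ε)) * ‖h (z.1, -z.2)‖) := by
              refine mul_le_mul (hχ'b _) ((norm_add_le _ _).trans ?_) (norm_nonneg _) (by positivity)
              rw [norm_smul, norm_smul]
              exact add_le_add (mul_le_mul_of_nonneg_right hAz hn1)
                (mul_le_mul_of_nonneg_right h1 hn2)
          _ = _ := by field_simp
      rw [← ofReal_norm, ← ofReal_norm, ← ofReal_norm, ← ENNReal.ofReal_mul (by positivity),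
        ← ENNReal.ofReal_mul (by positivity), ← ENNReal.ofReal_add (by positivity) (by positivity)]
      exact ENNReal.ofReal_le_ofReal h4
    have hmeas : AEMeasurable (fun z : E × ℝ ↦ ENNReal.ofReal (2 * C * L) * ‖h (z.1, -z.2)‖ₑ)
        (volume.restrict S) := by
      have h1 : IntegrableOn h S := hi.mono_set hSsub
      have h2 := integrable_reflect ((integrable_indicator_iff hSm).2 h1)
      have h3 : (fun z : E × ℝ ↦ S.indicator h (z.1, -z.2)) =
          S.indicator (fun z : E × ℝ ↦ h (z.1, -z.2)) := by
        funext z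
        have h4 : (z.1, -z.2) ∈ S ↔ z ∈ S := Set.ext_iff.1 hSr z
        by_cases h5 : z ∈ S
        · rw [indicator_of_mem h5, indicator_of_mem (h4.2 h5)]
        · rw [indicator_of_notMem h5, indicator_of_notMem (fun h6 ↦ h5 (h4.1 h6))]
      rw [h3, integrable_indicator_iff hSm] at h2
      exact (h2.1.enorm).const_mul _
    have hhalf : ∫⁻ z in S, ‖h z - h (z.1, -z.2)‖ₑ ≤
        2 * ∫⁻ z in K ×ˢ Ioo (0 : ℝ) ε, ‖h z - h (z.1, -z.2)‖ₑ := by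
      have h1 : S ≤ᵐ[volume] ((K ×ˢ Ioo (0 : ℝ) ε) ∪
          (fun z : E × ℝ ↦ (z.1, -z.2)) ⁻¹' (K ×ˢ Ioo (0 : ℝ) ε) : Set (E × ℝ)) := by
        filter_upwards [ae_snd_ne_zero] with z hz hzS
        rcases lt_or_gt_of_ne hz with h0 | h0
        · right
          exact ⟨hzS.1, by simpa using h0, by linarith [hzS.2.1]⟩
        · left
          exact ⟨hzS.1, h0, hzS.2.2⟩
      refine (lintegral_mono' (Measure.restrict_mono_ae h1) le_rfl).trans ?_
      refine (lintegral_union_le _ _ _).trans ?_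
      rw [two_mul]
      refine add_le_add le_rfl ?_
      rw [← setLIntegral_reflect (K ×ˢ Ioo (0 : ℝ) ε)]
      refine lintegral_mono fun z ↦ ?_
      dsimp only
      rw [neg_neg, ← enorm_neg, neg_sub]
    calc ‖∫ z, (χ' ε z.2 * ψ z) • h z‖ₑ
        ≤ ‖(2 : ℝ) • ∫ z, (χ' ε z.2 * ψ z) • h z‖ₑ := by
          rw [enorm_smul]
          refine le_mul_of_one_le_left zero_le ?_
          rw [← ofReal_norm]
          simp
      _ ≤ ∫⁻ z : E × ℝ, ‖χ' ε z.2 • (ψ z • h z - ψ (z.1, -z.2) • h (z.1, -z.2))‖ₑ := by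
          rw [h2J]; exact enorm_integral_le_lintegral_enorm _
      _ = ∫⁻ z in S, ‖χ' ε z.2 • (ψ z • h z - ψ (z.1, -z.2) • h (z.1, -z.2))‖ₑ := by
          refine (setLIntegral_eq_of_support_subset ?_).symm
          intro z hz
          by_contra h1
          apply hz
          by_cases h2 : z.1 ∈ K
          · have h3 : ε ≤ |z.2| := by
              by_contra h4
              rw [not_le, abs_lt] at h4
              exact h1 ⟨h2, h4⟩
            simp [hχ'0 _ h3]
          · simp [hψK z h2, hψK (z.1, -z.2) h2]
      _ ≤ ∫⁻ z in S, (ENNReal.ofReal (C * ε⁻¹ * A) * ‖h z - h (z.1, -z.2)‖ₑ +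
          ENNReal.ofReal (2 * C * L) * ‖h (z.1, -z.2)‖ₑ) := setLIntegral_mono' hSm hpt
      _ = (ENNReal.ofReal (C * ε⁻¹ * A) * ∫⁻ z in S, ‖h z - h (z.1, -z.2)‖ₑ) +
          ENNReal.ofReal (2 * C * L) * ∫⁻ z in S, ‖h z‖ₑ := by
          rw [lintegral_add_right' _ hmeas, lintegral_const_mul' _ _ ENNReal.ofReal_ne_top,
            lintegral_const_mul' _ _ ENNReal.ofReal_ne_top]
          have hr := setLIntegral_reflect S (fun z ↦ ‖h z‖ₑ)
          rw [hSr] at hr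
          rw [hr]
      _ ≤ _ := by
          refine add_le_add ?_ le_rfl
          refine (mul_le_mul_right hhalf _).trans (le_of_eq ?_)
          rw [← mul_assoc, ← mul_assoc]
          congr 1
          have : (2 : ℝ≥0∞) = ENNReal.ofReal 2 := by simp
          rw [this, ← ENNReal.ofReal_mul (by positivity), ← ENNReal.ofReal_mul (by positivity)]
          congr 1
          ring
  have hlim3 : Tendsto (fun ε ↦ ∫ z, (χ' ε z.2 * ψ z) • h z) (𝓝[>] 0) (𝓝 0) := by
    rw [tendsto_zero_iff_enorm_tendsto_zero]
    have h4 := (ENNReal.Tendsto.const_mul (hjump K hKΩ hK)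
      (Or.inr (ENNReal.ofReal_ne_top (r := 2 * C * A)))).add
      (ENNReal.Tendsto.const_mul (tendsto_setLIntegral_slab hK hi (by linarith))
        (Or.inr (ENNReal.ofReal_ne_top (r := 2 * C * L))))
    simp only [mul_zero, add_zero] at h4
    refine tendsto_of_tendsto_of_tendsto_of_le_of_le' tendsto_const_nhds h4
      (Eventually.of_forall fun _ ↦ zero_le) ?_
    filter_upwards [Ioo_mem_nhdsGT (half_pos hδ)] with ε hε
    exact hlayer ε hε.1 hε.2
  have h5 := hlim1.add (hlim3.const_smul v.2)
  rw [smul_zero, add_zero] at h5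
  refine tendsto_nhds_unique h5 (hlim2.neg.congr' ?_)
  filter_upwards [self_mem_nhdsWithin] with ε hε
  exact (hid ε hε).symm

end Glue

/-! ### The folded gluing of two functions on a cylinder -/

section Def

/-- The folded gluing of `f` and `g`: on the fibre above `x`, it runs through `g` from height `0`
up to height `r x / 2`, then back through `g` down to height `0`, and then through `f`. Each piece
is run through at unit speed. It is `f` where `r = 0`, and `g` on `(0, 1)` where `2 ≤ r`. -/
def glueMap {X Y : Type*} (r : X → ℝ) (f g : X × ℝ → Y) (z : X × ℝ) : Y :=
  if z.2 < r z.1 / 2 then g z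
  else if z.2 < r z.1 then g (z.1, r z.1 - z.2)
  else f (z.1, z.2 - r z.1)

/-- The derivative of the folded gluing `glueMap r f g`, computed by the chain rule from the
derivatives `dr`, `Df` and `Dg` of `r`, `f` and `g`. -/
def glueDeriv {X F : Type*} {T : X → Type*} [∀ x, AddCommGroup (T x)] [∀ x, Module ℝ (T x)]
    [∀ x, TopologicalSpace (T x)] [NormedAddCommGroup F] [NormedSpace ℝ F]
    (r : X → ℝ) (dr : ∀ x, T x →L[ℝ] ℝ) (Df Dg : ∀ z : X × ℝ, T z.1 × ℝ →L[ℝ] F) (z : X × ℝ) :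
    T z.1 × ℝ →L[ℝ] F :=
  if z.2 < r z.1 / 2 then Dg z
  else if z.2 < r z.1 then (Dg (z.1, r z.1 - z.2)).comp (shearDeriv (-1) (dr z.1))
  else (Df (z.1, z.2 - r z.1)).comp (shearDeriv 1 (-1 • dr z.1))

section

variable {X Y : Type*} {r : X → ℝ} {f g : X × ℝ → Y} {x : X} {t : ℝ}

lemma glueMap_low (h : t < r x / 2) : glueMap r f g (x, t) = g (x, t) := if_pos h

lemma glueMap_mid (h : r x / 2 ≤ t) (h' : t < r x) :
    glueMap r f g (x, t) = g (x, r x - t) :=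
  (if_neg (not_lt.2 h)).trans (if_pos h')

lemma glueMap_high (h : r x / 2 ≤ t) (h' : r x ≤ t) :
    glueMap r f g (x, t) = f (x, t - r x) :=
  (if_neg (not_lt.2 h)).trans (if_neg (not_lt.2 h'))

variable {F : Type*} {T : X → Type*} [∀ x, AddCommGroup (T x)] [∀ x, Module ℝ (T x)]
  [∀ x, TopologicalSpace (T x)] [NormedAddCommGroup F] [NormedSpace ℝ F]
  {dr : ∀ x, T x →L[ℝ] ℝ} {Df Dg : ∀ z : X × ℝ, T z.1 × ℝ →L[ℝ] F}

lemma glueDeriv_low (h : t < r x / 2) : glueDeriv r dr Df Dg (x, t) = Dg (x, t) := if_pos h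

lemma glueDeriv_mid (h : r x / 2 ≤ t) (h' : t < r x) :
    glueDeriv r dr Df Dg (x, t) = (Dg (x, r x - t)).comp (shearDeriv (-1) (dr x)) :=
  (if_neg (not_lt.2 h)).trans (if_pos h')

lemma glueDeriv_high (h : r x / 2 ≤ t) (h' : r x ≤ t) :
    glueDeriv r dr Df Dg (x, t) = (Df (x, t - r x)).comp (shearDeriv 1 (-1 • dr x)) :=
  (if_neg (not_lt.2 h)).trans (if_neg (not_lt.2 h'))

end

end Def

section Chart

variable {E F : Type*} [NormedAddCommGroup E] [NormedSpace ℝ E] [FiniteDimensional ℝ E]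
  [MeasureSpace E] [BorelSpace E] [SFinite (volume : Measure E)]
  [IsFiniteMeasureOnCompacts (volume : Measure E)]
  [NormedAddCommGroup F] [NormedSpace ℝ F]

/-- A smooth function on an open set agrees near each point with a smooth function on the whole
space. -/
lemma exists_contDiff_eventuallyEq {r : E → ℝ} {D : Set E} (hD : IsOpen D)
    (hr : ContDiffOn ℝ ∞ r D) {y : E} (hy : y ∈ D) :
    ∃ ρ : E → ℝ, ContDiff ℝ ∞ ρ ∧ ρ =ᶠ[𝓝 y] r := by
  obtain ⟨ε, hε, hb⟩ := Metric.isOpen_iff.1 hD y hy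
  let b : ContDiffBump y := ⟨ε / 4, ε / 2, by linarith, by linarith⟩
  refine ⟨fun x ↦ b x * r x, ?_, ?_⟩
  · rw [contDiff_iff_contDiffAt]
    intro x
    by_cases hx : x ∈ D
    · exact b.contDiff.contDiffAt.mul (hr.contDiffAt (hD.mem_nhds hx))
    · have h1 : x ∉ tsupport b := by
        intro h2
        rw [b.tsupport_eq, Metric.mem_closedBall] at h2
        apply hx
        apply hb
        rw [Metric.mem_ball]
        have : b.rOut = ε / 2 := rfl
        linarith
      refine (contDiffAt_const (c := (0 : ℝ))).congr_of_eventuallyEq ?_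
      filter_upwards [(isClosed_tsupport b).isOpen_compl.mem_nhds h1] with w hw
      rw [image_eq_zero_of_notMem_tsupport hw, zero_mul]
  · filter_upwards [b.eventuallyEq_one] with w hw
    simp only [hw, Pi.one_apply, one_mul]

/-- The function which is `b` on the upper half of a cylinder, and the reflection of `a` on the
lower half. -/
def reflectGlue {X Y : Type*} (a b : X × ℝ → Y) (z : X × ℝ) : Y :=
  if z.2 < 0 then a (fiberShear (-1) (fun _ ↦ 0) z) else b z

/-- The derivative of `reflectGlue`. -/
def reflectGlueDeriv (a' b' : E × ℝ → E × ℝ →L[ℝ] F) (z : E × ℝ) : E × ℝ →L[ℝ] F :=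
  if z.2 < 0 then (a' (fiberShear (-1) (fun _ ↦ 0) z)).comp
    (shearDeriv (-1) (fderiv ℝ (fun _ : E ↦ (0 : ℝ)) z.1)) else b' z

lemma reflectGlue_of_neg {X Y : Type*} {a b : X × ℝ → Y} {x : X} {t : ℝ} (h : t < 0) :
    reflectGlue a b (x, t) = a (fiberShear (-1) (fun _ ↦ 0) (x, t)) := if_pos h

lemma reflectGlue_of_nonneg {X Y : Type*} {a b : X × ℝ → Y} {x : X} {t : ℝ} (h : 0 ≤ t) :
    reflectGlue a b (x, t) = b (x, t) := if_neg (not_lt.2 h)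

lemma reflectGlueDeriv_of_neg {a' b' : E × ℝ → E × ℝ →L[ℝ] F} {x : E} {t : ℝ} (h : t < 0) :
    reflectGlueDeriv a' b' (x, t) = (a' (fiberShear (-1) (fun _ ↦ 0) (x, t))).comp
      (shearDeriv (-1) 0) := by
  refine (if_pos h).trans ?_
  simp

lemma reflectGlueDeriv_of_nonneg {a' b' : E × ℝ → E × ℝ →L[ℝ] F} {x : E} {t : ℝ} (h : 0 ≤ t) :
    reflectGlueDeriv a' b' (x, t) = b' (x, t) := if_neg (not_lt.2 h)

lemma locallyIntegrableOn_ite_neg {G : Type*} [NormedAddCommGroup G] {a b : E × ℝ → G}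
    {Ω : Set E} (hΩ : IsOpen Ω) {δ : ℝ} (ha : LocallyIntegrableOn a (Ω ×ˢ Ioc (-δ) 0))
    (hb : LocallyIntegrableOn b (Ω ×ˢ Ico 0 δ)) :
    LocallyIntegrableOn (fun z ↦ if z.2 < 0 then a z else b z) (Ω ×ˢ Ioo (-δ) δ) := by
  refine (locallyIntegrableOn_iff (hΩ.prod isOpen_Ioo).isLocallyClosed).2 fun K hK hKc ↦ ?_
  have hn : MeasurableSet {z : E × ℝ | z.2 < 0} := measurableSet_lt measurable_snd measurable_const
  have h1 : IntegrableOn a (K ∩ {z | z.2 < 0}) := by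
    have h2 : IntegrableOn a (K ∩ {z | z.2 ≤ 0}) :=
      ha.integrableOn_compact_subset
        (fun z hz ↦ ⟨(hK hz.1).1, (hK hz.1).2.1, hz.2⟩)
        (hKc.inter_right (isClosed_le continuous_snd continuous_const))
    exact h2.mono_set (inter_subset_inter_right _ fun z (hz : z.2 < 0) ↦ hz.le)
  have h2 : IntegrableOn b (K ∩ {z | z.2 < 0}ᶜ) := by
    have h2 : IntegrableOn b (K ∩ {z | 0 ≤ z.2}) :=
      hb.integrableOn_compact_subset
        (fun z hz ↦ ⟨(hK hz.1).1, hz.2, (hK hz.1).2.2⟩)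
        (hKc.inter_right (isClosed_le continuous_const continuous_snd))
    exact h2.mono_set (inter_subset_inter_right _ fun z (hz : ¬z.2 < 0) ↦ not_lt.1 hz)
  have h3 := (h1.congr_fun (g := fun z ↦ if z.2 < 0 then a z else b z)
    (fun z hz ↦ by simp only [mem_inter_iff, mem_ofPred_eq] at hz; simp [hz.2])
    (hKc.measurableSet.inter hn)).union
    (h2.congr_fun (g := fun z ↦ if z.2 < 0 then a z else b z)
    (fun z hz ↦ by
      simp only [mem_inter_iff, mem_compl_iff, mem_ofPred_eq] at hz; simp [hz.2])
    (hKc.measurableSet.inter hn.compl))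
  rwa [inter_union_compl] at h3

/-- The reflection of `a` and the function `b` fit together to a weakly differentiable function if
`a` and `b` have no jump between their bottoms. -/
lemma HasWeakFDerivOn.reflectGlue {a b : E × ℝ → F} {a' b' : E × ℝ → E × ℝ →L[ℝ] F} {Ω : Set E}
    (hΩ : IsOpen Ω) {δ : ℝ}
    (ha : HasWeakFDerivOn a a' (Ω ×ˢ Ioo 0 δ)) (hb : HasWeakFDerivOn b b' (Ω ×ˢ Ioo 0 δ))
    (hla : LocallyIntegrableOn a (Ω ×ˢ Ico 0 δ)) (hla' : LocallyIntegrableOn a' (Ω ×ˢ Ico 0 δ))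
    (hlb : LocallyIntegrableOn b (Ω ×ˢ Ico 0 δ)) (hlb' : LocallyIntegrableOn b' (Ω ×ˢ Ico 0 δ))
    (hjump : ∀ K ⊆ Ω, IsCompact K → Tendsto (fun ε : ℝ ↦ ENNReal.ofReal ε⁻¹ *
      ∫⁻ z in K ×ˢ Ioo (0 : ℝ) ε, ‖b z - a z‖ₑ) (𝓝[>] 0) (𝓝 0)) :
    HasWeakFDerivOn (reflectGlue a b) (reflectGlueDeriv a' b') (Ω ×ˢ Ioo (-δ) δ) := by
  have hr : fiberShear (-1) (fun _ : E ↦ 0) ⁻¹' (Ω ×ˢ Ico 0 δ) = Ω ×ˢ Ioc (-δ) 0 := by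
    ext z
    simp only [fiberShear, mem_preimage, mem_prod, mem_Ico, mem_Ioc]
    constructor <;> rintro ⟨h1, h2, h3⟩ <;> exact ⟨h1, by linarith, by linarith⟩
  have hr2 : fiberShear (-1) (fun _ : E ↦ 0) ⁻¹' (Ω ×ˢ Ioo 0 δ) = Ω ×ˢ Ioo (-δ) 0 := by
    ext z
    simp only [fiberShear, mem_preimage, mem_prod, mem_Ioo]
    constructor <;> rintro ⟨h1, h2, h3⟩ <;> exact ⟨h1, by linarith, by linarith⟩
  have hl1 := locallyIntegrableOn_comp_fiberShear (σ := -1) (ρ := fun _ : E ↦ 0) hla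
    (by norm_num) continuous_const
  have hl2 := locallyIntegrableOn_comp_fiberShear (σ := -1) (ρ := fun _ : E ↦ 0) hla'
    (by norm_num) continuous_const
  rw [hr] at hl1 hl2
  have hw := ha.comp_fiberShear (hΩ.prod isOpen_Ioo) (σ := -1) (ρ := fun _ : E ↦ 0) (by norm_num)
    contDiff_const
  rw [hr2] at hw
  have hl3 : LocallyIntegrableOn (fun z : E × ℝ ↦ (a' (fiberShear (-1) (fun _ ↦ 0) z)).comp
      (shearDeriv (-1) (fderiv ℝ (fun _ : E ↦ (0 : ℝ)) z.1))) (Ω ×ˢ Ioc (-δ) 0) := by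
    intro z hz
    obtain ⟨s, hs, hi⟩ := hl2 z hz
    refine ⟨s, hs, ?_⟩
    have h1 : ∀ z : E × ℝ, (a' (fiberShear (-1) (fun _ ↦ 0) z)).comp
        (shearDeriv (-1) (fderiv ℝ (fun _ : E ↦ (0 : ℝ)) z.1)) =
        ((ContinuousLinearMap.compL ℝ (E × ℝ) (E × ℝ) F).flip (shearDeriv (-1) (0 : E →L[ℝ] ℝ)))
          ((a' ∘ fiberShear (-1) (fun _ ↦ 0)) z) := by
      intro z
      simp
    simp only [h1]
    exact ContinuousLinearMap.integrable_comp _ hi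
  refine HasWeakFDerivOn.glue_hyperplane hΩ (locallyIntegrableOn_ite_neg hΩ hl1 hlb)
    (locallyIntegrableOn_ite_neg hΩ hl3 hlb') ?_ ?_ ?_
  · refine hb.congr (hΩ.prod isOpen_Ioo) ?_ ?_
    · intro z hz
      simp [FoldingSobolev.reflectGlue, not_lt.2 hz.2.1.le]
    · intro z hz
      simp [reflectGlueDeriv, not_lt.2 hz.2.1.le]
  · refine hw.congr (hΩ.prod isOpen_Ioo) ?_ ?_
    · intro z hz
      simp [FoldingSobolev.reflectGlue, hz.2.2]
    · intro z hz
      simp [reflectGlueDeriv, hz.2.2]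
  · intro K hK hKc
    refine (hjump K hK hKc).congr fun ε ↦ ?_
    congr 1
    refine setLIntegral_congr_fun (hKc.measurableSet.prod measurableSet_Ioo) fun z hz ↦ ?_
    have h1 := hz.2.1
    simp [FoldingSobolev.reflectGlue, fiberShear, not_lt.2 h1.le, h1]

/-- The folded gluing of two weakly differentiable functions with the same trace is weakly
differentiable. Away from the heights `r / 2` and `r`, this is the chain rule; the fold at height
`r / 2` is an even reflection, and at height `r` the two traces agree. -/
theorem HasWeakFDerivOn.glueMap {f g : E × ℝ → F} {f' g' : E × ℝ → E × ℝ →L[ℝ] F}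
    {Ωf Ωg Ω D : Set E} (hΩf : IsOpen Ωf) (hΩg : IsOpen Ωg) (hΩ : IsOpen Ω) (hD : IsOpen D)
    {r : E → ℝ} (hr : ContDiffOn ℝ ∞ r D) (hr0 : ∀ y ∈ D, 0 ≤ r y) (hΩD : Ω ⊆ D)
    (hrf : ∀ y ∈ Ω, r y < 2 → y ∈ Ωf) (hrg : ∀ y ∈ Ω, 0 < r y → y ∈ Ωg)
    (hf : HasWeakFDerivOn f f' (Ωf ×ˢ Ioo 0 1)) (hg : HasWeakFDerivOn g g' (Ωg ×ˢ Ioo 0 1))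
    (hlf : LocallyIntegrableOn f (Ωf ×ˢ Ico 0 1)) (hlf' : LocallyIntegrableOn f' (Ωf ×ˢ Ico 0 1))
    (hlg : LocallyIntegrableOn g (Ωg ×ˢ Ico 0 1)) (hlg' : LocallyIntegrableOn g' (Ωg ×ˢ Ico 0 1))
    (hjump : ∀ K ⊆ Ωf ∩ Ωg, IsCompact K → Tendsto (fun ε : ℝ ↦ ENNReal.ofReal ε⁻¹ *
      ∫⁻ z in K ×ˢ Ioo (0 : ℝ) ε, ‖f z - g z‖ₑ) (𝓝[>] 0) (𝓝 0)) :
    HasWeakFDerivOn (glueMap r f g)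
      (glueDeriv (T := fun _ : E ↦ E) r (fderiv ℝ r) f' g') (Ω ×ˢ Ioo 0 1) := by
  refine hasWeakFDerivOn_of_locally fun z₀ hz₀ ↦ ?_
  obtain ⟨y₀, t₀⟩ := z₀
  obtain ⟨hy₀, ht₀, ht₁⟩ := hz₀
  simp only at hy₀ ht₀ ht₁
  -- near `y₀`, the function `r` is replaced by a function that is smooth on the whole space, so
  -- that its shears are defined everywhere
  obtain ⟨ρ, hρ, hρr⟩ := exists_contDiff_eventuallyEq hD hr (hΩD hy₀)
  obtain ⟨B₁, hB₁, hB₁o, hyB₁⟩ := eventually_nhds_iff.1 hρr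
  set B := B₁ ∩ Ω with hB
  have hBo : IsOpen B := hB₁o.inter hΩ
  have hyB : y₀ ∈ B := ⟨hyB₁, hy₀⟩
  have hρB : ∀ y ∈ B, ρ y = r y := fun y hy ↦ hB₁ y hy.1
  have hdρB : ∀ y ∈ B, fderiv ℝ ρ y = fderiv ℝ r y := fun y hy ↦
    Filter.EventuallyEq.fderiv_eq (Filter.eventuallyEq_of_mem (hBo.mem_nhds hy) hρB)
  have hρ0 : ∀ y ∈ B, 0 ≤ ρ y := fun y hy ↦ by rw [hρB y hy]; exact hr0 y (hΩD hy.2)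
  have hρc : Continuous fun z : E × ℝ ↦ ρ z.1 := hρ.continuous.comp continuous_fst
  have hρe := hρB y₀ hyB
  have hg01 : IsOpen (Ωg ×ˢ Ioo (0 : ℝ) 1) := hΩg.prod isOpen_Ioo
  have hf01 : IsOpen (Ωf ×ˢ Ioo (0 : ℝ) 1) := hΩf.prod isOpen_Ioo
  have hdneg : ∀ x, fderiv ℝ (fun y ↦ -ρ y) x = -fderiv ℝ ρ x := fun x ↦ fderiv_fun_neg
  rcases lt_trichotomy t₀ (ρ y₀ / 2) with h1 | h1 | h1
  -- below the fold
  · have hOo : IsOpen (((B ∩ Ωg) ×ˢ Ioo (0 : ℝ) 1) ∩ {z | z.2 < ρ z.1 / 2}) :=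
      ((hBo.inter hΩg).prod isOpen_Ioo).inter
        (isOpen_lt continuous_snd (hρc.div_const 2))
    refine ⟨_, hOo, ⟨⟨⟨hyB, hrg y₀ hy₀ (by linarith)⟩, ht₀, ht₁⟩, h1⟩, ?_⟩
    refine (hg.mono fun z hz ↦ ⟨hz.1.1.2, hz.1.2⟩).congr hOo ?_ ?_
    · rintro ⟨y, t⟩ ⟨⟨⟨hyB, -⟩, -⟩, h2⟩
      simp only [mem_ofPred_eq, hρB y hyB] at h2
      simp [FoldingSobolev.glueMap, h2]
    · rintro ⟨y, t⟩ ⟨⟨⟨hyB, -⟩, -⟩, h2⟩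
      simp only [mem_ofPred_eq, hρB y hyB] at h2
      simp [glueDeriv, h2]
  -- at the fold: with `Φ (y, τ) = (y, ρ y / 2 - τ)`, the gluing is the even reflection of
  -- `g ∘ Φ`, shifted up by `ρ / 2`
  · have hyg : y₀ ∈ Ωg := hrg y₀ hy₀ (by linarith)
    have hρ2 : ContDiff ℝ ∞ fun y ↦ ρ y / 2 := hρ.div_const 2
    have hρ2n : ContDiff ℝ ∞ fun y ↦ -(ρ y / 2) := hρ2.neg
    have hd2 : ∀ x, fderiv ℝ (fun y ↦ ρ y / 2) x = (1 / 2 : ℝ) • fderiv ℝ ρ x := by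
      intro x
      have h2 : HasFDerivAt ρ (fderiv ℝ ρ x) x :=
        (hρ.differentiable (by simp)).differentiableAt.hasFDerivAt
      have h3 := h2.const_mul (1 / 2 : ℝ)
      rw [← h3.fderiv]
      congr 1
      funext y
      ring
    have hd2n : ∀ x, fderiv ℝ (fun y ↦ -(ρ y / 2)) x = -((1 / 2 : ℝ) • fderiv ℝ ρ x) := by
      intro x
      rw [← hd2, ← fderiv_fun_neg]
    set Φ := fiberShear (-1) (fun y ↦ ρ y / 2) with hΦ
    have hΦc : Continuous Φ := (contDiff_fiberShear _ hρ2).continuous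
    have hk := hg.comp_fiberShear hg01 (σ := -1) (by norm_num) hρ2
    have hPo : IsOpen (Φ ⁻¹' (Ωg ×ˢ Ioo (0 : ℝ) 1)) := hg01.preimage hΦc
    have hmem : (y₀, (0 : ℝ)) ∈ Φ ⁻¹' (Ωg ×ˢ Ioo (0 : ℝ) 1) := by
      simp only [hΦ, fiberShear, mem_preimage, mem_prod, mem_Ioo, mul_zero, zero_add]
      exact ⟨hyg, by linarith, by linarith⟩
    obtain ⟨B', J, hB'o, hJo, hyB', h0J, hsub⟩ := isOpen_prod_iff.1 hPo _ _ hmem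
    obtain ⟨δ, hδ, hδJ⟩ := Metric.isOpen_iff.1 hJo 0 h0J
    rw [Real.ball_eq_Ioo, zero_sub, zero_add] at hδJ
    have hsub2 : (B ∩ B') ×ˢ Ico 0 δ ⊆ Φ ⁻¹' (Ωg ×ˢ Ioo (0 : ℝ) 1) := fun z hz ↦
      hsub ⟨hz.1.2, hδJ ⟨by linarith [hz.2.1], hz.2.2⟩⟩
    have hsub3 : (B ∩ B') ×ˢ Ioo 0 δ ⊆ Φ ⁻¹' (Ωg ×ˢ Ioo (0 : ℝ) 1) := fun z hz ↦
      hsub2 ⟨hz.1, hz.2.1.le, hz.2.2⟩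
    have hBB' : IsOpen (B ∩ B') := hBo.inter hB'o
    have hG := HasWeakFDerivOn.reflectGlue hBB' (hk.mono hsub3) (hk.mono hsub3)
      (hk.1.mono_set hsub2) (hk.2.mono_set hsub2) (hk.1.mono_set hsub2) (hk.2.mono_set hsub2)
      (fun K _ _ ↦ by simp)
    have hG2 := hG.comp_fiberShear (hBB'.prod isOpen_Ioo) (σ := 1) (by norm_num) hρ2n
    have hOo : IsOpen ((fiberShear 1 (fun y ↦ -(ρ y / 2)) ⁻¹' ((B ∩ B') ×ˢ Ioo (-δ) δ)) ∩
        {z : E × ℝ | z.2 < ρ z.1}) :=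
      ((hBB'.prod isOpen_Ioo).preimage (contDiff_fiberShear _ hρ2n).continuous).inter
        (isOpen_lt continuous_snd hρc)
    refine ⟨_, hOo, ⟨⟨⟨hyB, hyB'⟩, ?_, ?_⟩, ?_⟩, (hG2.mono inter_subset_left).congr hOo ?_ ?_⟩
    · simp only [fiberShear]; linarith
    · simp only [fiberShear]; linarith
    · simp only [mem_ofPred_eq]; linarith
    · rintro ⟨y, t⟩ ⟨⟨⟨hyB, -⟩, -⟩, h2⟩
      simp only [mem_ofPred_eq, fiberShear] at h2 hyB
      have hry := hρB y hyB
      by_cases h3 : t < ρ y / 2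
      · rw [glueMap_low (by linarith)]
        change FoldingSobolev.reflectGlue _ _ (y, 1 * t + -(ρ y / 2)) = _
        rw [reflectGlue_of_neg (by linarith)]
        change g (y, -1 * (-1 * (1 * t + -(ρ y / 2)) + 0) + ρ y / 2) = _
        congr 2; ring
      · rw [glueMap_mid (by linarith) (by linarith)]
        change FoldingSobolev.reflectGlue _ _ (y, 1 * t + -(ρ y / 2)) = _
        rw [reflectGlue_of_nonneg (by linarith)]
        change g (y, -1 * (1 * t + -(ρ y / 2)) + ρ y / 2) = _
        congr 2; linarith
    · rintro ⟨y, t⟩ ⟨⟨⟨hyB, -⟩, -⟩, h2⟩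
      simp only [mem_ofPred_eq, fiberShear] at h2 hyB
      have hry := hρB y hyB
      have hdry := hdρB y hyB
      change (reflectGlueDeriv _ _ (y, 1 * t + -(ρ y / 2))).comp (shearDeriv 1
        (fderiv ℝ (fun y ↦ -(ρ y / 2)) y)) = _
      by_cases h3 : t < ρ y / 2
      · rw [glueDeriv_low (by linarith), reflectGlueDeriv_of_neg (by linarith)]
        have e1 : Φ (fiberShear (-1) (fun _ ↦ 0) (y, 1 * t + -(ρ y / 2))) = (y, t) := by
          refine Prod.ext rfl ?_
          simp only [hΦ, fiberShear]
          ring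
        rw [← hΦ, e1, hd2n]
        change (((g' (y, t)).comp (shearDeriv (-1) (fderiv ℝ (fun y ↦ ρ y / 2) y))).comp _).comp _
          = _
        rw [hd2]
        ext v
        · simp
        · simp
      · rw [glueDeriv_mid (by linarith) (by linarith), reflectGlueDeriv_of_nonneg (by linarith)]
        have e1 : Φ (y, 1 * t + -(ρ y / 2)) = (y, r y - t) := by
          refine Prod.ext rfl ?_
          simp only [hΦ, fiberShear]
          linarith
        rw [← hΦ, e1, hd2n, ← hdry]
        change ((g' (y, r y - t)).comp (shearDeriv (-1) (fderiv ℝ (fun y ↦ ρ y / 2) y))).comp _ = _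
        rw [hd2]
        refine ContinuousLinearMap.ext fun v ↦ ?_
        simp only [ContinuousLinearMap.comp_apply, shearDeriv_apply, _root_.neg_apply,
          _root_.smul_apply, smul_eq_mul]
        congr 2
        ring
  · have hyf : y₀ ∈ Ωf := hrf y₀ hy₀ (by linarith)
    have hρn : ContDiff ℝ ∞ fun y ↦ -ρ y := hρ.neg
    have hcn : Continuous (fiberShear 1 fun y ↦ -ρ y) := (contDiff_fiberShear 1 hρn).continuous
    rcases (hρ0 y₀ hyB).eq_or_lt with h2 | h2
    -- where `ρ` vanishes at `y₀`, a neighbourhood is taken that lies above the graph of `ρ`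
    · have hw := hf.comp_fiberShear hf01 (σ := 1) (by norm_num) hρn
      have hOo : IsOpen ((B ×ˢ Ioo (0 : ℝ) 1) ∩
          (fiberShear 1 (fun y ↦ -ρ y) ⁻¹' (Ωf ×ˢ Ioo (0 : ℝ) 1))) :=
        (hBo.prod isOpen_Ioo).inter (hf01.preimage hcn)
      refine ⟨_, hOo, ⟨⟨hyB, ht₀, ht₁⟩, hyf, ?_, ?_⟩,
        (hw.mono inter_subset_right).congr hOo ?_ ?_⟩
      · simp only [fiberShear]; linarith
      · simp only [fiberShear]; linarith
      · rintro ⟨y, t⟩ ⟨⟨hyB, -⟩, -, h3, -⟩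
        simp only [fiberShear] at h3 hyB
        have h0 := hρ0 y hyB
        have hry := hρB y hyB
        rw [glueMap_high (by linarith) (by linarith)]
        change f (y, 1 * t + -ρ y) = _
        congr 2; linarith
      · rintro ⟨y, t⟩ ⟨⟨hyB, -⟩, -, h3, -⟩
        simp only [fiberShear] at h3 hyB
        have h0 := hρ0 y hyB
        have hry := hρB y hyB
        have hdry := hdρB y hyB
        rw [glueDeriv_high (by linarith) (by linarith)]
        have e1 : fiberShear 1 (fun y ↦ -ρ y) (y, t) = (y, t - r y) := by
          refine Prod.ext rfl ?_
          simp only [fiberShear]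
          linarith
        dsimp only
        rw [e1, hdneg, ← hdry, neg_one_smul]
    -- above the fold, the gluing is the reflection of `g` below `f`, shifted up by `ρ`
    · have hyg : y₀ ∈ Ωg := hrg y₀ hy₀ (by linarith)
      have hfg : IsOpen (Ωf ∩ Ωg) := hΩf.inter hΩg
      have hG := HasWeakFDerivOn.reflectGlue hfg
        (hg.mono (prod_mono inter_subset_right le_rfl))
        (hf.mono (prod_mono inter_subset_left le_rfl))
        (hlg.mono_set (prod_mono inter_subset_right le_rfl))
        (hlg'.mono_set (prod_mono inter_subset_right le_rfl))
        (hlf.mono_set (prod_mono inter_subset_left le_rfl))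
        (hlf'.mono_set (prod_mono inter_subset_left le_rfl)) hjump
      have hw := hG.comp_fiberShear (hfg.prod isOpen_Ioo) (σ := 1) (by norm_num) hρn
      have hOo : IsOpen (((B ×ˢ Ioo (0 : ℝ) 1) ∩
          (fiberShear 1 (fun y ↦ -ρ y) ⁻¹' ((Ωf ∩ Ωg) ×ˢ Ioo (-1 : ℝ) 1))) ∩
          {z | ρ z.1 / 2 < z.2}) :=
        ((hBo.prod isOpen_Ioo).inter ((hfg.prod isOpen_Ioo).preimage hcn)).inter
          (isOpen_lt (hρc.div_const 2) continuous_snd)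
      refine ⟨_, hOo, ⟨⟨⟨hyB, ht₀, ht₁⟩, ⟨hyf, hyg⟩, ?_, ?_⟩, h1⟩,
        (hw.mono (inter_subset_left.trans inter_subset_right)).congr hOo ?_ ?_⟩
      · simp only [fiberShear]; linarith
      · simp only [fiberShear]; linarith
      · rintro ⟨y, t⟩ ⟨⟨⟨hyB, -⟩, -⟩, h3⟩
        simp only [mem_ofPred_eq] at h3 hyB
        have hry := hρB y hyB
        change FoldingSobolev.reflectGlue _ _ (y, 1 * t + -ρ y) = _
        by_cases h4 : t < ρ y
        · rw [glueMap_mid (by linarith) (by linarith), reflectGlue_of_neg (by linarith)]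
          change g (y, -1 * (1 * t + -ρ y) + 0) = _
          congr 2; linarith
        · rw [glueMap_high (by linarith) (by linarith), reflectGlue_of_nonneg (by linarith)]
          congr 2; linarith
      · rintro ⟨y, t⟩ ⟨⟨⟨hyB, -⟩, -⟩, h3⟩
        simp only [mem_ofPred_eq] at h3 hyB
        have hry := hρB y hyB
        have hdry := hdρB y hyB
        change (reflectGlueDeriv _ _ (y, 1 * t + -ρ y)).comp (shearDeriv 1
          (fderiv ℝ (fun y ↦ -ρ y) y)) = _
        by_cases h4 : t < ρ y
        · rw [glueDeriv_mid (by linarith) (by linarith), reflectGlueDeriv_of_neg (by linarith)]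
          have e1 : fiberShear (-1) (fun _ ↦ 0) (y, 1 * t + -ρ y) = (y, r y - t) := by
            refine Prod.ext rfl ?_
            simp only [fiberShear]
            linarith
          rw [e1, hdneg, ← hdry]
          ext v
          · simp
          · simp
        · rw [glueDeriv_high (by linarith) (by linarith), reflectGlueDeriv_of_nonneg (by linarith)]
          have e1 : 1 * t + -ρ y = t - r y := by linarith
          rw [e1, hdneg, ← hdry, neg_one_smul]

end Chart

/-! ### Existence of traces on the bottom of a cylinder -/

section Shift

variable {Z F : Type*} [NormedAddCommGroup Z] [NormedSpace ℝ Z] [FiniteDimensional ℝ Z]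
  [MeasureSpace Z] [BorelSpace Z] [(volume : Measure Z).IsAddHaarMeasure]
  [NormedAddCommGroup F] [NormedSpace ℝ F] [CompleteSpace F]

instance isFiniteMeasure_restrict_uIoc (a b : ℝ) :
    IsFiniteMeasure ((volume : Measure ℝ).restrict (uIoc a b)) := by
  unfold uIoc; infer_instance

lemma integrable_shift_prod {k : Z → F} (hk : Integrable k) (e : Z) (τ : ℝ) :
    Integrable (Function.uncurry fun (θ : ℝ) (z : Z) ↦ k (z + θ • e))
      ((volume.restrict (uIoc 0 τ)).prod volume) := by
  have h1 : Integrable (fun p : ℝ × Z ↦ k p.2) ((volume.restrict (uIoc 0 τ)).prod volume) :=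
    hk.comp_snd _
  have hmp : MeasurePreserving (fun p : ℝ × Z ↦ (p.1, p.2 + p.1 • e))
      ((volume.restrict (uIoc 0 τ)).prod volume) ((volume.restrict (uIoc 0 τ)).prod volume) := by
    refine (MeasurePreserving.id _).skew_product (g := fun (θ : ℝ) (z : Z) ↦ z + θ • e) ?_ ?_
    · exact (continuous_snd.add (continuous_fst.smul continuous_const)).measurable
    · exact Eventually.of_forall fun θ ↦ (measurePreserving_add_right volume (θ • e)).map_eq
  exact hmp.integrable_comp_of_integrable h1

lemma integrable_intervalIntegral_shift {k : Z → F} (hk : Integrable k) (e : Z) (τ : ℝ) :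
    Integrable fun z ↦ ∫ θ in (0 : ℝ)..τ, k (z + θ • e) := by
  have h1 := (integrable_shift_prod hk e τ).integral_prod_right
  simp only [Function.uncurry_apply_pair] at h1
  have h2 := h1.smul (if (0 : ℝ) ≤ τ then (1 : ℝ) else -1)
  refine h2.congr (Eventually.of_forall fun z ↦ ?_)
  simp only [Pi.smul_apply, intervalIntegral.intervalIntegral_eq_integral_uIoc]

/-- If `k` is the weak derivative of `f` in the direction `e`, then the increment of `f` between
`z` and `z + τ • e` is the integral of `k` over this segment, for almost every `z`. -/
lemma ae_shift_sub_eq_integral {f k : Z → F} (hf : Integrable f) (hk : Integrable k) (e : Z)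
    (τ : ℝ) {O : Set Z} (hO : IsOpen O)
    (h : ∀ θ ∈ uIcc 0 τ, ∀ ψ : Z → ℝ, ContDiff ℝ ∞ ψ → HasCompactSupport ψ → tsupport ψ ⊆ O →
      ∫ z, fderiv ℝ ψ (z - θ • e) e • f z = -∫ z, ψ (z - θ • e) • k z) :
    ∀ᵐ z, z ∈ O → f (z + τ • e) - f z = ∫ θ in (0 : ℝ)..τ, k (z + θ • e) := by
  have hfs : Integrable fun z ↦ f (z + τ • e) := hf.comp_add_right _
  have hK := integrable_intervalIntegral_shift hk e τ
  have hmain := hO.ae_eq_zero_of_integral_contDiff_smul_eq_zero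
    (f := fun z ↦ (f (z + τ • e) - f z) - ∫ θ in (0 : ℝ)..τ, k (z + θ • e)) (μ := volume)
    (((hfs.sub hf).sub hK).locallyIntegrable.locallyIntegrableOn O) ?_
  · filter_upwards [hmain] with z hz hzO
    exact sub_eq_zero.1 (hz hzO)
  intro ψ hψ hc hs
  obtain ⟨A, hA⟩ := hψ.continuous.bounded_above_of_compact_support hc
  obtain ⟨A', hA'⟩ := (continuous_fderiv_apply' hψ e).bounded_above_of_compact_support
    (HasCompactSupport.fderiv_apply' hc e)
  have hm : Measurable fun p : ℝ × Z ↦ p.2 - p.1 • e :=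
    (continuous_snd.sub (continuous_fst.smul continuous_const)).measurable
  have i1 : Integrable fun z ↦ ψ z • f (z + τ • e) :=
    hfs.bdd_smul A hψ.continuous.aestronglyMeasurable (Eventually.of_forall hA)
  have i2 : Integrable fun z ↦ ψ z • f z :=
    hf.bdd_smul A hψ.continuous.aestronglyMeasurable (Eventually.of_forall hA)
  have i3 : Integrable fun z ↦ ψ z • ∫ θ in (0 : ℝ)..τ, k (z + θ • e) :=
    hK.bdd_smul A hψ.continuous.aestronglyMeasurable (Eventually.of_forall hA)
  have i4 : Integrable fun z ↦ ψ (z - τ • e) • f z :=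
    hf.bdd_smul A (hψ.continuous.comp (continuous_id.sub continuous_const)).aestronglyMeasurable
      (Eventually.of_forall fun z ↦ hA _)
  have s1 : ∫ z, ψ z • ∫ θ in (0 : ℝ)..τ, k (z + θ • e) =
      ∫ θ in (0 : ℝ)..τ, ∫ z, ψ z • k (z + θ • e) := by
    rw [intervalIntegral_integral_swap]
    · simp only [intervalIntegral.integral_smul]
    · exact (integrable_shift_prod hk e τ).bdd_smul A
        ((hψ.continuous.comp continuous_snd).aestronglyMeasurable)
        (Eventually.of_forall fun z ↦ hA _)
  have s2 : ∀ θ : ℝ, ∫ z, ψ z • k (z + θ • e) = ∫ z, ψ (z - θ • e) • k z := by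
    intro θ
    rw [← integral_add_right_eq_self (fun z ↦ ψ (z - θ • e) • k z) (θ • e)]
    simp
  have s3 : ∫ θ in (0 : ℝ)..τ, ∫ z, fderiv ℝ ψ (z - θ • e) e • f z =
      ∫ z, (ψ z - ψ (z - τ • e)) • f z := by
    rw [intervalIntegral_integral_swap]
    · refine integral_congr_ae (Eventually.of_forall fun z ↦ ?_)
      simp only [intervalIntegral.integral_smul_const]
      congr 1
      have hd : ∀ θ ∈ uIcc 0 τ, HasDerivAt (fun θ : ℝ ↦ -ψ (z - θ • e))
          (fderiv ℝ ψ (z - θ • e) e) θ := by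
        intro θ _
        have h1 : HasDerivAt (fun θ : ℝ ↦ z - θ • e) (-((1 : ℝ) • e)) θ :=
          ((hasDerivAt_id θ).smul_const e).const_sub z
        have h2 := ((hψ.differentiable (by simp)).differentiableAt
          (x := z - θ • e)).hasFDerivAt.comp_hasDerivAt θ h1
        have h3 := h2.neg
        rw [one_smul, map_neg, neg_neg] at h3
        exact h3
      rw [intervalIntegral.integral_eq_sub_of_hasDerivAt hd]
      · simp only [zero_smul, sub_zero]; ring
      · refine Continuous.intervalIntegrable ?_ _ _
        exact (continuous_fderiv_apply' hψ e).comp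
          (continuous_const.sub (continuous_id.smul continuous_const))
    · have h1 : Integrable (fun p : ℝ × Z ↦ f p.2) ((volume.restrict (uIoc 0 τ)).prod volume) :=
        hf.comp_snd _
      exact h1.bdd_smul A'
        (((continuous_fderiv_apply' hψ e).measurable.comp hm).aestronglyMeasurable)
        (Eventually.of_forall fun z ↦ hA' _)
  have s4 : ∫ z, ψ z • f (z + τ • e) = ∫ z, ψ (z - τ • e) • f z := by
    rw [← integral_add_right_eq_self (fun z ↦ ψ (z - τ • e) • f z) (τ • e)]
    simp
  have s5 : ∫ θ in (0 : ℝ)..τ, ∫ z, ψ (z - θ • e) • k z =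
      -∫ θ in (0 : ℝ)..τ, ∫ z, fderiv ℝ ψ (z - θ • e) e • f z := by
    rw [← intervalIntegral.integral_neg]
    refine intervalIntegral.integral_congr fun θ hθ ↦ ?_
    simp only [h θ hθ ψ hψ hc hs, neg_neg]
  simp only [smul_sub]
  have i12 : Integrable fun z ↦ ψ z • f (z + τ • e) - ψ z • f z := i1.sub i2
  rw [integral_sub i12 i3, integral_sub i1 i2, s1]
  simp only [s2]
  rw [s5, s3, s4]
  simp only [sub_smul]
  rw [integral_sub i2 i4]
  abel

end Shift

section Trace

variable {E F : Type*} [NormedAddCommGroup E] [NormedSpace ℝ E] [FiniteDimensional ℝ E]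
  [MeasureSpace E] [BorelSpace E] [(volume : Measure E).IsAddHaarMeasure]
  [NormedAddCommGroup F] [NormedSpace ℝ F] [CompleteSpace F]

instance instIsAddHaarMeasureProdReal : (volume : Measure (E × ℝ)).IsAddHaarMeasure :=
  inferInstanceAs ((volume : Measure E).prod (volume : Measure ℝ)).IsAddHaarMeasure

/-- On almost every vertical line, the increments of a weakly differentiable function are the
integrals of its vertical derivative; here for the part of a cylinder inside a compact set. -/
lemma HasWeakFDerivOn.ae_ae_sub_eq_integral {f : E × ℝ → F} {f' : E × ℝ → E × ℝ →L[ℝ] F}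
    {Ω : Set E} (hf : HasWeakFDerivOn f f' (Ω ×ˢ Ioo 0 1)) {K : Set E} (hK : IsCompact K)
    (hKΩ : K ⊆ Ω) {a b : ℝ} (ha : 0 < a) (hb : b < 1) :
    ∀ᵐ y : E, y ∈ interior K → ∀ᵐ t : ℝ, ∀ᵐ t' : ℝ, t ∈ Ioo a b → t' ∈ Ioo a b →
      f (y, t') - f (y, t) = ∫ s in t..t', f' (y, s) (0, 1) := by
  set e : E × ℝ := (0, 1) with he
  set S : Set (E × ℝ) := K ×ˢ Icc a b with hS
  have hSc : IsCompact S := hK.prod isCompact_Icc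
  have hSm : MeasurableSet S := hSc.measurableSet
  have hSΩ : S ⊆ Ω ×ˢ Ioo 0 1 := prod_mono hKΩ (Icc_subset_Ioo ha hb)
  have hfi : Integrable (S.indicator f) :=
    (integrable_indicator_iff hSm).2 (hf.1.integrableOn_compact_subset hSΩ hSc)
  have hki : Integrable (S.indicator fun z ↦ f' z e) :=
    (integrable_indicator_iff hSm).2
      ((LocallyIntegrableOn.clm_apply_const hf.2 e).integrableOn_compact_subset hSΩ hSc)
  -- strongly measurable representatives, which make the exceptional sets below measurable
  set f₂ := hfi.1.mk _ with hf₂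
  set k₂ := hki.1.mk _ with hk₂
  have hfe : S.indicator f =ᵐ[volume] f₂ := hfi.1.ae_eq_mk
  have hke : (S.indicator fun z ↦ f' z e) =ᵐ[volume] k₂ := hki.1.ae_eq_mk
  have hfm : StronglyMeasurable f₂ := hfi.1.stronglyMeasurable_mk
  have hkm : StronglyMeasurable k₂ := hki.1.stronglyMeasurable_mk
  have hfi₂ : Integrable f₂ := hfi.congr hfe
  have hki₂ : Integrable k₂ := hki.congr hke
  set O : ℝ → Set (E × ℝ) := fun τ ↦
    interior K ×ˢ (Ioo a b ∩ (fun t ↦ t + τ) ⁻¹' Ioo a b) with hO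
  have hOo : ∀ τ, IsOpen (O τ) := fun τ ↦ isOpen_interior.prod
    (isOpen_Ioo.inter (isOpen_Ioo.preimage (continuous_add_const τ)))
  have hshift : ∀ τ : ℝ, ∀ᵐ z, z ∈ O τ → f₂ (z + τ • e) - f₂ z =
      ∫ θ in (0 : ℝ)..τ, k₂ (z + θ • e) := by
    intro τ
    refine ae_shift_sub_eq_integral hfi₂ hki₂ e τ (hOo τ) ?_
    intro θ hθ ψ hψ hc hs
    set ψθ : E × ℝ → ℝ := fun z ↦ ψ (z - θ • e) with hψθ
    have hcd : ContDiff ℝ ∞ ψθ := hψ.comp (contDiff_id.sub contDiff_const)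
    let φ : E × ℝ ≃ₜ E × ℝ := Homeomorph.subRight (θ • e)
    have hcc : HasCompactSupport ψθ := hc.comp_homeomorph φ
    have hts : tsupport ψθ ⊆ S := by
      have h1 : tsupport ψθ = φ ⁻¹' tsupport ψ := tsupport_comp_eq_preimage ψ φ
      rw [h1]
      intro z hz
      obtain ⟨h2, h3, h4⟩ := hs hz
      have h5 : φ z = (z.1, z.2 - θ) := by
        simp [φ, he, Prod.ext_iff]
      simp only [h5, mem_Ioo, mem_preimage] at h2 h3 h4
      refine ⟨interior_subset h2, ?_⟩
      rw [mem_uIcc] at hθ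
      rcases hθ with hθ | hθ
      · exact ⟨by linarith, by linarith⟩
      · exact ⟨by linarith, by linarith⟩
    have hfd : ∀ z, fderiv ℝ ψθ z e = fderiv ℝ ψ (z - θ • e) e := by
      intro z
      rw [hψθ, fderiv_comp_sub]
    have h1 := hf.3 ψθ hcd hcc (hts.trans hSΩ) e
    have h2 : ∫ z, fderiv ℝ ψ (z - θ • e) e • f₂ z = ∫ z, fderiv ℝ ψθ z e • f z := by
      refine integral_congr_ae ?_
      filter_upwards [hfe] with z hz
      rw [← hz, hfd]
      by_cases hzS : z ∈ S
      · rw [indicator_of_mem hzS]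
      · have h3 : fderiv ℝ ψ (z - θ • e) e = 0 := by
          rw [← hfd]
          by_contra h0
          exact hzS (hts (tsupport_fderiv_apply_subset' ψθ e (subset_tsupport _ h0)))
        rw [h3, zero_smul, zero_smul]
    have h3 : ∫ z, ψ (z - θ • e) • k₂ z = ∫ z, ψθ z • f' z e := by
      refine integral_congr_ae ?_
      filter_upwards [hke] with z hz
      rw [← hz]
      by_cases hzS : z ∈ S
      · rw [indicator_of_mem hzS]
      · have h3 : ψθ z = 0 := by
          by_contra h0
          exact hzS (hts (subset_tsupport _ h0))
        change ψθ z • _ = ψθ z • _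
        rw [h3, zero_smul, zero_smul]
    rw [h2, h3, h1]
  -- the difference of `f₂` and of the primitive of `k₂` is constant along vertical lines
  set h₂ : E × ℝ → F := fun z ↦ f₂ z - ∫ s in Iic z.2, k₂ (z.1, s) with hh₂
  have hh₂m : StronglyMeasurable h₂ := by
    refine hfm.sub ?_
    have h1 : StronglyMeasurable fun p : (E × ℝ) × ℝ ↦
        {p : (E × ℝ) × ℝ | p.2 ≤ p.1.2}.indicator (fun p ↦ k₂ (p.1.1, p.2)) p := by
      refine StronglyMeasurable.indicator ?_ ?_
      · exact hkm.comp_measurable ((measurable_fst.comp measurable_fst).prodMk measurable_snd)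
      · exact measurableSet_le measurable_snd (measurable_snd.comp measurable_fst)
    have h2 := h1.integral_prod_right' (ν := (volume : Measure ℝ))
    have h3 : (fun z : E × ℝ ↦ ∫ s in Iic z.2, k₂ (z.1, s)) = fun z ↦ ∫ s : ℝ,
        {p : (E × ℝ) × ℝ | p.2 ≤ p.1.2}.indicator (fun p ↦ k₂ (p.1.1, p.2)) (z, s) := by
      funext z
      rw [← integral_indicator measurableSet_Iic]
      rfl
    rw [h3]
    exact h2
  have hky : ∀ᵐ z : E × ℝ, Integrable fun s ↦ k₂ (z.1, s) :=
    Measure.quasiMeasurePreserving_fst.ae (hki₂.prod_right_ae (μ := (volume : Measure E)))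
  have hconst : ∀ τ : ℝ, ∀ᵐ z, z ∈ O τ → h₂ (z + τ • e) = h₂ z := by
    intro τ
    filter_upwards [hshift τ, hky] with z hz hkz hzO
    have h1 := hz hzO
    have h2 : ∫ θ in (0 : ℝ)..τ, k₂ (z + θ • e) = ∫ s in z.2..(z.2 + τ), k₂ (z.1, s) := by
      have h3 := intervalIntegral.integral_comp_add_left (a := 0) (b := τ)
        (fun s ↦ k₂ (z.1, s)) z.2
      rw [add_zero] at h3
      rw [← h3]
      refine intervalIntegral.integral_congr fun θ _ ↦ ?_
      congr 1
      simp [he, Prod.ext_iff]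
    have h4 := intervalIntegral.integral_Iic_sub_Iic (a := z.2) (b := z.2 + τ)
      hkz.integrableOn hkz.integrableOn
    have h5 : z + τ • e = (z.1, z.2 + τ) := by simp [he, Prod.ext_iff]
    simp only [hh₂]
    rw [h2, ← h4] at h1
    rw [h5] at h1 ⊢
    simp only
    rw [sub_eq_sub_iff_sub_eq_sub]
    exact h1
  have hmeas : MeasurableSet {p : ℝ × (E × ℝ) | p.2 ∈ O p.1 → h₂ (p.2 + p.1 • e) = h₂ p.2} := by
    have h1 : MeasurableSet {p : ℝ × (E × ℝ) | p.2 ∈ O p.1} := by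
      have : IsOpen {p : ℝ × (E × ℝ) | p.2 ∈ O p.1} := by
        have e1 : {p : ℝ × (E × ℝ) | p.2 ∈ O p.1} =
            (fun p ↦ p.2.1) ⁻¹' interior K ∩ ((fun p ↦ p.2.2) ⁻¹' Ioo a b ∩
              (fun p ↦ p.2.2 + p.1) ⁻¹' Ioo a b) := by
          ext p; rfl
        rw [e1]
        exact (isOpen_interior.preimage (by fun_prop)).inter
          ((isOpen_Ioo.preimage (by fun_prop)).inter (isOpen_Ioo.preimage (by fun_prop)))
      exact this.measurableSet
    have h2 : MeasurableSet {p : ℝ × (E × ℝ) | h₂ (p.2 + p.1 • e) = h₂ p.2} := by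
      refine StronglyMeasurable.measurableSet_eq_fun
        (hh₂m.comp_measurable ?_) (hh₂m.comp_measurable measurable_snd)
      exact (continuous_snd.add (continuous_fst.smul continuous_const)).measurable
    have h3 : {p : ℝ × (E × ℝ) | p.2 ∈ O p.1 → h₂ (p.2 + p.1 • e) = h₂ p.2} =
        {p : ℝ × (E × ℝ) | p.2 ∈ O p.1}ᶜ ∪ {p | h₂ (p.2 + p.1 • e) = h₂ p.2} := by
      ext p
      simp only [mem_ofPred_eq, mem_union, mem_compl_iff]
      tauto
    rw [h3]
    exact h1.compl.union h2
  -- the exceptional null set of `z` depends on `τ`; Fubini's theorem exchanges the two quantifiers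
  have hall : ∀ᵐ z : E × ℝ, ∀ᵐ τ : ℝ, z ∈ O τ → h₂ (z + τ • e) = h₂ z :=
    (Measure.ae_ae_comm (μ := (volume : Measure ℝ)) (ν := (volume : Measure (E × ℝ))) hmeas).1
      (Eventually.of_forall hconst)
  have hall2 : ∀ᵐ y : E, ∀ᵐ t : ℝ, ∀ᵐ τ : ℝ, (y, t) ∈ O τ → h₂ ((y, t) + τ • e) = h₂ (y, t) :=
    Measure.ae_ae_of_ae_prod (μ := (volume : Measure E)) (ν := (volume : Measure ℝ)) hall
  have hfe2 : ∀ᵐ y : E, ∀ᵐ t : ℝ, S.indicator f (y, t) = f₂ (y, t) :=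
    Measure.ae_ae_of_ae_prod (μ := (volume : Measure E)) (ν := (volume : Measure ℝ)) hfe
  have hke2 : ∀ᵐ y : E, ∀ᵐ t : ℝ, S.indicator (fun z ↦ f' z e) (y, t) = k₂ (y, t) :=
    Measure.ae_ae_of_ae_prod (μ := (volume : Measure E)) (ν := (volume : Measure ℝ)) hke
  have hky2 : ∀ᵐ y : E, Integrable fun s ↦ k₂ (y, s) := hki₂.prod_right_ae
  filter_upwards [hall2, hfe2, hke2, hky2] with y hy hfy hky hkiy hyK
  filter_upwards [hy, hfy] with t ht hft
  have ht2 : ∀ᵐ t' : ℝ, (y, t) ∈ O (t' - t) → h₂ ((y, t) + (t' - t) • e) = h₂ (y, t) :=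
    (measurePreserving_sub_right volume t).quasiMeasurePreserving.ae ht
  filter_upwards [ht2, hfy] with t' ht' hft' hta htb
  have hyK' := interior_subset hyK
  have htS : (y, t) ∈ S := ⟨hyK', Ioo_subset_Icc_self hta⟩
  have htS' : (y, t') ∈ S := ⟨hyK', Ioo_subset_Icc_self htb⟩
  have h1 := ht' ⟨hyK, hta, by rw [mem_preimage, add_sub_cancel]; exact htb⟩
  have h2 : (y, t) + (t' - t) • e = (y, t') := by simp [he]
  rw [h2] at h1
  simp only [hh₂] at h1
  rw [sub_eq_sub_iff_sub_eq_sub, intervalIntegral.integral_Iic_sub_Iic hkiy.integrableOn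
    hkiy.integrableOn, ← hft, ← hft',
    indicator_of_mem htS, indicator_of_mem htS'] at h1
  rw [h1]
  refine intervalIntegral.integral_congr_ae ?_
  filter_upwards [hky] with s hs hst
  rw [← hs, indicator_of_mem]
  refine ⟨hyK', ?_⟩
  rw [mem_uIoc] at hst
  rcases hst with h3 | h3
  · exact ⟨by linarith [hta.1], by linarith [htb.2]⟩
  · exact ⟨by linarith [htb.1], by linarith [hta.2]⟩

/-- The value at height `0` of a function with derivative `k` on the interval `(0, 1)`. It is
obtained by averaging `h t - ∫ s in 0..t, k s`, which is constant almost everywhere, so that the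
value depends measurably on parameters. -/
def bottomValue (h k : ℝ → F) : F := ∫ t in Ioo (0 : ℝ) 1, (h t - ∫ s in (0 : ℝ)..t, k s)

/-- A function on the base is the trace on the bottom of a cylinder `Ω × (0, 1)` of a function on
this cylinder: the version of `HasTrace` for the Lebesgue measure on the base. -/
structure HasBottomTrace (Ω : Set E) (f : E × ℝ → F) (u : E → F) : Prop where
  aestronglyMeasurable : AEStronglyMeasurable u (volume.restrict Ω)
  tendsto : ∀ K ⊆ Ω, IsCompact K → Tendsto (fun ε : ℝ ↦ ENNReal.ofReal ε⁻¹ *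
    ∫⁻ z in K ×ˢ Ioo (0 : ℝ) ε, ‖f z - u z.1‖ₑ) (𝓝[>] 0) (𝓝 0)

/-- On almost every vertical line, a weakly differentiable function is the sum of its bottom value
and of the integral of its vertical derivative. -/
lemma HasWeakFDerivOn.ae_ae_eq_bottomValue_add {f : E × ℝ → F} {f' : E × ℝ → E × ℝ →L[ℝ] F}
    {Ω : Set E} (hf : HasWeakFDerivOn f f' (Ω ×ˢ Ioo 0 1)) {K : Set E} (hK : IsCompact K)
    (hKΩ : K ⊆ Ω) (hk : IntegrableOn (fun z ↦ f' z (0, 1)) (K ×ˢ Ioo 0 1)) :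
    ∀ᵐ y : E, y ∈ interior K → ∀ᵐ t : ℝ, t ∈ Ioo (0 : ℝ) 1 →
      f (y, t) = bottomValue (fun t ↦ f (y, t)) (fun t ↦ f' (y, t) (0, 1)) +
        ∫ s in (0 : ℝ)..t, f' (y, s) (0, 1) := by
  -- the interval `(0, 1)` is exhausted by the intervals `(1 / (n + 2), 1 - 1 / (n + 2))`
  have h1 : ∀ n : ℕ, ∀ᵐ y : E, y ∈ interior K → ∀ᵐ t : ℝ, ∀ᵐ t' : ℝ,
      t ∈ Ioo (1 / ((n : ℝ) + 2)) (1 - 1 / ((n : ℝ) + 2)) →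
      t' ∈ Ioo (1 / ((n : ℝ) + 2)) (1 - 1 / ((n : ℝ) + 2)) →
      f (y, t') - f (y, t) = ∫ s in t..t', f' (y, s) (0, 1) := fun n ↦
    hf.ae_ae_sub_eq_integral hK hKΩ (by positivity) (by
      have : 0 < 1 / ((n : ℝ) + 2) := by positivity
      linarith)
  rw [IntegrableOn, Measure.volume_eq_prod, ← Measure.prod_restrict] at hk
  have hk2 := (ae_restrict_iff' hK.measurableSet).1 hk.prod_right_ae
  filter_upwards [ae_all_iff.2 h1, hk2] with y hy hky hyK
  have hint : ∀ t ∈ Ioo (0 : ℝ) 1, IntervalIntegrable (fun s ↦ f' (y, s) (0, 1)) volume 0 t := by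
    intro t ht
    rw [intervalIntegrable_iff_integrableOn_Ioo_of_le ht.1.le]
    exact (hky (interior_subset hyK)).mono_measure
      (Measure.restrict_mono (Ioo_subset_Ioo_right ht.2.le) le_rfl)
  have h2 : ∀ᵐ t : ℝ, ∀ n : ℕ, ∀ᵐ t' : ℝ,
      t ∈ Ioo (1 / ((n : ℝ) + 2)) (1 - 1 / ((n : ℝ) + 2)) →
      t' ∈ Ioo (1 / ((n : ℝ) + 2)) (1 - 1 / ((n : ℝ) + 2)) →
      f (y, t') - f (y, t) = ∫ s in t..t', f' (y, s) (0, 1) :=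
    ae_all_iff.2 fun n ↦ hy n hyK
  filter_upwards [h2] with t ht ht01
  have h3 : ∀ᵐ t' : ℝ, t' ∈ Ioo (0 : ℝ) 1 →
      f (y, t') - ∫ s in (0 : ℝ)..t', f' (y, s) (0, 1) =
      f (y, t) - ∫ s in (0 : ℝ)..t, f' (y, s) (0, 1) := by
    filter_upwards [ae_all_iff.2 ht] with t' ht' ht'01
    have hlim : Tendsto (fun n : ℕ ↦ 1 / ((n : ℝ) + 2)) atTop (𝓝 0) :=
      tendsto_const_nhds.div_atTop
        (tendsto_atTop_add_const_right _ _ tendsto_natCast_atTop_atTop)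
    have hm : 0 < min (min t t') (min (1 - t) (1 - t')) :=
      lt_min (lt_min ht01.1 ht'01.1) (lt_min (by linarith [ht01.2]) (by linarith [ht'01.2]))
    obtain ⟨n, hn⟩ := (hlim.eventually (gt_mem_nhds hm)).exists
    rw [lt_min_iff, lt_min_iff, lt_min_iff] at hn
    have h4 := ht' n ⟨hn.1.1, by linarith [hn.2.1]⟩ ⟨hn.1.2, by linarith [hn.2.2]⟩
    rw [sub_eq_sub_iff_sub_eq_sub, h4,
      intervalIntegral.integral_interval_sub_left (hint t' ht'01) (hint t ht01)]
  have h5 : bottomValue (fun t ↦ f (y, t)) (fun t ↦ f' (y, t) (0, 1)) =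
      f (y, t) - ∫ s in (0 : ℝ)..t, f' (y, s) (0, 1) := by
    unfold bottomValue
    rw [setIntegral_congr_ae measurableSet_Ioo h3]
    simp
  rw [h5, sub_add_cancel]

/-- A weakly differentiable function on a cylinder whose vertical derivative is integrable up to
the bottom has a trace on the bottom: at height `t < ε`, it differs from its bottom value at most
by the integral of the norm of its vertical derivative over `(0, ε)`. -/
theorem HasWeakFDerivOn.hasBottomTrace {f : E × ℝ → F} {f' : E × ℝ → E × ℝ →L[ℝ] F}
    {Ω : Set E} (hΩ : IsOpen Ω) (hf : HasWeakFDerivOn f f' (Ω ×ˢ Ioo 0 1))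
    (hk : ∀ K ⊆ Ω, IsCompact K → IntegrableOn (fun z ↦ f' z (0, 1)) (K ×ˢ Ioo 0 1)) :
    HasBottomTrace Ω f
      fun y ↦ bottomValue (fun t ↦ f (y, t)) (fun t ↦ f' (y, t) (0, 1)) := by
  have hfm : AEStronglyMeasurable f
      ((volume.restrict Ω).prod (volume.restrict (Ioo (0 : ℝ) 1))) := by
    rw [Measure.prod_restrict]
    exact hf.1.aestronglyMeasurable
  have hkm : AEStronglyMeasurable (fun z ↦ f' z (0, 1))
      ((volume.restrict Ω).prod (volume.restrict (Ioo (0 : ℝ) 1))) := by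
    rw [Measure.prod_restrict]
    exact (LocallyIntegrableOn.clm_apply_const hf.2 _).aestronglyMeasurable
  have hum : AEStronglyMeasurable
      (fun y ↦ bottomValue (fun t ↦ f (y, t)) (fun t ↦ f' (y, t) (0, 1)))
      (volume.restrict Ω) := by
    have h1 : AEStronglyMeasurable (fun p : (E × ℝ) × ℝ ↦
        {p : (E × ℝ) × ℝ | p.2 ≤ p.1.2}.indicator (fun p ↦ f' (p.1.1, p.2) (0, 1)) p)
        (((volume.restrict Ω).prod (volume.restrict (Ioo (0 : ℝ) 1))).prod
          (volume.restrict (Ioo (0 : ℝ) 1))) := by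
      refine AEStronglyMeasurable.indicator ?_
        (measurableSet_le measurable_snd (measurable_snd.comp measurable_fst))
      refine hkm.comp_quasiMeasurePreserving (f := fun p : (E × ℝ) × ℝ ↦ (p.1.1, p.2)) ?_
      exact QuasiMeasurePreserving.prodMap Measure.quasiMeasurePreserving_fst
        (Measure.QuasiMeasurePreserving.id _)
    have h2 := h1.integral_prod_right'
    have h3 := (hfm.sub h2).integral_prod_right'
    refine h3.congr (Eventually.of_forall fun y ↦ ?_)
    unfold bottomValue
    refine setIntegral_congr_fun measurableSet_Ioo fun t ht ↦ ?_
    simp only [Pi.sub_apply]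
    congr 1
    rw [intervalIntegral.integral_of_le ht.1.le, ← integral_Ioc_eq_integral_Ioo]
    have h4 : Ioc 0 t = Iic t ∩ Ioc (0 : ℝ) 1 := by
      ext s
      simp only [mem_Ioc, mem_inter_iff, mem_Iic]
      constructor
      · rintro ⟨h5, h6⟩; exact ⟨h6, h5, by linarith [ht.2]⟩
      · rintro ⟨h5, h6, -⟩; exact ⟨h6, h5⟩
    rw [h4, ← Measure.restrict_restrict measurableSet_Iic, ← integral_indicator measurableSet_Iic]
    rfl
  refine ⟨hum, ?_⟩
  intro K hKΩ hK
  set u : E → F := fun y ↦ bottomValue (fun t ↦ f (y, t)) (fun t ↦ f' (y, t) (0, 1)) with hu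
  obtain ⟨K', hK', hKK', hK'Ω⟩ := exists_compact_between hK hΩ hKΩ
  have hae := hf.ae_ae_eq_bottomValue_add hK' hK'Ω (hk K' hK'Ω hK')
  have hest : ∀ ε ∈ Ioo (0 : ℝ) 1, ENNReal.ofReal ε⁻¹ *
      ∫⁻ z in K ×ˢ Ioo (0 : ℝ) ε, ‖f z - u z.1‖ₑ ≤
      ∫⁻ z in K ×ˢ Ioo (0 : ℝ) ε, ‖f' z (0, 1)‖ₑ := by
    intro ε hε
    have hsub : (volume.restrict K).prod (volume.restrict (Ioo 0 ε)) ≤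
        (volume.restrict Ω).prod (volume.restrict (Ioo (0 : ℝ) 1)) := by
      rw [Measure.prod_restrict, Measure.prod_restrict]
      exact Measure.restrict_mono (prod_mono hKΩ (Ioo_subset_Ioo_right hε.2.le)) le_rfl
    have hm1 : AEMeasurable (fun z : E × ℝ ↦ ‖f z - u z.1‖ₑ)
        ((volume.restrict K).prod (volume.restrict (Ioo 0 ε))) := by
      refine ((hfm.mono_measure hsub).sub ?_).enorm
      exact (hum.mono_measure (Measure.restrict_mono hKΩ le_rfl)).comp_quasiMeasurePreserving
        Measure.quasiMeasurePreserving_fst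
    have hm2 : AEMeasurable (fun z : E × ℝ ↦ ‖f' z (0, 1)‖ₑ)
        ((volume.restrict K).prod (volume.restrict (Ioo 0 ε))) := (hkm.mono_measure hsub).enorm
    rw [Measure.volume_eq_prod, ← Measure.prod_restrict, lintegral_prod _ hm1,
      lintegral_prod _ hm2]
    have hεinv : ENNReal.ofReal ε⁻¹ * ENNReal.ofReal ε = 1 := by
      rw [← ENNReal.ofReal_mul (inv_nonneg.2 hε.1.le), inv_mul_cancel₀ hε.1.ne', ENNReal.ofReal_one]
    have h1 : ∫⁻ y in K, ∫⁻ t in Ioo 0 ε, ‖f (y, t) - u y‖ₑ ≤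
        ∫⁻ y in K, ENNReal.ofReal ε * ∫⁻ t in Ioo 0 ε, ‖f' (y, t) (0, 1)‖ₑ := by
      refine setLIntegral_mono_ae' hK.measurableSet ?_
      filter_upwards [hae] with y hy hyK
      have h2 : ∫⁻ t in Ioo 0 ε, ‖f (y, t) - u y‖ₑ ≤
          ∫⁻ _ in Ioo 0 ε, (∫⁻ t in Ioo 0 ε, ‖f' (y, t) (0, 1)‖ₑ) := by
        refine setLIntegral_mono_ae' measurableSet_Ioo ?_
        filter_upwards [hy (hKK' hyK)] with t ht htε
        rw [ht ⟨htε.1, htε.2.trans hε.2⟩]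
        simp only [hu, add_sub_cancel_left]
        rw [intervalIntegral.integral_of_le htε.1.le]
        refine (enorm_integral_le_lintegral_enorm _).trans ?_
        have hsub : Ioc 0 t ⊆ Ioo 0 ε := fun s hs ↦ ⟨hs.1, hs.2.trans_lt htε.2⟩
        exact lintegral_mono' (Measure.restrict_mono hsub le_rfl) le_rfl
      refine h2.trans (le_of_eq ?_)
      rw [lintegral_const, Measure.restrict_apply_univ, Real.volume_Ioo, sub_zero, mul_comm]
    calc _ ≤ ENNReal.ofReal ε⁻¹ *
          ∫⁻ y in K, ENNReal.ofReal ε * ∫⁻ t in Ioo 0 ε, ‖f' (y, t) (0, 1)‖ₑ :=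
          mul_le_mul_right h1 _
      _ = _ := by
        rw [lintegral_const_mul' _ _ ENNReal.ofReal_ne_top, ← mul_assoc, hεinv, one_mul]
  have hlim : Tendsto (fun ε : ℝ ↦ ∫⁻ z in K ×ˢ Ioo (0 : ℝ) ε, ‖f' z (0, 1)‖ₑ)
      (𝓝[>] 0) (𝓝 0) := by
    have hi : IntegrableOn (fun z ↦ f' z (0, 1)) (K ×ˢ Ioo 0 1) := hk K hKΩ hK
    have h1 : Tendsto (fun ε : ℝ ↦ (volume.restrict (K ×ˢ Ioo (0 : ℝ) 1)) (K ×ˢ Ioo (0 : ℝ) ε))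
        (𝓝[>] 0) (𝓝 0) := by
      have h2 : Tendsto (fun ε : ℝ ↦ (volume : Measure E) K * ENNReal.ofReal ε) (𝓝[>] 0) (𝓝 0) := by
        have h3 : Tendsto (fun ε : ℝ ↦ ENNReal.ofReal ε) (𝓝 0) (𝓝 (ENNReal.ofReal 0)) :=
          ENNReal.continuous_ofReal.tendsto 0
        rw [ENNReal.ofReal_zero] at h3
        have h4 := ENNReal.Tendsto.const_mul (h3.mono_left (nhdsWithin_le_nhds (s := Ioi 0)))
          (Or.inr (hK.measure_lt_top (μ := (volume : Measure E))).ne)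
        rwa [mul_zero] at h4
      refine tendsto_of_tendsto_of_tendsto_of_le_of_le tendsto_const_nhds h2 (fun _ ↦ zero_le)
        fun ε ↦ ?_
      refine (Measure.restrict_apply_le (K ×ˢ Ioo (0 : ℝ) 1) (K ×ˢ Ioo (0 : ℝ) ε)).trans ?_
      rw [Measure.volume_eq_prod, Measure.prod_prod, Real.volume_Ioo, sub_zero]
    refine (tendsto_setLIntegral_zero (f := fun z ↦ ‖f' z (0, 1)‖ₑ) hi.2.ne h1).congr' ?_
    filter_upwards [Ioo_mem_nhdsGT (zero_lt_one' ℝ)] with ε hε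
    rw [Measure.restrict_restrict (hK.measurableSet.prod measurableSet_Ioo), inter_eq_left.2]
    exact prod_mono le_rfl (Ioo_subset_Ioo_right hε.2.le)
  refine tendsto_of_tendsto_of_tendsto_of_le_of_le' tendsto_const_nhds hlim
    (Eventually.of_forall fun _ ↦ zero_le) ?_
  filter_upwards [Ioo_mem_nhdsGT (zero_lt_one' ℝ)] with ε hε using hest ε hε

lemma HasBottomTrace.aestronglyMeasurable_sub {f : E × ℝ → F} {u : E → F} {Ω : Set E}
    (hf : LocallyIntegrableOn f (Ω ×ˢ Ioo 0 1)) (hu : HasBottomTrace Ω f u) {K : Set E}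
    (hK : K ⊆ Ω) {ε : ℝ} (hε : ε ≤ 1) :
    AEStronglyMeasurable (fun z : E × ℝ ↦ f z - u z.1) (volume.restrict (K ×ˢ Ioo 0 ε)) := by
  have hfm : AEStronglyMeasurable f
      ((volume.restrict K).prod (volume.restrict (Ioo (0 : ℝ) ε))) := by
    rw [Measure.prod_restrict]
    exact hf.aestronglyMeasurable.mono_measure
      (Measure.restrict_mono (prod_mono hK (Ioo_subset_Ioo_right hε)) le_rfl)
  have hum := (hu.1.mono_measure (Measure.restrict_mono hK le_rfl)).comp_quasiMeasurePreserving
    (Measure.quasiMeasurePreserving_fst (ν := volume.restrict (Ioo (0 : ℝ) ε)))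
  rw [Measure.volume_eq_prod, ← Measure.prod_restrict]
  exact hfm.sub hum

/-- A locally integrable function with a trace is integrable up to the bottom. -/
lemma HasBottomTrace.locallyIntegrableOn {f : E × ℝ → F} {u : E → F} {Ω : Set E}
    (hΩ : IsOpen Ω) (hf : LocallyIntegrableOn f (Ω ×ˢ Ioo 0 1)) (hu : HasBottomTrace Ω f u) :
    LocallyIntegrableOn f (Ω ×ˢ Ico 0 1) := by
  rintro ⟨y₀, t₀⟩ ⟨hy₀, ht₀, ht₁⟩
  simp only at hy₀ ht₀ ht₁
  rcases ht₀.eq_or_lt with h0 | h0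
  · subst h0
    obtain ⟨K, hK, hyK, hKΩ⟩ := exists_compact_subset hΩ hy₀
    have h1 := ((hu.2 K hKΩ hK).eventually (gt_mem_nhds zero_lt_one)).and
      (Ioo_mem_nhdsGT (zero_lt_one' ℝ))
    obtain ⟨ε, hε1, hε⟩ := h1.exists
    have hfin : ∫⁻ z in K ×ˢ Ioo (0 : ℝ) ε, ‖f z - u z.1‖ₑ < ⊤ := by
      refine lt_of_le_of_ne le_top fun h2 ↦ ?_
      rw [h2, ENNReal.mul_top (by simpa using hε.1)] at hε1
      simp at hε1
    have hd : IntegrableOn (fun z : E × ℝ ↦ f z - u z.1) (K ×ˢ Ioo 0 ε) :=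
      ⟨hu.aestronglyMeasurable_sub hf hKΩ hε.2.le, hfin⟩
    -- on the slab `K × [ε / 4, ε / 2]`, both `f` and `f - u` are integrable; hence so is `u`
    have hsub1 : Icc (ε / 4) (ε / 2) ⊆ Ioo 0 1 :=
      Icc_subset_Ioo (by linarith [hε.1]) (by linarith [hε.2, hε.1])
    have hsub2 : Icc (ε / 4) (ε / 2) ⊆ Ioo 0 ε :=
      Icc_subset_Ioo (by linarith [hε.1]) (by linarith [hε.2, hε.1])
    have hf1 : IntegrableOn f (K ×ˢ Icc (ε / 4) (ε / 2)) :=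
      hf.integrableOn_compact_subset (prod_mono hKΩ hsub1) (hK.prod isCompact_Icc)
    have hu1 : IntegrableOn (fun z : E × ℝ ↦ u z.1) (K ×ˢ Icc (ε / 4) (ε / 2)) := by
      refine (hf1.sub (hd.mono_set (prod_mono le_rfl hsub2))).congr
        (Eventually.of_forall fun z ↦ ?_)
      simp
    have hu2 : IntegrableOn u K := by
      rw [IntegrableOn, Measure.volume_eq_prod, ← Measure.prod_restrict] at hu1
      have h2 := hu1.prod_left_ae
      have h3 : (ae ((volume : Measure ℝ).restrict (Icc (ε / 4) (ε / 2)))).NeBot := by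
        rw [ae_neBot, Ne, Measure.restrict_eq_zero, Real.volume_Icc, ENNReal.ofReal_eq_zero]
        linarith [hε.1]
      exact h2.exists.choose_spec
    have hu3 : IntegrableOn (fun z : E × ℝ ↦ u z.1) (K ×ˢ Ioo 0 ε) := by
      rw [IntegrableOn, Measure.volume_eq_prod, ← Measure.prod_restrict]
      exact hu2.comp_fst _
    have hf2 : IntegrableOn f (K ×ˢ Ioo 0 ε) := by
      refine (hd.add hu3).congr (Eventually.of_forall fun z ↦ ?_)
      simp
    have hf3 : IntegrableOn f (K ×ˢ Ico 0 ε) := by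
      rw [IntegrableOn, Measure.volume_eq_prod, ← Measure.prod_restrict] at hf2 ⊢
      rwa [Measure.restrict_congr_set Ioo_ae_eq_Ico] at hf2
    refine ⟨K ×ˢ Ico 0 ε, ?_, hf3⟩
    have h4 : K ×ˢ Ioo (-1) ε ∈ 𝓝 (y₀, (0 : ℝ)) :=
      prod_mem_nhds (mem_interior_iff_mem_nhds.1 hyK) (Ioo_mem_nhds (by norm_num) hε.1)
    filter_upwards [mem_nhdsWithin_of_mem_nhds h4, self_mem_nhdsWithin] with z hz hz2
    exact ⟨hz.1, hz2.2.1, hz.2.2⟩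
  · obtain ⟨s, hs, hi⟩ := hf (y₀, t₀) ⟨hy₀, h0, ht₁⟩
    rw [(hΩ.prod isOpen_Ioo).nhdsWithin_eq ⟨hy₀, h0, ht₁⟩] at hs
    exact ⟨s, mem_nhdsWithin_of_mem_nhds hs, hi⟩

/-- Two functions with the same trace have no jump across the bottom, in the sense of averages. -/
lemma HasBottomTrace.tendsto_sub {f g : E × ℝ → F} {u : E → F} {Ω : Set E}
    (hf : LocallyIntegrableOn f (Ω ×ˢ Ioo 0 1))
    (hu : HasBottomTrace Ω f u) (hv : HasBottomTrace Ω g u) {K : Set E} (hKΩ : K ⊆ Ω)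
    (hK : IsCompact K) :
    Tendsto (fun ε : ℝ ↦ ENNReal.ofReal ε⁻¹ *
      ∫⁻ z in K ×ˢ Ioo (0 : ℝ) ε, ‖f z - g z‖ₑ) (𝓝[>] 0) (𝓝 0) := by
  have h1 := (hu.2 K hKΩ hK).add (hv.2 K hKΩ hK)
  rw [add_zero] at h1
  refine tendsto_of_tendsto_of_tendsto_of_le_of_le' tendsto_const_nhds h1
    (Eventually.of_forall fun _ ↦ zero_le) ?_
  filter_upwards [Ioo_mem_nhdsGT (zero_lt_one' ℝ)] with ε hε
  rw [← mul_add]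
  refine mul_le_mul_right ?_ _
  rw [← lintegral_add_left' (hu.aestronglyMeasurable_sub hf hKΩ hε.2.le).enorm]
  refine lintegral_mono fun z ↦ ?_
  have h2 : f z - g z = (f z - u z.1) - (g z - u z.1) := by abel
  rw [h2]
  exact enorm_sub_le

end Trace

/-! ### The Riemannian volume in a chart -/

section Riemannian

variable {n : ℕ} {M : Type*} [TopologicalSpace M] [ChartedSpace (EuclideanSpace ℝ (Fin n)) M]

variable (n) in
/-- The chart at `x₀`, with its model space made explicit. -/
abbrev chartOf (x₀ : M) : OpenPartialHomeomorph M (EuclideanSpace ℝ (Fin n)) :=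
  chartAt (EuclideanSpace ℝ (Fin n)) x₀

/-- The derivative of the inverse of the chart at `x₀`, as an endomorphism of the model space
(to which every tangent space of `M` is equal by definition). -/
def chartDeriv (x₀ : M) (y : EuclideanSpace ℝ (Fin n)) :
    EuclideanSpace ℝ (Fin n) →L[ℝ] EuclideanSpace ℝ (Fin n) :=
  mfderiv (𝓡 n) (𝓡 n) (chartOf n x₀).symm y

lemma mdifferentiable_chartOf [IsManifold (𝓡 n) ∞ M] (x₀ : M) :
    (chartOf n x₀).MDifferentiable (𝓡 n) (𝓡 n) := by
  have : IsManifold (𝓡 n) 1 M := IsManifold.of_le (n := ∞) (by simp)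
  exact mdifferentiable_chart x₀

section Metric

variable [RiemannianBundle (fun x : M ↦ TangentSpace (𝓡 n) x)]

/-- The Riemannian metric at `q`, as a function on the model space. As the type of its arguments
does not depend on `q`, no transport is needed between the tangent spaces at two expressions of the
same point. -/
def metricForm (q : M) (a b : EuclideanSpace ℝ (Fin n)) : ℝ :=
  inner ℝ (show TangentSpace (𝓡 n) q from a) (show TangentSpace (𝓡 n) q from b)

lemma metricForm_sum_smul (q : M) (c d : Fin n → ℝ) (v w : Fin n → EuclideanSpace ℝ (Fin n)) :
    metricForm q (∑ i, c i • v i) (∑ j, d j • w j) =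
      ∑ i, ∑ j, c i * d j * metricForm q (v i) (w j) := by
  have h := sum_inner (𝕜 := ℝ) (E := TangentSpace (𝓡 n) q) Finset.univ (fun i ↦ c i • v i)
    (∑ j, d j • w j : EuclideanSpace ℝ (Fin n))
  refine h.trans (Finset.sum_congr rfl fun i _ ↦ ?_)
  have h' := inner_sum (𝕜 := ℝ) (E := TangentSpace (𝓡 n) q) Finset.univ (fun j ↦ d j • w j)
    (c i • v i : EuclideanSpace ℝ (Fin n))
  refine h'.trans (Finset.sum_congr rfl fun j _ ↦ ?_)
  have h1 := real_inner_smul_left (F := TangentSpace (𝓡 n) q) (v i) (d j • w j) (c i)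
  have h2 := real_inner_smul_right (F := TangentSpace (𝓡 n) q) (v i) (w j) (d j)
  refine h1.trans ?_
  rw [mul_assoc]
  exact congrArg (c i * ·) h2

lemma gramMatrix_apply (x₀ : M) (y : EuclideanSpace ℝ (Fin n)) (k l : Fin n) :
    gramMatrix x₀ y k l = metricForm ((chartOf n x₀).symm y)
      (chartDeriv x₀ y (EuclideanSpace.single k 1)) (chartDeriv x₀ y (EuclideanSpace.single l 1)) :=
  rfl

variable [IsManifold (𝓡 n) ∞ M]

lemma chartDeriv_injective (x₀ : M) {y : EuclideanSpace ℝ (Fin n)}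
    (hy : y ∈ (chartOf n x₀).target) : Function.Injective (chartDeriv x₀ y) := by
  have h := (mdifferentiable_chartOf x₀).comp_symm_deriv hy
  exact Function.LeftInverse.injective
    (g := mfderiv (𝓡 n) (𝓡 n) (chartOf n x₀) ((chartOf n x₀).symm y))
    fun v ↦ congrArg (fun A : EuclideanSpace ℝ (Fin n) →L[ℝ] EuclideanSpace ℝ (Fin n) ↦ A v) h

lemma det_gramMatrix_pos (x₀ : M) {y : EuclideanSpace ℝ (Fin n)}
    (hy : y ∈ (chartOf n x₀).target) : 0 < (gramMatrix x₀ y).det := by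
  have h1 : LinearIndependent ℝ fun k : Fin n ↦
      (EuclideanSpace.single k (1 : ℝ) : EuclideanSpace ℝ (Fin n)) := by
    have := (EuclideanSpace.basisFun (Fin n) ℝ).toBasis.linearIndependent
    rw [OrthonormalBasis.coe_toBasis] at this
    simpa only [funext fun k ↦ EuclideanSpace.basisFun_apply (Fin n) ℝ k] using this
  have h2 := h1.map' (chartDeriv x₀ y).toLinearMap
    (LinearMap.ker_eq_bot.2 (chartDeriv_injective x₀ hy))
  exact (Matrix.posDef_gram_of_linearIndependent (𝕜 := ℝ)
    (E := TangentSpace (𝓡 n) ((chartOf n x₀).symm y)) h2).det_pos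

variable [IsContMDiffRiemannianBundle (𝓡 n) ∞ (EuclideanSpace ℝ (Fin n))
      (fun x : M ↦ TangentSpace (𝓡 n) x)]

lemma isContinuousRiemannianBundle_tangentSpace :
    IsContinuousRiemannianBundle (EuclideanSpace ℝ (Fin n))
      (fun x : M ↦ TangentSpace (𝓡 n) x) := by
  obtain ⟨g, hg, hg'⟩ := IsContMDiffRiemannianBundle.exists_contMDiff (IB := 𝓡 n) (n := ∞)
    (F := EuclideanSpace ℝ (Fin n)) (E := fun x : M ↦ TangentSpace (𝓡 n) x)
  exact ⟨⟨g, hg.continuous, hg'⟩⟩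

lemma continuousOn_metricForm_chartDeriv (x₀ : M) (a b : EuclideanSpace ℝ (Fin n)) :
    ContinuousOn (fun y ↦ metricForm ((chartOf n x₀).symm y) (chartDeriv x₀ y a)
      (chartDeriv x₀ y b)) (chartOf n x₀).target := by
  have hc : ∀ c : EuclideanSpace ℝ (Fin n), ContinuousOn
      (fun y ↦ (⟨(chartOf n x₀).symm y, chartDeriv x₀ y c⟩ :
        TotalSpace (EuclideanSpace ℝ (Fin n)) (TangentSpace (𝓡 n) (M := M))))
      (chartOf n x₀).target := by
    intro c
    have h1 : ContMDiffOn (𝓡 n) (𝓡 n) ∞ (chartOf n x₀).symm (chartOf n x₀).target :=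
      contMDiffOn_chart_symm
    have h2 := h1.continuousOn_tangentMapWithin (by simp)
      (chartOf n x₀).open_target.uniqueMDiffOn
    have h3 : Continuous (fun y : EuclideanSpace ℝ (Fin n) ↦
        (⟨y, c⟩ : TangentBundle (𝓡 n) (EuclideanSpace ℝ (Fin n)))) :=
      (tangentBundleModelSpaceHomeomorph (𝓡 n)).symm.continuous.comp
        (continuous_id.prodMk continuous_const)
    refine (h2.comp h3.continuousOn fun y hy ↦ hy).congr fun y hy ↦ ?_
    change _ = (⟨(chartOf n x₀).symm y, mfderivWithin (𝓡 n) (𝓡 n) (chartOf n x₀).symm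
      (chartOf n x₀).target y c⟩ :
        TotalSpace (EuclideanSpace ℝ (Fin n)) (TangentSpace (𝓡 n) (M := M)))
    rw [mfderivWithin_of_isOpen (chartOf n x₀).open_target hy]
    rfl
  have := isContinuousRiemannianBundle_tangentSpace (n := n) (M := M)
  exact ContinuousOn.inner_bundle (hc a) (hc b)

lemma continuousOn_det_gramMatrix (x₀ : M) :
    ContinuousOn (fun y ↦ (gramMatrix x₀ y).det) (chartOf n x₀).target := by
  rw [continuousOn_iff_continuous_domRestrict]
  refine Continuous.matrix_det (continuous_matrix fun k l ↦ ?_)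
  exact continuousOn_iff_continuous_domRestrict.1 (continuousOn_metricForm_chartDeriv x₀ _ _)

end Metric

variable [IsManifold (𝓡 n) ∞ M]

/-- The chain rule for the transition map from the chart at `x₀` to the chart at `x₁`. -/
lemma hasFDerivAt_transition (x₀ x₁ : M) {y : EuclideanSpace ℝ (Fin n)}
    (hy : y ∈ (chartOf n x₀).target) (hy' : (chartOf n x₀).symm y ∈ (chartOf n x₁).source) :
    ∃ J : EuclideanSpace ℝ (Fin n) →L[ℝ] EuclideanSpace ℝ (Fin n),
      HasFDerivAt (fun y ↦ chartOf n x₁ ((chartOf n x₀).symm y)) J y ∧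
      chartDeriv x₀ y =
        (chartDeriv x₁ (chartOf n x₁ ((chartOf n x₀).symm y))).comp J := by
  have h0 := ((mdifferentiable_chartOf x₀).mdifferentiableAt_symm hy).hasMFDerivAt
  have h1 := ((mdifferentiable_chartOf x₁).mdifferentiableAt hy').hasMFDerivAt
  have h2 := h1.comp y h0
  refine ⟨_, h2.hasFDerivAt, ?_⟩
  have h3 := (mdifferentiable_chartOf x₁).symm_comp_deriv hy'
  ext1 v
  exact (congrArg (fun A : EuclideanSpace ℝ (Fin n) →L[ℝ] EuclideanSpace ℝ (Fin n) ↦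
    A (chartDeriv x₀ y v)) h3).symm

variable [RiemannianBundle (fun x : M ↦ TangentSpace (𝓡 n) x)]

/-- The Gram matrices in two charts are related by `g₀ = Jᵀ g₁ J`, where `J` is the derivative of
the transition map. -/
lemma det_gramMatrix_transition (x₀ x₁ : M) {y : EuclideanSpace ℝ (Fin n)}
    (hy' : (chartOf n x₀).symm y ∈ (chartOf n x₁).source)
    {J : EuclideanSpace ℝ (Fin n) →L[ℝ] EuclideanSpace ℝ (Fin n)}
    (hJ : chartDeriv x₀ y =
        (chartDeriv x₁ (chartOf n x₁ ((chartOf n x₀).symm y))).comp J) :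
    (gramMatrix x₀ y).det =
      J.det ^ 2 * (gramMatrix x₁ (chartOf n x₁ ((chartOf n x₀).symm y))).det := by
  set y' := chartOf n x₁ ((chartOf n x₀).symm y) with hy1
  have hb : (chartOf n x₁).symm y' = (chartOf n x₀).symm y := (chartOf n x₁).left_inv hy'
  set A : Matrix (Fin n) (Fin n) ℝ := LinearMap.toMatrix
    (EuclideanSpace.basisFun (Fin n) ℝ).toBasis (EuclideanSpace.basisFun (Fin n) ℝ).toBasis
    J.toLinearMap with hA
  have hAa : ∀ i k, A i k = J (EuclideanSpace.single k 1) i := by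
    intro i k
    simp [hA, LinearMap.toMatrix_apply]
  have hdet : J.det = A.det := by
    rw [hA, LinearMap.det_toMatrix]
  have hex : ∀ k, chartDeriv x₀ y (EuclideanSpace.single k 1) =
      ∑ i, A i k • chartDeriv x₁ y' (EuclideanSpace.single i 1) := by
    intro k
    have h1 : J (EuclideanSpace.single k 1) = ∑ i, A i k • EuclideanSpace.single i (1 : ℝ) := by
      have := (EuclideanSpace.basisFun (Fin n) ℝ).toBasis.sum_repr (J (EuclideanSpace.single k 1))
      simp only [hAa]
      simpa using this.symm
    rw [hJ, ContinuousLinearMap.comp_apply, h1, map_sum]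
    simp only [map_smul]
  have hm : gramMatrix x₀ y = A.transpose * gramMatrix x₁ y' * A := by
    ext k l
    rw [gramMatrix_apply, hex, hex, metricForm_sum_smul, Matrix.mul_apply]
    simp only [Matrix.mul_apply, Matrix.transpose_apply, Finset.sum_mul, gramMatrix_apply, hb]
    rw [Finset.sum_comm]
    refine Finset.sum_congr rfl fun i _ ↦ Finset.sum_congr rfl fun j _ ↦ ?_
    ring
  rw [hm, Matrix.det_mul, Matrix.det_mul, Matrix.det_transpose, hdet]
  ring

section Measure

variable [MeasurableSpace M] [BorelSpace M]

lemma aemeasurable_symm_chartOf (x₀ : M) :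
    AEMeasurable (chartOf n x₀).symm (volume.restrict (chartOf n x₀).target) :=
  (chartOf n x₀).continuousOn_symm.aemeasurable (chartOf n x₀).open_target.measurableSet

lemma measurableSet_symm_preimage (x₀ : M) {A : Set M} (hA : MeasurableSet A) :
    MeasurableSet ((chartOf n x₀).target ∩ (chartOf n x₀).symm ⁻¹' A) := by
  have h := (continuousOn_iff_continuous_domRestrict.1
    (chartOf n x₀).continuousOn_symm).measurable hA
  have := (chartOf n x₀).open_target.measurableSet.subtype_image h
  convert this using 1
  ext y
  simp [and_comm]

lemma chartVolume_apply (x₀ : M) {A : Set M} (hA : MeasurableSet A) :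
    chartVolume (n := n) x₀ A =
      ∫⁻ y in (chartOf n x₀).target ∩ (chartOf n x₀).symm ⁻¹' A,
        ENNReal.ofReal (√(gramMatrix x₀ y).det) := by
  unfold chartVolume
  rw [Measure.map_apply_of_aemeasurable _ hA, withDensity_apply',
    Measure.restrict_restrict' (chartOf n x₀).open_target.measurableSet, inter_comm]
  exact (aemeasurable_symm_chartOf x₀).mono_ac (withDensity_absolutelyContinuous _ _)

/-- The change of variables formula for the transition between two charts. -/
lemma chartVolume_eq_of_subset (x₀ x₁ : M) {A : Set M} (hA : MeasurableSet A)
    (h0 : A ⊆ (chartOf n x₀).source) (h1 : A ⊆ (chartOf n x₁).source) :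
    chartVolume (n := n) x₁ A = chartVolume (n := n) x₀ A := by
  rw [chartVolume_apply x₁ hA, chartVolume_apply x₀ hA]
  set S := (chartOf n x₀).target ∩ (chartOf n x₀).symm ⁻¹' A with hS
  have hT : (chartOf n x₁).target ∩ (chartOf n x₁).symm ⁻¹' A =
      (fun y ↦ chartOf n x₁ ((chartOf n x₀).symm y)) '' S := by
    ext y
    constructor
    · rintro ⟨hy, hyA⟩
      refine ⟨chartOf n x₀ ((chartOf n x₁).symm y), ⟨(chartOf n x₀).map_source (h0 hyA), ?_⟩, ?_⟩
      · rw [mem_preimage, (chartOf n x₀).left_inv (h0 hyA)]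
        exact hyA
      · simp only [(chartOf n x₀).left_inv (h0 hyA), (chartOf n x₁).right_inv hy]
    · rintro ⟨w, ⟨hw, hwA⟩, rfl⟩
      refine ⟨(chartOf n x₁).map_source (h1 hwA), ?_⟩
      rw [mem_preimage, (chartOf n x₁).left_inv (h1 hwA)]
      exact hwA
  have hinj : InjOn (fun y ↦ chartOf n x₁ ((chartOf n x₀).symm y)) S := by
    intro y hy w hw hyw
    have := (chartOf n x₁).injOn (h1 hy.2) (h1 hw.2) hyw
    exact (chartOf n x₀).symm.injOn hy.1 hw.1 this
  have hJ : ∀ y : EuclideanSpace ℝ (Fin n), ∃ J : EuclideanSpace ℝ (Fin n) →L[ℝ]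
      EuclideanSpace ℝ (Fin n), y ∈ S →
      HasFDerivAt (fun y ↦ chartOf n x₁ ((chartOf n x₀).symm y)) J y ∧
      chartDeriv x₀ y = (chartDeriv x₁ (chartOf n x₁ ((chartOf n x₀).symm y))).comp J := by
    intro y
    by_cases hy : y ∈ S
    · obtain ⟨J, hJ⟩ := hasFDerivAt_transition x₀ x₁ hy.1 (h1 hy.2)
      exact ⟨J, fun _ ↦ hJ⟩
    · exact ⟨0, fun h ↦ absurd h hy⟩
  choose J hJ using hJ
  rw [hT, lintegral_image_eq_lintegral_abs_det_fderiv_mul volume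
    (measurableSet_symm_preimage x₀ hA) (fun y hy ↦ (hJ y hy).1.hasFDerivWithinAt) hinj]
  refine setLIntegral_congr_fun (measurableSet_symm_preimage x₀ hA) fun y hy ↦ ?_
  rw [det_gramMatrix_transition x₀ x₁ (h1 hy.2) (hJ y hy).2, Real.sqrt_mul (sq_nonneg _),
    Real.sqrt_sq_eq_abs, ENNReal.ofReal_mul (abs_nonneg _)]

lemma chartVolume_inter_source (x₀ : M) {A : Set M} (hA : MeasurableSet A) :
    chartVolume (n := n) x₀ (A ∩ (chartOf n x₀).source) = chartVolume (n := n) x₀ A := by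
  rw [chartVolume_apply x₀ hA,
    chartVolume_apply x₀ (hA.inter (chartOf n x₀).open_source.measurableSet)]
  congr 2
  ext y
  simp only [mem_inter_iff, mem_preimage, and_congr_right_iff]
  exact fun hy ↦ and_iff_left ((chartOf n x₀).map_target hy)

/-- The Riemannian volume is given by the density `√(det g)` in every chart. -/
theorem riemannianVolume_apply (x₀ : M) {A : Set M} (hA : MeasurableSet A)
    (h0 : A ⊆ (chartOf n x₀).source) :
    riemannianVolume n M A = ∫⁻ y in (chartOf n x₀).target ∩ (chartOf n x₀).symm ⁻¹' A,
        ENNReal.ofReal (√(gramMatrix x₀ y).det) := by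
  rw [← chartVolume_apply x₀ hA]
  refine le_antisymm ?_ (Measure.le_iff'.1 (le_iSup (fun x : M ↦ chartVolume (n := n) x) x₀) A)
  set S := (chartOf n x₀).source with hS
  have hSm : MeasurableSet S := (chartOf n x₀).open_source.measurableSet
  -- this measure is an upper bound of all `chartVolume x₁`
  have h1 : riemannianVolume n M ≤
      chartVolume (n := n) x₀ + (riemannianVolume n M).restrict Sᶜ := by
    refine iSup_le fun x₁ ↦ Measure.le_iff.2 fun B hB ↦ ?_
    rw [← measure_inter_add_sdiff B hSm, Measure.add_apply, Measure.restrict_apply hB]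
    refine add_le_add ?_ (Measure.le_iff'.1 (le_iSup (fun x : M ↦ chartVolume (n := n) x) x₁) _)
    rw [← chartVolume_inter_source x₁ (hB.inter hSm), chartVolume_eq_of_subset x₀ x₁
      ((hB.inter hSm).inter (chartOf n x₁).open_source.measurableSet)
      (fun y hy ↦ hy.1.2) (fun y hy ↦ hy.2)]
    exact measure_mono fun y hy ↦ hy.1.1
  refine (Measure.le_iff'.1 h1 A).trans ?_
  rw [Measure.add_apply, Measure.restrict_apply hA]
  have : A ∩ Sᶜ = ∅ := by
    rw [← sdiff_eq, sdiff_eq_empty]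
    exact h0
  simp [this]

variable [IsContMDiffRiemannianBundle (𝓡 n) ∞ (EuclideanSpace ℝ (Fin n))
      (fun x : M ↦ TangentSpace (𝓡 n) x)]

/-- On a compact part of a chart, the density `√(det g)` is bounded above and below. -/
lemma exists_density_bounds (x₀ : M) {K : Set (EuclideanSpace ℝ (Fin n))} (hK : IsCompact K)
    (hKt : K ⊆ (chartOf n x₀).target) :
    ∃ C : ℝ≥0, ∀ y ∈ K, ENNReal.ofReal (√(gramMatrix x₀ y).det) ≤ C ∧
      1 ≤ C * ENNReal.ofReal (√(gramMatrix x₀ y).det) := by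
  have hc : ContinuousOn (fun y ↦ √(gramMatrix x₀ y).det) K :=
    ((continuousOn_det_gramMatrix x₀).mono hKt).sqrt
  have hpos : ∀ y ∈ K, 0 < √(gramMatrix x₀ y).det := fun y hy ↦
    Real.sqrt_pos.2 (det_gramMatrix_pos x₀ (hKt hy))
  obtain ⟨a, ha⟩ := hK.exists_bound_of_continuousOn hc
  obtain ⟨b, hb⟩ := hK.exists_bound_of_continuousOn (hc.inv₀ fun y hy ↦ (hpos y hy).ne')
  refine ⟨Real.toNNReal (max a b), fun y hy ↦ ⟨?_, ?_⟩⟩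
  · refine ENNReal.ofReal_le_ofReal ?_
    exact (le_abs_self _).trans ((ha y hy).trans (le_max_left _ _))
  · have h1 : (√(gramMatrix x₀ y).det)⁻¹ ≤ max a b :=
      (le_abs_self _).trans ((hb y hy).trans (le_max_right _ _))
    have h2 : 0 ≤ max a b := (inv_nonneg.2 (hpos y hy).le).trans h1
    change _ ≤ ENNReal.ofReal (max a b) * _
    rw [← ENNReal.ofReal_mul h2, ← ENNReal.ofReal_one]
    refine ENNReal.ofReal_le_ofReal ?_
    rwa [← div_le_iff₀ (hpos y hy), one_div]

end Measure

end Riemannian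

/-! ### Comparison of the Riemannian volume with the Lebesgue measure of a chart -/

lemma lintegral_prod_le_of_le_map {X Y : Type*} [MeasurableSpace X] [MeasurableSpace Y]
    {μ : Measure X} {ν : Measure Y} [SFinite μ] {f : X → Y} (hf : Measurable f) {C : ℝ≥0}
    (h : ν ≤ C • μ.map f) (m : Measure ℝ) [SFinite m] (k : Y × ℝ → ℝ≥0∞) :
    ∫⁻ z, k z ∂(ν.prod m) ≤ C * ∫⁻ w, k (f w.1, w.2) ∂(μ.prod m) := by
  have h1 : ν.prod m ≤ C • (μ.prod m).map (Prod.map f id) := by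
    refine (Measure.prod_mono h le_rfl).trans (le_of_eq ?_)
    have h2 := Measure.map_prod_map μ m hf measurable_id
    rw [Measure.map_id] at h2
    rw [← h2]
    exact Measure.prod_smul_left _
  refine (lintegral_mono' h1 le_rfl).trans ?_
  rw [lintegral_smul_measure]
  exact mul_le_mul_right (lintegral_map_le k (Prod.map f id)) _

section Riemannian

variable {n : ℕ} {M : Type*} [TopologicalSpace M] [ChartedSpace (EuclideanSpace ℝ (Fin n)) M]
  [MeasurableSpace M] [BorelSpace M]

open Classical in
/-- The chart at `x₀`, extended by `0` to a measurable map. -/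
def chartMap (x₀ : M) : M → EuclideanSpace ℝ (Fin n) :=
  (chartOf n x₀).source.piecewise (chartOf n x₀) fun _ ↦ 0

open Classical in
/-- The inverse of the chart at `x₀`, extended by `x₀` to a measurable map. -/
def chartInv (x₀ : M) : EuclideanSpace ℝ (Fin n) → M :=
  (chartOf n x₀).target.piecewise (chartOf n x₀).symm fun _ ↦ x₀

open Classical in
lemma measurable_chartMap (x₀ : M) : Measurable (chartMap (n := n) x₀) :=
  (chartOf n x₀).continuousOn.measurable_piecewise continuousOn_const
    (chartOf n x₀).open_source.measurableSet

open Classical in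
lemma measurable_chartInv (x₀ : M) : Measurable (chartInv (n := n) x₀) :=
  (chartOf n x₀).continuousOn_symm.measurable_piecewise continuousOn_const
    (chartOf n x₀).open_target.measurableSet

open Classical in
lemma chartMap_of_mem {x₀ x : M} (hx : x ∈ (chartOf n x₀).source) :
    chartMap (n := n) x₀ x = chartOf n x₀ x := piecewise_eq_of_mem _ _ _ hx

open Classical in
lemma chartInv_of_mem {x₀ : M} {y : EuclideanSpace ℝ (Fin n)} (hy : y ∈ (chartOf n x₀).target) :
    chartInv (n := n) x₀ y = (chartOf n x₀).symm y := piecewise_eq_of_mem _ _ _ hy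

/-- The part of the domain of the chart at `x₀` in `G`, in coordinates. -/
abbrev chartDomain (n : ℕ) {M : Type*} [TopologicalSpace M]
    [ChartedSpace (EuclideanSpace ℝ (Fin n)) M] (x₀ : M) (G : Set M) :
    Set (EuclideanSpace ℝ (Fin n)) :=
  (chartOf n x₀).target ∩ (chartOf n x₀).symm ⁻¹' G

lemma isOpen_chartDomain (x₀ : M) {G : Set M} (hG : IsOpen G) : IsOpen (chartDomain n x₀ G) :=
  (chartOf n x₀).isOpen_inter_preimage_symm hG

lemma isCompact_symm_image {x₀ : M} {K : Set (EuclideanSpace ℝ (Fin n))} (hK : IsCompact K)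
    (hKt : K ⊆ (chartOf n x₀).target) : IsCompact ((chartOf n x₀).symm '' K) :=
  hK.image_of_continuousOn ((chartOf n x₀).continuousOn_symm.mono hKt)

lemma symm_image_subset_source {x₀ : M} {K : Set (EuclideanSpace ℝ (Fin n))}
    (hKt : K ⊆ (chartOf n x₀).target) : (chartOf n x₀).symm '' K ⊆ (chartOf n x₀).source := by
  rintro _ ⟨y, hy, rfl⟩
  exact (chartOf n x₀).map_target (hKt hy)

lemma target_inter_preimage_symm_image {x₀ : M} {K : Set (EuclideanSpace ℝ (Fin n))}
    (hKt : K ⊆ (chartOf n x₀).target) :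
    (chartOf n x₀).target ∩ (chartOf n x₀).symm ⁻¹' ((chartOf n x₀).symm '' K) = K := by
  ext y
  constructor
  · rintro ⟨hy, w, hw, hwy⟩
    rwa [← (chartOf n x₀).symm.injOn (hKt hw) hy hwy]
  · exact fun hy ↦ ⟨hKt hy, mem_image_of_mem _ hy⟩

variable [IsManifold (𝓡 n) ∞ M]
  [RiemannianBundle (fun x : M ↦ TangentSpace (𝓡 n) x)]
  [IsContMDiffRiemannianBundle (𝓡 n) ∞ (EuclideanSpace ℝ (Fin n))
      (fun x : M ↦ TangentSpace (𝓡 n) x)]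

lemma riemannianVolume_eq_zero_iff (x₀ : M) {A : Set M} (hA : MeasurableSet A)
    (h0 : A ⊆ (chartOf n x₀).source) :
    riemannianVolume n M A = 0 ↔ volume (chartDomain n x₀ A) = 0 := by
  rw [riemannianVolume_apply x₀ hA h0]
  refine ⟨fun h ↦ ?_, fun h ↦ setLIntegral_measure_zero _ _ h⟩
  have hc : ContinuousOn (fun y ↦ ENNReal.ofReal (√(gramMatrix x₀ y).det))
      (chartOf n x₀).target :=
    ENNReal.continuous_ofReal.comp_continuousOn (continuousOn_det_gramMatrix x₀).sqrt
  have hm : AEMeasurable (fun y ↦ ENNReal.ofReal (√(gramMatrix x₀ y).det))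
      (volume.restrict (chartDomain n x₀ A)) :=
    (hc.aemeasurable (chartOf n x₀).open_target.measurableSet).mono_measure
      (Measure.restrict_mono inter_subset_left le_rfl)
  rw [lintegral_eq_zero_iff' hm] at h
  have h2 := (ae_restrict_iff' (measurableSet_symm_preimage x₀ hA)).1 h
  rw [measure_eq_zero_iff_ae_notMem]
  filter_upwards [h2] with y hy hyA
  have := hy hyA
  simp only [Pi.zero_apply, ENNReal.ofReal_eq_zero] at this
  exact absurd (Real.sqrt_pos.2 (det_gramMatrix_pos x₀ hyA.1)) (not_lt.2 this)

lemma quasiMeasurePreserving_chartInv (x₀ : M) {G : Set M} (hG : MeasurableSet G) :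
    Measure.QuasiMeasurePreserving (chartInv (n := n) x₀) (volume.restrict (chartDomain n x₀ G))
      ((riemannianVolume n M).restrict G) := by
  refine ⟨measurable_chartInv x₀, Measure.AbsolutelyContinuous.mk fun A hA h ↦ ?_⟩
  have hS := (chartOf n x₀).open_source.measurableSet
  rw [Measure.restrict_apply hA] at h
  rw [Measure.map_apply (measurable_chartInv x₀) hA,
    Measure.restrict_apply (measurable_chartInv x₀ hA)]
  have h1 := (riemannianVolume_eq_zero_iff x₀ ((hA.inter hG).inter hS) inter_subset_right).1
    (measure_mono_null inter_subset_left h)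
  refine measure_mono_null (fun y hy ↦ ?_) h1
  have hy1 : chartInv x₀ y ∈ A := hy.1
  rw [chartInv_of_mem hy.2.1] at hy1
  exact ⟨hy.2.1, ⟨hy1, hy.2.2⟩, (chartOf n x₀).map_target hy.2.1⟩

lemma quasiMeasurePreserving_chartMap (x₀ : M) {G : Set M} (hG : MeasurableSet G) :
    Measure.QuasiMeasurePreserving (chartMap (n := n) x₀)
      ((riemannianVolume n M).restrict ((chartOf n x₀).source ∩ G))
      (volume.restrict (chartDomain n x₀ G)) := by
  refine ⟨measurable_chartMap x₀, Measure.AbsolutelyContinuous.mk fun A hA h ↦ ?_⟩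
  have hS := (chartOf n x₀).open_source.measurableSet
  rw [Measure.restrict_apply hA] at h
  rw [Measure.map_apply (measurable_chartMap x₀) hA,
    Measure.restrict_apply (measurable_chartMap x₀ hA)]
  refine (riemannianVolume_eq_zero_iff x₀ ((measurable_chartMap x₀ hA).inter (hS.inter hG))
    (fun x hx ↦ hx.2.1)).2 (measure_mono_null (t := A ∩ chartDomain n x₀ G)
      (fun y hy ↦ ⟨?_, hy.1, hy.2.2.2⟩) h)
  have hy1 : chartMap x₀ ((chartOf n x₀).symm y) ∈ A := hy.2.1
  rwa [chartMap_of_mem hy.2.2.1, (chartOf n x₀).right_inv hy.1] at hy1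

variable [T2Space M]

lemma exists_restrict_image_le (x₀ : M) {K : Set (EuclideanSpace ℝ (Fin n))} (hK : IsCompact K)
    (hKt : K ⊆ (chartOf n x₀).target) :
    ∃ C : ℝ≥0, (riemannianVolume n M).restrict ((chartOf n x₀).symm '' K) ≤
        C • (volume.restrict K).map (chartInv (n := n) x₀) ∧
      volume.restrict K ≤ C • ((riemannianVolume n M).restrict ((chartOf n x₀).symm '' K)).map
        (chartMap (n := n) x₀) := by
  obtain ⟨C, hC⟩ := exists_density_bounds x₀ hK hKt
  have hKm := (isCompact_symm_image hK hKt).measurableSet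
  refine ⟨C, Measure.le_iff.2 fun A hA ↦ ?_, Measure.le_iff.2 fun A hA ↦ ?_⟩
  · rw [Measure.restrict_apply hA, Measure.smul_apply,
      Measure.map_apply (measurable_chartInv x₀) hA,
      Measure.restrict_apply (measurable_chartInv x₀ hA),
      riemannianVolume_apply x₀ (hA.inter hKm)
        (inter_subset_right.trans (symm_image_subset_source hKt))]
    have hm := measurableSet_symm_preimage (n := n) x₀ (hA.inter hKm)
    have hsub : (chartOf n x₀).target ∩ (chartOf n x₀).symm ⁻¹' (A ∩ (chartOf n x₀).symm '' K) ⊆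
        chartInv x₀ ⁻¹' A ∩ K := by
      rintro y ⟨hy, hyA, hyK⟩
      refine ⟨?_, ?_⟩
      · rwa [mem_preimage, chartInv_of_mem hy]
      · rw [← target_inter_preimage_symm_image hKt]
        exact ⟨hy, hyK⟩
    calc _ ≤ ∫⁻ _ in (chartOf n x₀).target ∩ (chartOf n x₀).symm ⁻¹'
          (A ∩ (chartOf n x₀).symm '' K), (C : ℝ≥0∞) :=
        setLIntegral_mono measurable_const fun y hy ↦ (hC y (hsub hy).2).1
      _ ≤ _ := by
        rw [setLIntegral_const]
        exact mul_le_mul_right (measure_mono hsub) _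
  · have hm := measurable_chartMap (n := n) x₀ hA
    rw [Measure.restrict_apply hA, Measure.smul_apply,
      Measure.map_apply (measurable_chartMap x₀) hA, Measure.restrict_apply hm,
      riemannianVolume_apply x₀ (hm.inter hKm)
        (inter_subset_right.trans (symm_image_subset_source hKt))]
    have hset : (chartOf n x₀).target ∩ (chartOf n x₀).symm ⁻¹'
        (chartMap x₀ ⁻¹' A ∩ (chartOf n x₀).symm '' K) = A ∩ K := by
      ext y
      constructor
      · rintro ⟨hy, hyA, hyK⟩
        have hyK' : y ∈ K := by
          rw [← target_inter_preimage_symm_image hKt]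
          exact ⟨hy, hyK⟩
        rw [mem_preimage, chartMap_of_mem ((chartOf n x₀).map_target hy),
          (chartOf n x₀).right_inv hy] at hyA
        exact ⟨hyA, hyK'⟩
      · rintro ⟨hyA, hyK⟩
        refine ⟨hKt hyK, ?_, mem_image_of_mem _ hyK⟩
        rwa [mem_preimage, chartMap_of_mem ((chartOf n x₀).map_target (hKt hyK)),
          (chartOf n x₀).right_inv (hKt hyK)]
    rw [hset, ENNReal.smul_def, smul_eq_mul,
      ← lintegral_const_mul' _ _ ENNReal.coe_ne_top, ← setLIntegral_one]
    exact setLIntegral_mono' (hA.inter hK.measurableSet) fun y hy ↦ (hC y hy.2).2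

instance isLocallyFiniteMeasure_riemannianVolume :
    IsLocallyFiniteMeasure (riemannianVolume n M) := by
  refine ⟨fun x ↦ ?_⟩
  obtain ⟨K, hK, hxK, hKt⟩ := exists_compact_subset (chartOf n x).open_target
    (mem_chart_target (EuclideanSpace ℝ (Fin n)) x)
  refine ⟨(chartOf n x).symm '' K, ?_, ?_⟩
  · have := (chartOf n x).symm.image_mem_nhds
      (x := chartOf n x x) (mem_chart_target (EuclideanSpace ℝ (Fin n)) x)
      (mem_interior_iff_mem_nhds.1 hxK)
    rwa [(chartOf n x).left_inv (mem_chart_source (EuclideanSpace ℝ (Fin n)) x)] at this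
  · obtain ⟨C, hC, -⟩ := exists_restrict_image_le x hK hKt
    rw [← Measure.restrict_apply_univ]
    refine (Measure.le_iff'.1 hC univ).trans_lt ?_
    rw [Measure.smul_apply, Measure.map_apply (measurable_chartInv x) MeasurableSet.univ,
      preimage_univ, Measure.restrict_apply_univ, ENNReal.smul_def, smul_eq_mul]
    exact ENNReal.mul_lt_top ENNReal.coe_lt_top hK.measure_lt_top

instance isFiniteMeasure_riemannianVolume [CompactSpace M] :
    IsFiniteMeasure (riemannianVolume n M) := inferInstance

variable [CompactSpace M]

/-- Integrals over a compact part of a cylinder over the manifold and over its representation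
in a chart are comparable. -/
lemma exists_lintegral_chart_le (x₀ : M) {K : Set (EuclideanSpace ℝ (Fin n))} (hK : IsCompact K)
    (hKt : K ⊆ (chartOf n x₀).target) :
    ∃ C : ℝ≥0, ∀ {J : Set ℝ}, MeasurableSet J → ∀ h : M × ℝ → ℝ≥0∞,
      (∫⁻ z in ((chartOf n x₀).symm '' K) ×ˢ J, h z ∂((riemannianVolume n M).prod volume) ≤
        C * ∫⁻ w in K ×ˢ J, h ((chartOf n x₀).symm w.1, w.2)) ∧
      ∫⁻ w in K ×ˢ J, h ((chartOf n x₀).symm w.1, w.2) ≤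
        C * ∫⁻ z in ((chartOf n x₀).symm '' K) ×ˢ J, h z
          ∂((riemannianVolume n M).prod volume) := by
  obtain ⟨C, hC, hC'⟩ := exists_restrict_image_le x₀ hK hKt
  refine ⟨C, fun {J} hJ h ↦ ⟨?_, ?_⟩⟩
  · have h1 := lintegral_prod_le_of_le_map (measurable_chartInv x₀) hC (volume.restrict J) h
    rw [Measure.prod_restrict, Measure.prod_restrict] at h1
    refine h1.trans (mul_le_mul_right (le_of_eq ?_) _)
    refine setLIntegral_congr_fun (hK.measurableSet.prod hJ) fun w hw ↦ ?_
    rw [chartInv_of_mem (hKt hw.1)]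
  · have h1 := lintegral_prod_le_of_le_map (measurable_chartMap x₀) hC' (volume.restrict J)
      (fun w ↦ h ((chartOf n x₀).symm w.1, w.2))
    rw [Measure.prod_restrict, Measure.prod_restrict] at h1
    refine h1.trans (mul_le_mul_right (le_of_eq ?_) _)
    refine setLIntegral_congr_fun ((isCompact_symm_image hK hKt).measurableSet.prod hJ)
      fun z hz ↦ ?_
    have hz' := symm_image_subset_source hKt hz.1
    simp only [chartMap_of_mem hz', (chartOf n x₀).left_inv hz']

end Riemannian

/-! ### The norm of a derivative on the cylinder -/

section DerivNorm

variable {n : ℕ} {M : Type*} [TopologicalSpace M] [ChartedSpace (EuclideanSpace ℝ (Fin n)) M]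
  {F : Type*} [NormedAddCommGroup F] [NormedSpace ℝ F]

instance finiteDimensional_tangentSpace (x : M) : FiniteDimensional ℝ (TangentSpace (𝓡 n) x) :=
  inferInstanceAs (FiniteDimensional ℝ (EuclideanSpace ℝ (Fin n)))

section Metric

variable [RiemannianBundle (fun x : M ↦ TangentSpace (𝓡 n) x)] {x : M}

lemma derivNorm_nonneg (A : TangentSpace (𝓡 n) x × ℝ →L[ℝ] F) : 0 ≤ derivNorm A :=
  Real.sqrt_nonneg _

lemma derivNorm_sq (A : TangentSpace (𝓡 n) x × ℝ →L[ℝ] F) :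
    derivNorm A ^ 2 = (∑ k, ‖A (stdOrthonormalBasis ℝ (TangentSpace (𝓡 n) x) k, 0)‖ ^ 2) +
      ‖A (0, 1)‖ ^ 2 :=
  Real.sq_sqrt (by positivity)

lemma norm_apply_vertical_le_derivNorm (A : TangentSpace (𝓡 n) x × ℝ →L[ℝ] F) :
    ‖A (0, 1)‖ ≤ derivNorm A := by
  refine (sq_le_sq₀ (norm_nonneg _) (derivNorm_nonneg A)).1 ?_
  rw [derivNorm_sq]
  exact le_add_of_nonneg_left (Finset.sum_nonneg fun _ _ ↦ sq_nonneg _)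

lemma norm_apply_horizontal_le (A : TangentSpace (𝓡 n) x × ℝ →L[ℝ] F)
    (v : TangentSpace (𝓡 n) x) : ‖A (v, 0)‖ ≤ derivNorm A * ‖v‖ := by
  set b := stdOrthonormalBasis ℝ (TangentSpace (𝓡 n) x) with hb
  have h1 : A (v, 0) = ∑ k, inner ℝ (b k) v • A (b k, 0) := by
    have h2 : A.comp (ContinuousLinearMap.inl ℝ (TangentSpace (𝓡 n) x) ℝ) v =
        A.comp (ContinuousLinearMap.inl ℝ (TangentSpace (𝓡 n) x) ℝ)
          (∑ k, inner ℝ (b k) v • b k) := by rw [b.sum_repr' v]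
    rw [map_sum] at h2
    simp only [map_smul] at h2
    exact h2
  have h3 : ∑ k, (inner ℝ (b k) v) ^ 2 = ‖v‖ ^ 2 := by
    rw [← b.sum_sq_norm_inner_right v]
    simp
  rw [h1]
  refine (norm_sum_le _ _).trans ?_
  simp only [norm_smul]
  refine (sq_le_sq₀ (by positivity) (mul_nonneg (derivNorm_nonneg A) (norm_nonneg v))).1
    ((Finset.sum_mul_sq_le_sq_mul_sq _ _ _).trans ?_)
  simp only [Real.norm_eq_abs, sq_abs, h3]
  rw [mul_pow, mul_comm, derivNorm_sq]
  exact mul_le_mul_of_nonneg_right (le_add_of_nonneg_right (sq_nonneg _)) (sq_nonneg _)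

lemma norm_apply_le_derivNorm (A : TangentSpace (𝓡 n) x × ℝ →L[ℝ] F)
    (v : TangentSpace (𝓡 n) x) (τ : ℝ) : ‖A (v, τ)‖ ≤ derivNorm A * (‖v‖ + |τ|) := by
  have h1 : A (v, τ) = A (v, 0) + τ • A (0, 1) := by
    rw [← map_smul, ← map_add]
    simp
  rw [h1, mul_add]
  refine (norm_add_le _ _).trans (add_le_add (norm_apply_horizontal_le A v) ?_)
  rw [norm_smul, Real.norm_eq_abs, mul_comm]
  exact mul_le_mul_of_nonneg_right (norm_apply_vertical_le_derivNorm A) (abs_nonneg τ)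

/-- Composition with the derivative of a fibrewise shear of bounded slope increases the norm of a
derivative at most by a constant factor. -/
lemma derivNorm_comp_shearDeriv_le (A : TangentSpace (𝓡 n) x × ℝ →L[ℝ] F) {σ : ℝ}
    (hσ : |σ| = 1) (c : TangentSpace (𝓡 n) x →L[ℝ] ℝ) {B : ℝ} (hB : 0 ≤ B)
    (hc : ∀ v, |c v| ≤ B * ‖v‖) :
    derivNorm (A.comp (shearDeriv σ c)) ≤ (n + 1) * (1 + B) * derivNorm A := by
  have hA := derivNorm_nonneg A
  have hn : (0 : ℝ) ≤ n := n.cast_nonneg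
  refine (sq_le_sq₀ (derivNorm_nonneg _) (by positivity)).1 ?_
  rw [derivNorm_sq]
  have h1 : ∀ k, ‖A.comp (shearDeriv σ c)
      (stdOrthonormalBasis ℝ (TangentSpace (𝓡 n) x) k, 0)‖ ^ 2 ≤
        ((1 + B) * derivNorm A) ^ 2 := by
    intro k
    refine pow_le_pow_left₀ (norm_nonneg _) ?_ 2
    rw [ContinuousLinearMap.comp_apply, shearDeriv_apply]
    refine (norm_apply_le_derivNorm A _ _).trans ?_
    have h2 := hc (stdOrthonormalBasis ℝ (TangentSpace (𝓡 n) x) k)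
    rw [OrthonormalBasis.norm_eq_one, mul_one] at h2
    rw [OrthonormalBasis.norm_eq_one, mul_comm]
    refine mul_le_mul_of_nonneg_right ?_ hA
    simpa using h2
  have h3 : ‖A.comp (shearDeriv σ c) (0, 1)‖ ^ 2 ≤ ((1 + B) * derivNorm A) ^ 2 := by
    refine pow_le_pow_left₀ (norm_nonneg _) ?_ 2
    rw [ContinuousLinearMap.comp_apply, shearDeriv_apply]
    refine (norm_apply_le_derivNorm A _ _).trans ?_
    have h4 : ‖(0 : TangentSpace (𝓡 n) x)‖ = 0 := norm_zero
    simp only [mul_one, map_zero, add_zero, hσ, h4, zero_add]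
    nlinarith
  refine (add_le_add (Finset.sum_le_sum fun k _ ↦ h1 k) h3).trans ?_
  rw [Finset.sum_const, Finset.card_univ, Fintype.card_fin]
  have h5 : Module.finrank ℝ (TangentSpace (𝓡 n) x) = n := finrank_euclideanSpace_fin
  rw [h5, nsmul_eq_mul]
  have h6 : (0 : ℝ) ≤ ((1 + B) * derivNorm A) ^ 2 := sq_nonneg _
  nlinarith [mul_nonneg hn h6, mul_nonneg (mul_nonneg hn hn) h6]

end Metric

section Chart

variable [IsManifold (𝓡 n) ∞ M]

lemma contDiffOn_comp_symm {ψ : M → ℝ} (hψ : ContMDiff (𝓡 n) 𝓘(ℝ) ∞ ψ) (x₀ : M) :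
    ContDiffOn ℝ ∞ (fun y ↦ ψ ((chartOf n x₀).symm y)) (chartOf n x₀).target :=
  (hψ.comp_contMDiffOn contMDiffOn_chart_symm).contDiffOn

/-- The derivative of a real function on the manifold, as a linear form. -/
def realDeriv (ψ : M → ℝ) (x : M) : TangentSpace (𝓡 n) x →L[ℝ] ℝ :=
  mfderiv (𝓡 n) 𝓘(ℝ) ψ x

lemma fderiv_comp_symm {ψ : M → ℝ} (hψ : ContMDiff (𝓡 n) 𝓘(ℝ) ∞ ψ) (x₀ : M)
    {y : EuclideanSpace ℝ (Fin n)} (hy : y ∈ (chartOf n x₀).target) (v : EuclideanSpace ℝ (Fin n)) :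
    fderiv ℝ (fun y ↦ ψ ((chartOf n x₀).symm y)) y v =
      realDeriv ψ ((chartOf n x₀).symm y)
        (mfderiv (𝓡 n) (𝓡 n) (chartOf n x₀).symm y v) := by
  have h0 := ((mdifferentiable_chartOf x₀).mdifferentiableAt_symm hy).hasMFDerivAt
  have h1 := ((hψ.mdifferentiable (by simp)) ((chartOf n x₀).symm y)).hasMFDerivAt
  have h2 := h1.comp y h0
  obtain ⟨A, hA, hA'⟩ : ∃ A : EuclideanSpace ℝ (Fin n) →L[ℝ] ℝ,
      HasFDerivAt (fun y ↦ ψ ((chartOf n x₀).symm y)) A y ∧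
      ∀ v, A v = realDeriv ψ ((chartOf n x₀).symm y)
        (mfderiv (𝓡 n) (𝓡 n) (chartOf n x₀).symm y v) := ⟨_, h2.hasFDerivAt, fun _ ↦ rfl⟩
  rw [hA.fderiv, hA']

variable [RiemannianBundle (fun x : M ↦ TangentSpace (𝓡 n) x)]
  [IsContMDiffRiemannianBundle (𝓡 n) ∞ (EuclideanSpace ℝ (Fin n))
      (fun x : M ↦ TangentSpace (𝓡 n) x)]

lemma exists_norm_chartDeriv_le (x₀ : M) {K : Set (EuclideanSpace ℝ (Fin n))} (hK : IsCompact K)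
    (hKt : K ⊆ (chartOf n x₀).target) :
    ∃ C : ℝ, 0 ≤ C ∧ ∀ y ∈ K, ∀ w : EuclideanSpace ℝ (Fin n),
      ‖(mfderiv (𝓡 n) (𝓡 n) (chartOf n x₀).symm y w :
        TangentSpace (𝓡 n) ((chartOf n x₀).symm y))‖ ≤ C * ‖w‖ := by
  have h1 : ∀ k l : Fin n, ∃ C, ∀ y ∈ K, ‖metricForm ((chartOf n x₀).symm y)
      (chartDeriv x₀ y (EuclideanSpace.single k 1))
      (chartDeriv x₀ y (EuclideanSpace.single l 1))‖ ≤ C := fun k l ↦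
    hK.exists_bound_of_continuousOn ((continuousOn_metricForm_chartDeriv x₀ _ _).mono hKt)
  choose C hC using h1
  refine ⟨√(∑ k, ∑ l, |C k l|), Real.sqrt_nonneg _, fun y hy w ↦ ?_⟩
  have hw : chartDeriv x₀ y w = ∑ k, w k • chartDeriv x₀ y (EuclideanSpace.single k 1) := by
    have h2 : w = ∑ k, w k • EuclideanSpace.single k (1 : ℝ) := by
      have := (EuclideanSpace.basisFun (Fin n) ℝ).toBasis.sum_repr w
      simpa using this.symm
    conv_lhs => rw [h2]
    rw [map_sum]
    simp only [map_smul]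
  have h3 : ‖(mfderiv (𝓡 n) (𝓡 n) (chartOf n x₀).symm y w :
      TangentSpace (𝓡 n) ((chartOf n x₀).symm y))‖ ^ 2 =
      metricForm ((chartOf n x₀).symm y) (chartDeriv x₀ y w) (chartDeriv x₀ y w) :=
    (real_inner_self_eq_norm_sq _).symm
  refine (sq_le_sq₀ (norm_nonneg _) (by positivity)).1 ?_
  rw [h3, hw, metricForm_sum_smul, mul_pow, Real.sq_sqrt (by positivity), Finset.sum_mul]
  refine Finset.sum_le_sum fun k _ ↦ ?_
  rw [Finset.sum_mul]
  refine Finset.sum_le_sum fun l _ ↦ ?_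
  have hk := PiLp.norm_apply_le w k
  have hl := PiLp.norm_apply_le w l
  refine (le_abs_self _).trans ?_
  rw [abs_mul, abs_mul, mul_comm, sq]
  exact mul_le_mul ((hC k l y hy).trans (le_abs_self _))
    (mul_le_mul hk hl (abs_nonneg _) (norm_nonneg _)) (by positivity) (abs_nonneg _)

lemma exists_norm_comp_chartDeriv_le (x₀ : M) {K : Set (EuclideanSpace ℝ (Fin n))}
    (hK : IsCompact K) (hKt : K ⊆ (chartOf n x₀).target) :
    ∃ C : ℝ, 0 ≤ C ∧ ∀ y ∈ K, ∀ A : TangentSpace (𝓡 n) ((chartOf n x₀).symm y) × ℝ →L[ℝ] F,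
      ‖(A.comp ((mfderiv (𝓡 n) (𝓡 n) (chartOf n x₀).symm y).prodMap
        (ContinuousLinearMap.id ℝ ℝ)) : EuclideanSpace ℝ (Fin n) × ℝ →L[ℝ] F)‖ ≤
        C * derivNorm A := by
  obtain ⟨C, hC0, hC⟩ := exists_norm_chartDeriv_le x₀ hK hKt
  refine ⟨C + 1, by positivity, fun y hy A ↦ ?_⟩
  have hA := derivNorm_nonneg A
  refine ContinuousLinearMap.opNorm_le_bound _ (by positivity) fun w ↦ ?_
  refine (norm_apply_le_derivNorm A (mfderiv (𝓡 n) (𝓡 n) (chartOf n x₀).symm y w.1) w.2).trans ?_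
  have h1 := hC y hy w.1
  have h2 : ‖w.1‖ ≤ ‖w‖ := norm_fst_le w
  have h3 : |w.2| ≤ ‖w‖ := norm_snd_le w
  rw [mul_comm (C + 1), mul_assoc]
  refine mul_le_mul_of_nonneg_left ?_ hA
  nlinarith [mul_le_mul_of_nonneg_left h2 hC0]

/-- The derivative of a smooth function on a compact Riemannian manifold is bounded. -/
lemma exists_mfderiv_bound [CompactSpace M] {ψ : M → ℝ} (hψ : ContMDiff (𝓡 n) 𝓘(ℝ) ∞ ψ) :
    ∃ B : ℝ, 0 ≤ B ∧ ∀ x, ∀ v : TangentSpace (𝓡 n) x,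
      |realDeriv ψ x v| ≤ B * ‖v‖ := by
  have := isContinuousRiemannianBundle_tangentSpace (n := n) (M := M)
  -- near `x`, the derivative is the composition of two factors that are bounded there: the
  -- derivatives of the chart at `x` and of the representative of `ψ` in it
  have hloc : ∀ x : M, ∃ B : ℝ, 0 ≤ B ∧ ∀ᶠ q in 𝓝 x, ∀ v : TangentSpace (𝓡 n) q,
      |realDeriv ψ q v| ≤ B * ‖v‖ := by
    intro x
    obtain ⟨C, hC0, hC⟩ := eventually_norm_trivializationAt_lt (EuclideanSpace ℝ (Fin n))
      (fun x : M ↦ TangentSpace (𝓡 n) x) x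
    have hcont : ContinuousAt (fun q ↦
        ‖fderiv ℝ (fun y ↦ ψ ((chartOf n x).symm y)) (chartOf n x q)‖) x := by
      have h1 := (contDiffOn_comp_symm hψ x).continuousOn_fderiv_of_isOpen
        (chartOf n x).open_target (by simp)
      have h2 := h1.continuousAt ((chartOf n x).open_target.mem_nhds
        (mem_chart_target (EuclideanSpace ℝ (Fin n)) x))
      exact (ContinuousAt.comp (f := chartOf n x) h2 ((chartOf n x).continuousAt
        (mem_chart_source (EuclideanSpace ℝ (Fin n)) x))).norm
    set D := ‖fderiv ℝ (fun y ↦ ψ ((chartOf n x).symm y)) (chartOf n x x)‖ + 1 with hD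
    have hD0 : 0 ≤ D := by positivity
    refine ⟨D * C, by positivity, ?_⟩
    filter_upwards [hC, hcont.eventually_lt_const (lt_add_one _),
      (chartOf n x).open_source.mem_nhds (mem_chart_source (EuclideanSpace ℝ (Fin n)) x)]
      with q hq hq' hqs v
    have hM : IsManifold (𝓡 n) 1 M := IsManifold.of_le (n := ∞) (by simp)
    have h3 : realDeriv ψ q v =
        fderiv ℝ (fun y ↦ ψ ((chartOf n x).symm y)) (chartOf n x q)
          (mfderiv (𝓡 n) (𝓡 n) (chartOf n x) q v) := by
      have h4 := (contDiffOn_comp_symm hψ x).differentiableOn (by simp) _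
        ((chartOf n x).map_source hqs)
      have h5 := (h4.differentiableAt ((chartOf n x).open_target.mem_nhds
        ((chartOf n x).map_source hqs))).hasFDerivAt.hasMFDerivAt
      have h6 := ((mdifferentiable_chartOf x).mdifferentiableAt hqs).hasMFDerivAt
      have h7 := (h5.comp q h6).congr_of_eventuallyEq (f₁ := ψ) (by
        filter_upwards [(chartOf n x).open_source.mem_nhds hqs] with a ha
        simp only [Function.comp_apply, (chartOf n x).left_inv ha])
      unfold realDeriv
      rw [h7.mfderiv]
      rfl
    have h8 : ‖(show EuclideanSpace ℝ (Fin n) from mfderiv (𝓡 n) (𝓡 n) (chartOf n x) q v)‖ ≤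
        C * ‖v‖ := by
      have h9 := TangentBundle.continuousLinearMapAt_trivializationAt (I := 𝓡 n) hqs
      have h10 := (hasMFDerivAt_extChartAt (I := 𝓡 n) hqs).mfderiv
      rw [h10] at h9
      have h11 := (((trivializationAt (EuclideanSpace ℝ (Fin n))
        (fun x : M ↦ TangentSpace (𝓡 n) x) x).continuousLinearMapAt ℝ q).le_of_opNorm_le hq.le v)
      rw [h9] at h11
      exact h11
    rw [h3]
    refine (ContinuousLinearMap.le_of_opNorm_le _ hq'.le _).trans ?_
    rw [mul_assoc]
    exact mul_le_mul_of_nonneg_left h8 hD0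
  choose B hB0 hB using hloc
  obtain ⟨t, -, ht⟩ := isCompact_univ.elim_nhds_subcover
    (fun x ↦ {q | ∀ v : TangentSpace (𝓡 n) q, |realDeriv ψ q v| ≤ B x * ‖v‖})
    (fun x _ ↦ hB x)
  refine ⟨∑ x ∈ t, B x, Finset.sum_nonneg fun x _ ↦ hB0 x, fun q v ↦ ?_⟩
  obtain ⟨x, hx, hq⟩ := mem_iUnion₂.1 (ht (mem_univ q))
  exact (hq v).trans (mul_le_mul_of_nonneg_right
    (Finset.single_le_sum (fun x _ ↦ hB0 x) hx) (norm_nonneg v))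

end Chart

end DerivNorm

/-! ### Traces on the manifold -/

section

variable {n : ℕ} {M : Type*} [TopologicalSpace M] [ChartedSpace (EuclideanSpace ℝ (Fin n)) M]
  [MeasurableSpace M] [BorelSpace M] [IsManifold (𝓡 n) ∞ M]
  [RiemannianBundle (fun x : M ↦ TangentSpace (𝓡 n) x)]
  {F : Type*} [NormedAddCommGroup F] [NormedSpace ℝ F]

lemma HasTrace.mono {G G' : Set M} {U : M × ℝ → F} {u : M → F} (h : HasTrace n G U u)
    (hG : G' ⊆ G) : HasTrace n G' U u :=
  ⟨h.1.mono_measure (Measure.restrict_mono hG le_rfl),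
    fun K hK hKc ↦ h.2 K (hK.trans hG) hKc⟩

/-- Being a trace is a local property. -/
lemma hasTrace_iUnion [T2Space M] {ι : Type*} [Finite ι] {G : ι → Set M}
    (hG : ∀ i, IsOpen (G i)) {U : M × ℝ → F} {u : M → F} (h : ∀ i, HasTrace n (G i) U u) :
    HasTrace n (⋃ i, G i) U u := by
  have := Fintype.ofFinite ι
  refine ⟨aestronglyMeasurable_iUnion_iff.2 fun i ↦ (h i).1, fun K hK hKc ↦ ?_⟩
  obtain ⟨K', hK'c, hK', hKK'⟩ := hKc.finite_compact_cover Finset.univ G (fun i _ ↦ hG i)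
    (by simpa using hK)
  have hsum := tendsto_finsetSum Finset.univ fun i _ ↦ (h i).2 (K' i) (hK' i) (hK'c i)
  simp only [Finset.sum_const_zero] at hsum
  refine tendsto_of_tendsto_of_tendsto_of_le_of_le tendsto_const_nhds hsum
    (fun _ ↦ zero_le) fun ε ↦ ?_
  simp only [← Finset.mul_sum]
  refine mul_le_mul_right ?_ _
  have h1 : K ×ˢ Ioo 0 ε = ⋃ i, K' i ×ˢ Ioo 0 ε := by
    rw [hKK']
    simp [iUnion_prod_const]
  rw [h1]
  refine (lintegral_iUnion_le _ _).trans ?_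
  rw [tsum_fintype]

variable [T2Space M] [CompactSpace M]
  [IsContMDiffRiemannianBundle (𝓡 n) ∞ (EuclideanSpace ℝ (Fin n))
      (fun x : M ↦ TangentSpace (𝓡 n) x)]

lemma HasTrace.hasBottomTrace {G : Set M} (hG : IsOpen G) {U : M × ℝ → F} {u : M → F}
    (h : HasTrace n G U u) (x₀ : M) :
    HasBottomTrace (chartDomain n x₀ G) (fun w ↦ U ((chartOf n x₀).symm w.1, w.2))
      (fun y ↦ u ((chartOf n x₀).symm y)) := by
  refine ⟨?_, fun K hK hKc ↦ ?_⟩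
  · refine (h.1.comp_quasiMeasurePreserving
      (quasiMeasurePreserving_chartInv x₀ hG.measurableSet)).congr ?_
    filter_upwards [ae_restrict_mem (isOpen_chartDomain x₀ hG).measurableSet] with y hy
    rw [Function.comp_apply, chartInv_of_mem hy.1]
  · have hKt : K ⊆ (chartOf n x₀).target := hK.trans inter_subset_left
    obtain ⟨C, hC⟩ := exists_lintegral_chart_le x₀ hKc hKt
    have hKG : (chartOf n x₀).symm '' K ⊆ G := by
      rintro _ ⟨y, hy, rfl⟩
      exact (hK hy).2
    have h1 := ENNReal.Tendsto.const_mul (a := (C : ℝ≥0∞))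
      (h.2 _ hKG (isCompact_symm_image hKc hKt)) (Or.inr ENNReal.coe_ne_top)
    rw [mul_zero] at h1
    refine tendsto_of_tendsto_of_tendsto_of_le_of_le tendsto_const_nhds h1
      (fun _ ↦ zero_le) fun ε ↦ ?_
    simp only
    rw [mul_left_comm]
    exact mul_le_mul_right (hC measurableSet_Ioo fun z ↦ ‖U z - u z.1‖ₑ).2 _

/-- A function which is the trace in every chart is the trace. -/
lemma hasTrace_of_hasBottomTrace {G : Set M} (hG : IsOpen G) {U : M × ℝ → F} {u : M → F}
    (h : ∀ x₀, HasBottomTrace (chartDomain n x₀ G) (fun w ↦ U ((chartOf n x₀).symm w.1, w.2))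
      (fun y ↦ u ((chartOf n x₀).symm y))) : HasTrace n G U u := by
  have hloc : ∀ x₀ : M, HasTrace n ((chartOf n x₀).source ∩ G) U u := by
    intro x₀
    have hopen := (chartOf n x₀).open_source.inter hG
    refine ⟨?_, fun K hK hKc ↦ ?_⟩
    · refine ((h x₀).1.comp_quasiMeasurePreserving
        (quasiMeasurePreserving_chartMap x₀ hG.measurableSet)).congr ?_
      filter_upwards [ae_restrict_mem hopen.measurableSet] with x hx
      rw [Function.comp_apply, chartMap_of_mem hx.1, (chartOf n x₀).left_inv hx.1]
    · have hKs : K ⊆ (chartOf n x₀).source := hK.trans inter_subset_left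
      have hK'c : IsCompact (chartOf n x₀ '' K) :=
        hKc.image_of_continuousOn ((chartOf n x₀).continuousOn.mono hKs)
      have himg : (chartOf n x₀).symm '' (chartOf n x₀ '' K) = K := by
        rw [image_image]
        exact (image_congr fun x hx ↦ (chartOf n x₀).left_inv (hKs hx)).trans (image_id' K)
      have hK't : chartOf n x₀ '' K ⊆ chartDomain n x₀ G := by
        rintro _ ⟨x, hx, rfl⟩
        refine ⟨(chartOf n x₀).map_source (hKs hx), ?_⟩
        rw [mem_preimage, (chartOf n x₀).left_inv (hKs hx)]
        exact (hK hx).2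
      obtain ⟨C, hC⟩ := exists_lintegral_chart_le x₀ hK'c (hK't.trans inter_subset_left)
      have h1 := ENNReal.Tendsto.const_mul (a := (C : ℝ≥0∞))
        ((h x₀).2 _ hK't hK'c) (Or.inr ENNReal.coe_ne_top)
      rw [mul_zero] at h1
      refine tendsto_of_tendsto_of_tendsto_of_le_of_le tendsto_const_nhds h1
        (fun _ ↦ zero_le) fun ε ↦ ?_
      simp only
      rw [mul_left_comm]
      have h2 := (hC (measurableSet_Ioo (a := 0) (b := ε)) fun z ↦ ‖U z - u z.1‖ₑ).1
      rw [himg] at h2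
      exact mul_le_mul_right h2 _
  obtain ⟨t, ht⟩ := isCompact_univ.elim_finite_subcover (fun x₀ : M ↦ (chartOf n x₀).source)
    (fun x₀ ↦ (chartOf n x₀).open_source)
    (fun x _ ↦ mem_iUnion.2 ⟨x, mem_chart_source (EuclideanSpace ℝ (Fin n)) x⟩)
  have h2 := hasTrace_iUnion (ι := t) (G := fun x₀ ↦ (chartOf n (x₀ : M)).source ∩ G)
    (fun x₀ ↦ (chartOf n (x₀ : M)).open_source.inter hG) (fun x₀ ↦ hloc x₀)
  refine h2.mono fun x hx ↦ ?_
  obtain ⟨x₀, hx₀, hx'⟩ := mem_iUnion₂.1 (ht (mem_univ x))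
  exact mem_iUnion.2 ⟨⟨x₀, hx₀⟩, hx', hx⟩

/-- As the volume is finite, a derivative of finite energy is integrable: `a ≤ 1 + a ^ p`. -/
lemma lintegral_derivNorm_lt_top {p : ℝ} (hp : 1 ≤ p) {G : Set M}
    {DU : ∀ z : M × ℝ, TangentSpace (𝓡 n) z.1 × ℝ →L[ℝ] F} (h : energy p G DU < ⊤) :
    ∫⁻ z in G ×ˢ Ioo (0 : ℝ) 1, ENNReal.ofReal (derivNorm (DU z))
      ∂((riemannianVolume n M).prod volume) < ⊤ := by
  have h1 : ∀ a : ℝ, 0 ≤ a → a ≤ 1 + a ^ p := by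
    intro a ha
    rcases le_total a 1 with h1 | h1
    · exact h1.trans (le_add_of_nonneg_right (Real.rpow_nonneg ha p))
    · exact (Real.self_le_rpow_of_one_le h1 hp).trans (le_add_of_nonneg_left zero_le_one)
  refine lt_of_le_of_lt (lintegral_mono (g := fun z ↦ 1 + ENNReal.ofReal (derivNorm (DU z) ^ p))
    fun z ↦ ?_) ?_
  · simp only
    rw [← ENNReal.ofReal_one, ← ENNReal.ofReal_add zero_le_one
      (Real.rpow_nonneg (derivNorm_nonneg _) p)]
    exact ENNReal.ofReal_le_ofReal (h1 _ (derivNorm_nonneg _))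
  · rw [lintegral_add_left measurable_const, setLIntegral_one, Measure.prod_prod]
    refine ENNReal.add_lt_top.2 ⟨ENNReal.mul_lt_top (measure_lt_top _ _) ?_, h⟩
    simp

/-- The representative of `DU` in a chart is integrable up to the bottom of the cylinder. -/
lemma HasSobolevDeriv.integrableOn_chart {p : ℝ} (hp : 1 ≤ p) {G : Set M} {U : M × ℝ → F}
    {DU : ∀ z : M × ℝ, TangentSpace (𝓡 n) z.1 × ℝ →L[ℝ] F} (h : HasSobolevDeriv p G U DU)
    (x₀ : M) {K : Set (EuclideanSpace ℝ (Fin n))} (hKc : IsCompact K)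
    (hK : K ⊆ chartDomain n x₀ G) :
    IntegrableOn (fun z : EuclideanSpace ℝ (Fin n) × ℝ ↦
      ((DU ((chartOf n x₀).symm z.1, z.2)).comp
      ((mfderiv (𝓡 n) (𝓡 n) (chartOf n x₀).symm z.1).prodMap (ContinuousLinearMap.id ℝ ℝ)) :
        EuclideanSpace ℝ (Fin n) × ℝ →L[ℝ] F)) (K ×ˢ Ioo 0 1) := by
  have hKt : K ⊆ (chartOf n x₀).target := hK.trans inter_subset_left
  refine ⟨(h.1 x₀).2.aestronglyMeasurable.mono_measure
    (Measure.restrict_mono (prod_mono hK le_rfl) le_rfl), ?_⟩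
  obtain ⟨C, hC⟩ := exists_lintegral_chart_le x₀ hKc hKt
  obtain ⟨D, hD0, hD⟩ := exists_norm_comp_chartDeriv_le (F := F) x₀ hKc hKt
  have hKG : (chartOf n x₀).symm '' K ⊆ G := by
    rintro _ ⟨y, hy, rfl⟩
    exact (hK hy).2
  have h1 : ∀ z ∈ K ×ˢ Ioo (0 : ℝ) 1, ‖((DU ((chartOf n x₀).symm z.1, z.2)).comp
      ((mfderiv (𝓡 n) (𝓡 n) (chartOf n x₀).symm z.1).prodMap (ContinuousLinearMap.id ℝ ℝ)) :
        EuclideanSpace ℝ (Fin n) × ℝ →L[ℝ] F)‖ₑ ≤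
      ENNReal.ofReal D * ENNReal.ofReal (derivNorm (DU ((chartOf n x₀).symm z.1, z.2))) := by
    intro z hz
    rw [← ENNReal.ofReal_mul hD0, ← ofReal_norm]
    exact ENNReal.ofReal_le_ofReal (hD z.1 hz.1 _)
  refine lt_of_le_of_lt (setLIntegral_mono' (hKc.measurableSet.prod measurableSet_Ioo) h1) ?_
  rw [lintegral_const_mul' _ _ ENNReal.ofReal_ne_top]
  refine ENNReal.mul_lt_top ENNReal.ofReal_lt_top (lt_of_le_of_lt
    (hC measurableSet_Ioo fun z ↦ ENNReal.ofReal (derivNorm (DU z))).2 ?_)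
  refine ENNReal.mul_lt_top ENNReal.coe_lt_top (lt_of_le_of_lt ?_
    (lintegral_derivNorm_lt_top hp h.2))
  exact lintegral_mono_set (prod_mono hKG le_rfl)

lemma locallyIntegrableOn_prod_Ico {E G : Type*} [NormedAddCommGroup E] [NormedSpace ℝ E]
    [FiniteDimensional ℝ E] [MeasureSpace E] [BorelSpace E] [(volume : Measure E).IsAddHaarMeasure]
    [NormedAddCommGroup G] {Ω : Set E} (hΩ : IsOpen Ω) {f : E × ℝ → G}
    (h : ∀ K ⊆ Ω, IsCompact K → IntegrableOn f (K ×ˢ Ioo 0 1)) :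
    LocallyIntegrableOn f (Ω ×ˢ Ico 0 1) := by
  rintro ⟨y, t⟩ ⟨hy, ht⟩
  obtain ⟨K, hK, hyK, hKΩ⟩ := exists_compact_subset hΩ hy
  have h1 : IntegrableOn f (K ×ˢ Ico 0 1) := by
    have h2 := h K hKΩ hK
    rw [IntegrableOn, Measure.volume_eq_prod, ← Measure.prod_restrict] at h2 ⊢
    rwa [Measure.restrict_congr_set Ioo_ae_eq_Ico] at h2
  refine ⟨K ×ˢ Ico 0 1, ?_, h1⟩
  have h4 : K ×ˢ univ ∈ 𝓝 (y, t) := prod_mem_nhds (mem_interior_iff_mem_nhds.1 hyK) univ_mem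
  filter_upwards [mem_nhdsWithin_of_mem_nhds h4, self_mem_nhdsWithin] with z hz hz2
  exact ⟨hz.1, hz2.2⟩

/-- Every Sobolev map on a cylinder has a trace on the bottom. -/
theorem HasSobolevDeriv.exists_hasTrace [CompleteSpace F] {p : ℝ} (hp : 1 ≤ p) {G : Set M}
    (hG : IsOpen G) {U : M × ℝ → F}
    {DU : ∀ z : M × ℝ, TangentSpace (𝓡 n) z.1 × ℝ →L[ℝ] F} (h : HasSobolevDeriv p G U DU) :
    ∃ u : M → F, HasTrace n G U u := by
  refine ⟨fun x ↦ bottomValue (fun t ↦ U (x, t)) (fun t ↦ DU (x, t) (0, 1)),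
    hasTrace_of_hasBottomTrace hG fun x₀ ↦ ?_⟩
  have h1 := (h.1 x₀).hasBottomTrace (isOpen_chartDomain x₀ hG) fun K hK hKc ↦
    ContinuousLinearMap.integrable_comp
      (ContinuousLinearMap.apply ℝ F ((0 : EuclideanSpace ℝ (Fin n)), (1 : ℝ)))
      (h.integrableOn_chart hp x₀ hKc hK)
  have hz : ∀ y, mfderiv (𝓡 n) (𝓡 n) (chartOf n x₀).symm y (0 : EuclideanSpace ℝ (Fin n)) =
      (0 : TangentSpace (𝓡 n) ((chartOf n x₀).symm y)) := fun y ↦ map_zero (chartDeriv x₀ y)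
  have h2 : (fun y ↦ bottomValue (fun t ↦ U ((chartOf n x₀).symm y, t))
      (fun t ↦ DU ((chartOf n x₀).symm y, t) (0, 1))) =
      fun y ↦ bottomValue (fun t ↦ U ((chartOf n x₀).symm y, t))
        (fun t ↦ DU ((chartOf n x₀).symm y, t)
          (mfderiv (𝓡 n) (𝓡 n) (chartOf n x₀).symm y (0 : EuclideanSpace ℝ (Fin n)), 1)) := by
    funext y
    exact congrArg (bottomValue _) (funext fun t ↦
      congrArg (fun v ↦ DU ((chartOf n x₀).symm y, t) (v, 1)) (hz y).symm)
  rw [h2]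
  exact h1

end

/-! ### The folded gluing of two Sobolev maps on the manifold -/

/-- Integrals of the folded gluing, piece by piece: on every fibre, the gluing runs through parts
of `g` at most twice, and through a part of `f` at most once. -/
lemma lintegral_fold_le {X : Type*} [MeasurableSpace X] (μ : Measure X) [SFinite μ] {r : X → ℝ}
    (hr : Measurable r) (hr0 : ∀ x, 0 ≤ r x) {S SO SG : Set X} (hS : MeasurableSet S) {ε : ℝ}
    (hO : ∀ x ∈ S, r x < ε → x ∈ SO) (hG : ∀ x ∈ S, 0 < r x → x ∈ SG)
    {H hf hg : X × ℝ → ℝ≥0∞} {c : ℝ≥0}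
    (hlow : ∀ x ∈ S, ∀ t ∈ Ioo 0 ε, t < r x / 2 → H (x, t) ≤ c * hg (x, t))
    (hmid : ∀ x ∈ S, ∀ t ∈ Ioo 0 ε, r x / 2 ≤ t → t < r x → H (x, t) ≤ c * hg (x, r x - t))
    (hhigh : ∀ x ∈ S, ∀ t ∈ Ioo 0 ε, r x / 2 ≤ t → r x ≤ t → H (x, t) ≤ c * hf (x, t - r x)) :
    ∫⁻ z in S ×ˢ Ioo 0 ε, H z ∂(μ.prod volume) ≤
      c * (2 * ∫⁻ z in SG ×ˢ Ioo 0 ε, hg z ∂(μ.prod volume) +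
        ∫⁻ z in SO ×ˢ Ioo 0 ε, hf z ∂(μ.prod volume)) := by
  have hr' : Measurable fun z : X × ℝ ↦ r z.1 := hr.comp measurable_fst
  have hSI : MeasurableSet (S ×ˢ Ioo (0 : ℝ) ε) := hS.prod measurableSet_Ioo
  set P₁ := S ×ˢ Ioo (0 : ℝ) ε ∩ {z | z.2 < r z.1 / 2} with hP₁
  set P₂ := S ×ˢ Ioo (0 : ℝ) ε ∩ {z | r z.1 / 2 ≤ z.2 ∧ z.2 < r z.1} with hP₂
  set P₃ := S ×ˢ Ioo (0 : ℝ) ε ∩ {z | r z.1 ≤ z.2} with hP₃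
  have hm₁ : MeasurableSet P₁ := hSI.inter (measurableSet_lt measurable_snd (hr'.div_const 2))
  have hm₂ : MeasurableSet P₂ := hSI.inter
    ((measurableSet_le (hr'.div_const 2) measurable_snd).inter
      (measurableSet_lt measurable_snd hr'))
  have hm₃ : MeasurableSet P₃ := hSI.inter (measurableSet_le hr' measurable_snd)
  have hcover : S ×ˢ Ioo (0 : ℝ) ε ⊆ P₁ ∪ (P₂ ∪ P₃) := by
    intro z hz
    rcases lt_or_ge z.2 (r z.1 / 2) with h1 | h1
    · exact Or.inl ⟨hz, h1⟩
    rcases lt_or_ge z.2 (r z.1) with h2 | h2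
    · exact Or.inr (Or.inl ⟨hz, h1, h2⟩)
    · exact Or.inr (Or.inr ⟨hz, h2⟩)
  have i₁ : ∫⁻ z in P₁, H z ∂(μ.prod volume) ≤
      c * ∫⁻ z in SG ×ˢ Ioo 0 ε, hg z ∂(μ.prod volume) := by
    rw [← lintegral_const_mul' _ _ ENNReal.coe_ne_top]
    refine (setLIntegral_mono' hm₁ fun z hz ↦ hlow z.1 hz.1.1 z.2 hz.1.2 hz.2).trans
      (lintegral_mono_set fun z hz ↦ ⟨hG z.1 hz.1.1 ?_, hz.1.2⟩)
    have h1 : z.2 < r z.1 / 2 := hz.2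
    linarith [hz.1.2.1]
  have i₂ : ∫⁻ z in P₂, H z ∂(μ.prod volume) ≤
      c * ∫⁻ z in SG ×ˢ Ioo 0 ε, hg z ∂(μ.prod volume) := by
    have hσ : (-1 : ℝ) * (-1) = 1 := by norm_num
    rw [← lintegral_const_mul' _ _ ENNReal.coe_ne_top,
      ← (measurePreserving_fiberShear hσ hr μ).setLIntegral_comp_preimage_emb
        (measurableEmbedding_fiberShear hσ hr) (fun z ↦ c * hg z) (SG ×ˢ Ioo 0 ε)]
    refine (setLIntegral_mono' hm₂ fun z hz ↦ ?_).trans (lintegral_mono_set fun z hz ↦ ?_)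
    · have h1 := hmid z.1 hz.1.1 z.2 hz.1.2 hz.2.1 hz.2.2
      have h2 : fiberShear (-1) r z = (z.1, r z.1 - z.2) := by
        simp only [fiberShear]
        rw [neg_one_mul, neg_add_eq_sub]
      rwa [h2]
    · obtain ⟨⟨h1, h2, h3⟩, h4, h5⟩ := hz
      refine ⟨hG z.1 h1 (by linarith), ?_, ?_⟩
      · change 0 < -1 * z.2 + r z.1
        linarith
      · change -1 * z.2 + r z.1 < ε
        linarith
  have i₃ : ∫⁻ z in P₃, H z ∂(μ.prod volume) ≤
      c * ∫⁻ z in SO ×ˢ Ioo 0 ε, hf z ∂(μ.prod volume) := by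
    have hσ : (1 : ℝ) * 1 = 1 := by norm_num
    have hneg : Measurable fun x ↦ -r x := hr.neg
    -- the graph `t = r x` is sent to the bottom of the cylinder, which is a null set
    have hnull : ∫⁻ z in SO ×ˢ Ioo 0 ε, hf z ∂(μ.prod volume) =
        ∫⁻ z in SO ×ˢ Ico 0 ε, hf z ∂(μ.prod volume) := by
      rw [← Measure.prod_restrict, ← Measure.prod_restrict,
        Measure.restrict_congr_set (Ioo_ae_eq_Ico (μ := volume) (a := (0 : ℝ)) (b := ε))]
    rw [hnull, ← lintegral_const_mul' _ _ ENNReal.coe_ne_top,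
      ← (measurePreserving_fiberShear hσ hneg μ).setLIntegral_comp_preimage_emb
        (measurableEmbedding_fiberShear hσ hneg) (fun z ↦ c * hf z) (SO ×ˢ Ico 0 ε)]
    refine (setLIntegral_mono' hm₃ fun z hz ↦ ?_).trans (lintegral_mono_set fun z hz ↦ ?_)
    · have h0 : r z.1 ≤ z.2 := hz.2
      have h1 := hhigh z.1 hz.1.1 z.2 hz.1.2 (by linarith [hr0 z.1]) h0
      have h2 : fiberShear 1 (fun x ↦ -r x) z = (z.1, z.2 - r z.1) := by
        simp only [fiberShear]
        rw [one_mul, ← sub_eq_add_neg]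
      rwa [h2]
    · obtain ⟨⟨h1, h2, h3⟩, h4⟩ := hz
      have h5 : r z.1 ≤ z.2 := h4
      refine ⟨hO z.1 h1 (by linarith), ?_, ?_⟩
      · change 0 ≤ 1 * z.2 + -r z.1
        linarith
      · change 1 * z.2 + -r z.1 < ε
        linarith [hr0 z.1]
  calc _ ≤ ∫⁻ z in P₁ ∪ (P₂ ∪ P₃), H z ∂(μ.prod volume) := lintegral_mono_set hcover
    _ ≤ _ := (lintegral_union_le _ _ _).trans (add_le_add i₁
      ((lintegral_union_le _ _ _).trans (add_le_add i₂ i₃)))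
    _ = _ := by ring

section

variable {n : ℕ} {M : Type*} [TopologicalSpace M] [ChartedSpace (EuclideanSpace ℝ (Fin n)) M]
  [MeasurableSpace M] [BorelSpace M] [IsManifold (𝓡 n) ∞ M]
  [RiemannianBundle (fun x : M ↦ TangentSpace (𝓡 n) x)]
  [T2Space M] [CompactSpace M]
  [IsContMDiffRiemannianBundle (𝓡 n) ∞ (EuclideanSpace ℝ (Fin n))
      (fun x : M ↦ TangentSpace (𝓡 n) x)]
  {F : Type*} [NormedAddCommGroup F] [NormedSpace ℝ F]

/-- The energy of the folded gluing is controlled by the energies of the glued maps. -/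
lemma exists_energy_glueDeriv_le {p : ℝ} (hp : 1 ≤ p) {ψ : M → ℝ}
    (hψ : ContMDiff (𝓡 n) 𝓘(ℝ) ∞ ψ) (hψ0 : ∀ x, 0 ≤ ψ x) :
    ∃ C : ℝ≥0, ∀ {F : Type*} [NormedAddCommGroup F] [NormedSpace ℝ F] {O G O' : Set M},
      MeasurableSet O' → (∀ x ∈ O', ψ x < 2 → x ∈ O) → (∀ x ∈ O', 0 < ψ x → x ∈ G) →
      ∀ Df Dg : ∀ z : M × ℝ, TangentSpace (𝓡 n) z.1 × ℝ →L[ℝ] F,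
      energy p O' (glueDeriv ψ (realDeriv ψ) Df Dg) ≤ C * (2 * energy p G Dg + energy p O Df) := by
  obtain ⟨B, hB0, hB⟩ := exists_mfderiv_bound hψ
  have hp0 : 0 ≤ p := zero_le_one.trans hp
  set a : ℝ := (n + 1) * (1 + B) with ha
  have ha1 : 1 ≤ a := by
    have : (0 : ℝ) ≤ n := n.cast_nonneg
    nlinarith [mul_nonneg this hB0]
  have ha0 : 0 ≤ a := zero_le_one.trans ha1
  have hap : 1 ≤ a ^ p := Real.one_le_rpow ha1 hp0
  refine ⟨Real.toNNReal (a ^ p), ?_⟩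
  intro F _ _ O G O' hO'm hO hG Df Dg
  have hshear : ∀ {x : M} (A : TangentSpace (𝓡 n) x × ℝ →L[ℝ] F) {σ : ℝ}, |σ| = 1 →
      ∀ c : TangentSpace (𝓡 n) x →L[ℝ] ℝ, (∀ v, |c v| ≤ B * ‖v‖) →
      ENNReal.ofReal (derivNorm (A.comp (shearDeriv σ c)) ^ p) ≤
        (Real.toNNReal (a ^ p) : ℝ≥0∞) * ENNReal.ofReal (derivNorm A ^ p) := by
    intro x A σ hσ c hc
    change _ ≤ ENNReal.ofReal (a ^ p) * _
    rw [← ENNReal.ofReal_mul (Real.rpow_nonneg ha0 p), ← Real.mul_rpow ha0 (derivNorm_nonneg A)]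
    exact ENNReal.ofReal_le_ofReal (Real.rpow_le_rpow (derivNorm_nonneg _)
      (derivNorm_comp_shearDeriv_le A hσ c hB0 hc) hp0)
  refine lintegral_fold_le (riemannianVolume n M) hψ.continuous.measurable hψ0 hO'm
    (fun x hx h ↦ hO x hx (by linarith)) hG ?_ ?_ ?_
  · intro x _ t _ h
    simp only
    rw [glueDeriv_low h]
    have h1 : (1 : ℝ≥0∞) ≤ (Real.toNNReal (a ^ p) : ℝ≥0∞) := by
      change 1 ≤ ENNReal.ofReal (a ^ p)
      rw [← ENNReal.ofReal_one]
      exact ENNReal.ofReal_le_ofReal hap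
    exact le_mul_of_one_le_left zero_le h1
  · intro x _ t _ h h'
    simp only
    rw [glueDeriv_mid h h']
    exact hshear (Dg (x, ψ x - t)) (by simp) _ (hB x)
  · intro x _ t _ h h'
    simp only
    rw [glueDeriv_high h h']
    refine hshear (Df (x, t - ψ x)) (by simp) _ fun v ↦ ?_
    simpa using hB x v

lemma HasTrace.glueMap {ψ : M → ℝ} (hψ : Continuous ψ) (hψ0 : ∀ x, 0 ≤ ψ x)
    {O G O' : Set M}
    (hO : ∀ x ∈ O', ψ x < 2 → x ∈ O) (hG : tsupport ψ ⊆ G) {f g : M × ℝ → F} {u : M → F}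
    (hf : HasTrace n O f u) (hg : HasTrace n G g u) :
    HasTrace n O' (glueMap ψ f g) u := by
  have hsub : O' ⊆ O ∪ G := by
    intro x hx
    rcases lt_or_ge (ψ x) 2 with h | h
    · exact Or.inl (hO x hx h)
    · exact Or.inr (hG (subset_tsupport ψ (by simp only [Function.mem_support]; linarith)))
  refine ⟨(aestronglyMeasurable_union_iff.2 ⟨hf.1, hg.1⟩).mono_measure
    (Measure.restrict_mono hsub le_rfl), fun K hK hKc ↦ ?_⟩
  have hKf : IsCompact (K ∩ {x | ψ x ≤ 1}) := hKc.inter_right (isClosed_le hψ continuous_const)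
  have hKg : IsCompact (K ∩ tsupport ψ) := hKc.inter_right (isClosed_tsupport ψ)
  have h1 := hf.2 _ (fun x hx ↦ hO x (hK hx.1) (by have : ψ x ≤ 1 := hx.2; linarith)) hKf
  have h2 := hg.2 _ (fun x hx ↦ hG hx.2) hKg
  have h3 := (ENNReal.Tendsto.const_mul (a := 2) h2 (Or.inr ENNReal.ofNat_ne_top)).add h1
  rw [mul_zero, zero_add] at h3
  refine tendsto_of_tendsto_of_tendsto_of_le_of_le' tendsto_const_nhds h3
    (Eventually.of_forall fun _ ↦ zero_le) ?_
  filter_upwards [Ioo_mem_nhdsGT (zero_lt_one' ℝ)] with ε hε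
  rw [mul_left_comm, ← mul_add]
  refine mul_le_mul_right ?_ _
  have h4 := lintegral_fold_le (riemannianVolume n M) hψ.measurable hψ0 hKc.measurableSet
    (SO := K ∩ {x | ψ x ≤ 1}) (SG := K ∩ tsupport ψ) (ε := ε)
    (fun x hx h ↦ ⟨hx, (h.trans hε.2).le⟩)
    (fun x hx h ↦ ⟨hx, subset_tsupport ψ (by simp only [Function.mem_support]; exact h.ne')⟩)
    (H := fun z ↦ ‖FoldingSobolev.glueMap ψ f g z - u z.1‖ₑ) (hf := fun z ↦ ‖f z - u z.1‖ₑ)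
    (hg := fun z ↦ ‖g z - u z.1‖ₑ) (c := 1)
    (fun x _ t _ h ↦ by simp only [glueMap_low h, ENNReal.coe_one, one_mul, le_refl])
    (fun x _ t _ h h' ↦ by simp only [glueMap_mid h h', ENNReal.coe_one, one_mul, le_refl])
    (fun x _ t _ h h' ↦ by simp only [glueMap_high h h', ENNReal.coe_one, one_mul, le_refl])
  rwa [ENNReal.coe_one, one_mul] at h4

variable [CompleteSpace F]

/-- The folded gluing of two Sobolev maps with the same trace is weakly differentiable. -/
theorem HasSobolevDeriv.hasWeakDeriv_glueMap {p : ℝ} (hp : 1 ≤ p) {ψ : M → ℝ}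
    (hψ : ContMDiff (𝓡 n) 𝓘(ℝ) ∞ ψ) (hψ0 : ∀ x, 0 ≤ ψ x)
    {O G O' : Set M} (hOo : IsOpen O) (hGo : IsOpen G) (hO'o : IsOpen O')
    (hO : ∀ x ∈ O', ψ x < 2 → x ∈ O) (hG : ∀ x ∈ O', 0 < ψ x → x ∈ G)
    {f g : M × ℝ → F} {Df Dg : ∀ z : M × ℝ, TangentSpace (𝓡 n) z.1 × ℝ →L[ℝ] F}
    (hf : HasSobolevDeriv p O f Df) (hg : HasSobolevDeriv p G g Dg) {u : M → F}
    (hfu : HasTrace n O f u) (hgu : HasTrace n G g u) :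
    HasWeakDeriv O' (glueMap ψ f g) (glueDeriv ψ (realDeriv ψ) Df Dg) := by
  intro x₀
  have hfu' := hfu.hasBottomTrace hOo x₀
  have hgu' := hgu.hasBottomTrace hGo x₀
  have hdf := isOpen_chartDomain (n := n) x₀ hOo
  have hdg := isOpen_chartDomain (n := n) x₀ hGo
  have key := HasWeakFDerivOn.glueMap hdf hdg (isOpen_chartDomain x₀ hO'o)
    (chartOf n x₀).open_target (contDiffOn_comp_symm hψ x₀) (fun y _ ↦ hψ0 _) inter_subset_left
    (fun y hy h ↦ ⟨hy.1, hO _ hy.2 h⟩) (fun y hy h ↦ ⟨hy.1, hG _ hy.2 h⟩)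
    (hf.1 x₀) (hg.1 x₀) (hfu'.locallyIntegrableOn hdf (hf.1 x₀).1)
    (locallyIntegrableOn_prod_Ico hdf fun K hK hKc ↦ hf.integrableOn_chart hp x₀ hKc hK)
    (hgu'.locallyIntegrableOn hdg (hg.1 x₀).1)
    (locallyIntegrableOn_prod_Ico hdg fun K hK hKc ↦ hg.integrableOn_chart hp x₀ hKc hK)
    (fun K hK hKc ↦ HasBottomTrace.tendsto_sub
      ((hf.1 x₀).1.mono_set (prod_mono inter_subset_left le_rfl))
      (Ω := chartDomain n x₀ O ∩ chartDomain n x₀ G)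
      ⟨hfu'.1.mono_measure (Measure.restrict_mono inter_subset_left le_rfl),
        fun K hK ↦ hfu'.2 K (hK.trans inter_subset_left)⟩
      ⟨hgu'.1.mono_measure (Measure.restrict_mono inter_subset_right le_rfl),
        fun K hK ↦ hgu'.2 K (hK.trans inter_subset_right)⟩ hK hKc)
  refine key.congr ((isOpen_chartDomain x₀ hO'o).prod isOpen_Ioo) (fun _ _ ↦ rfl) ?_
  rintro ⟨y, t⟩ ⟨⟨hy, -⟩, -⟩
  simp only at hy
  rcases lt_or_ge t (ψ ((chartOf n x₀).symm y) / 2) with h1 | h1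
  · refine (glueDeriv_low (T := fun _ : EuclideanSpace ℝ (Fin n) ↦ EuclideanSpace ℝ (Fin n))
      (r := fun y ↦ ψ ((chartOf n x₀).symm y)) h1).trans ?_
    refine Eq.trans ?_ (congrArg (fun A : TangentSpace (𝓡 n) ((chartOf n x₀).symm y) × ℝ →L[ℝ] F ↦
      A.comp ((mfderiv (𝓡 n) (𝓡 n) (chartOf n x₀).symm y).prodMap (ContinuousLinearMap.id ℝ ℝ)))
      (glueDeriv_low (dr := realDeriv (n := n) ψ) (Df := Df) (Dg := Dg) h1)).symm
    rfl
  rcases lt_or_ge t (ψ ((chartOf n x₀).symm y)) with h2 | h2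
  · refine (glueDeriv_mid (T := fun _ : EuclideanSpace ℝ (Fin n) ↦ EuclideanSpace ℝ (Fin n))
      (r := fun y ↦ ψ ((chartOf n x₀).symm y)) h1 h2).trans ?_
    refine Eq.trans ?_ (congrArg (fun A : TangentSpace (𝓡 n) ((chartOf n x₀).symm y) × ℝ →L[ℝ] F ↦
      A.comp ((mfderiv (𝓡 n) (𝓡 n) (chartOf n x₀).symm y).prodMap (ContinuousLinearMap.id ℝ ℝ)))
      (glueDeriv_mid (dr := realDeriv (n := n) ψ) (Df := Df) (Dg := Dg) h1 h2)).symm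
    refine ContinuousLinearMap.ext fun v ↦ ?_
    exact congrArg (fun s ↦ Dg ((chartOf n x₀).symm y, ψ ((chartOf n x₀).symm y) - t)
      (mfderiv (𝓡 n) (𝓡 n) (chartOf n x₀).symm y v.1, -1 * v.2 + s))
      (fderiv_comp_symm hψ x₀ hy v.1)
  · refine (glueDeriv_high (T := fun _ : EuclideanSpace ℝ (Fin n) ↦ EuclideanSpace ℝ (Fin n))
      (r := fun y ↦ ψ ((chartOf n x₀).symm y)) h1 h2).trans ?_
    refine Eq.trans ?_ (congrArg (fun A : TangentSpace (𝓡 n) ((chartOf n x₀).symm y) × ℝ →L[ℝ] F ↦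
      A.comp ((mfderiv (𝓡 n) (𝓡 n) (chartOf n x₀).symm y).prodMap (ContinuousLinearMap.id ℝ ℝ)))
      (glueDeriv_high (dr := realDeriv (n := n) ψ) (Df := Df) (Dg := Dg) h1 h2)).symm
    refine ContinuousLinearMap.ext fun v ↦ ?_
    exact congrArg (fun s ↦ Df ((chartOf n x₀).symm y, t - ψ ((chartOf n x₀).symm y))
      (mfderiv (𝓡 n) (𝓡 n) (chartOf n x₀).symm y v.1, 1 * v.2 + (-1 : ℤ) • s))
      (fderiv_comp_symm hψ x₀ hy v.1)

end

/-! ### Gluing along a finite covering -/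

section

variable {n : ℕ} {M : Type*} [TopologicalSpace M] [ChartedSpace (EuclideanSpace ℝ (Fin n)) M]
  {F : Type*} [NormedAddCommGroup F] [NormedSpace ℝ F]

lemma glueMap_comp {X Y Z : Type*} (e : Y → Z) (r : X → ℝ) (f g : X × ℝ → Y) :
    e ∘ glueMap r f g = glueMap r (e ∘ f) (e ∘ g) := by
  funext z
  simp only [glueMap, Function.comp_apply, apply_ite e]

/-- Smooth functions subordinate to a finite covering, one of which exceeds `2` at every point. -/
lemma exists_contMDiff_cover [T2Space M] [CompactSpace M] [IsManifold (𝓡 n) ∞ M]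
    {I : Type*} [Fintype I] {G : I → Set M} (hG_open : ∀ i, IsOpen (G i))
    (hG_cover : ⋃ i, G i = univ) :
    ∃ ψ : I → M → ℝ, (∀ i, ContMDiff (𝓡 n) 𝓘(ℝ) ∞ (ψ i)) ∧ (∀ i x, 0 ≤ ψ i x) ∧
      (∀ i, tsupport (ψ i) ⊆ G i) ∧ ∀ x, ∃ i, 2 < ψ i x := by
  obtain ⟨f, hf⟩ := SmoothPartitionOfUnity.exists_isSubordinate (𝓡 n) isClosed_univ G hG_open
    hG_cover.symm.subset
  have hc : (0 : ℝ) ≤ 3 * Fintype.card I := by positivity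
  -- one of the functions of a partition of unity is at least `1 / card I` at every point
  refine ⟨fun i x ↦ 3 * Fintype.card I * f i x, fun i ↦ contMDiff_const.mul (f i).contMDiff,
    fun i x ↦ mul_nonneg hc (f.nonneg i x),
    fun i ↦ (tsupport_mul_subset_right (f := fun _ ↦ (3 * Fintype.card I : ℝ))).trans (hf i),
    fun x ↦ ?_⟩
  by_contra! h
  have h1 : ∑ i, f i x = 1 := by
    rw [← finsum_eq_sum_of_fintype]
    exact f.sum_eq_one (mem_univ x)
  have h2 : ∑ i, 3 * Fintype.card I * f i x ≤ ∑ _i : I, (2 : ℝ) :=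
    Finset.sum_le_sum fun i _ ↦ h i
  rw [← Finset.mul_sum, h1, Finset.sum_const, Finset.card_univ, nsmul_eq_mul] at h2
  have h3 : 0 < Fintype.card I := by
    rw [Fintype.card_pos_iff]
    by_contra h4
    rw [not_nonempty_iff] at h4
    simp at h1
  have h4 : (0 : ℝ) < Fintype.card I := by exact_mod_cast h3
  linarith

/-- A finite measurable covering has a measurable choice of an index: the first one in an
enumeration of the index type. -/
lemma exists_measurable_partition {X I : Type*} [MeasurableSpace X] [Fintype I] {K : I → Set X}
    (hK : ∀ i, MeasurableSet (K i)) (hcover : ⋃ i, K i = univ) :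
    ∃ idx : X → I, (∀ x, x ∈ K (idx x)) ∧ ∀ i, MeasurableSet {x | idx x = i} := by
  let o := Fintype.equivFin I
  have hmin : ∀ x, ∃ i, x ∈ K i ∧ ∀ j, x ∈ K j → o i ≤ o j := by
    intro x
    classical
    obtain ⟨i₀, hi₀⟩ := mem_iUnion.1 (hcover.symm.subset (mem_univ x))
    obtain ⟨i, hi, hi'⟩ := Finset.exists_min_image (Finset.univ.filter fun i ↦ x ∈ K i) o
      ⟨i₀, by simpa using hi₀⟩
    exact ⟨i, by simpa using hi, fun j hj ↦ hi' j (by simpa using hj)⟩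
  choose idx h1 h2 using hmin
  refine ⟨idx, h1, fun i ↦ ?_⟩
  have : {x | idx x = i} = K i ∩ ⋂ j, ⋂ (_ : o j < o i), (K j)ᶜ := by
    ext x
    simp only [mem_inter_iff, mem_iInter, mem_compl_iff]
    constructor
    · rintro rfl
      exact ⟨h1 x, fun j hj hx ↦ absurd (h2 x j hx) (not_le.2 hj)⟩
    · rintro ⟨hx, hx'⟩
      refine o.injective (le_antisymm (h2 x i hx) (not_lt.1 fun h ↦ hx' _ h (h1 x)))
  rw [this]
  exact (hK i).inter (MeasurableSet.iInter fun j ↦ MeasurableSet.iInter fun _ ↦ (hK j).compl)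

section Trace

variable [MeasurableSpace M] [BorelSpace M] [IsManifold (𝓡 n) ∞ M]
  [RiemannianBundle (fun x : M ↦ TangentSpace (𝓡 n) x)] [T2Space M] [CompactSpace M]

/-- If the traces of maps on a finite covering are compatible, there is a function on the whole
manifold which is the trace of all of them. It is equal to `u i` on a measurable part of a compact
subset `K i` of `G i`; a compact subset of `G j` meets `K i` in a compact subset of `G i ∩ G j`, where
`u i` is a trace of `U j`. -/
lemma exists_common_trace {I : Type*} [Fintype I] {G : I → Set M} (hG_open : ∀ i, IsOpen (G i))
    (hG_cover : ⋃ i, G i = univ) {U : I → M × ℝ → F} {u : I → M → F}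
    (hu : ∀ i, HasTrace n (G i) (U i) (u i))
    (hij : ∀ i j, HasTrace n (G i ∩ G j) (U j) (u i)) :
    ∃ v : M → F, ∀ i, HasTrace n (G i) (U i) v := by
  obtain ⟨K, hKc, hKG, hK⟩ := isCompact_univ.finite_compact_cover Finset.univ G
    (fun i _ ↦ hG_open i) (by simp [hG_cover])
  obtain ⟨idx, hidx, hmeas⟩ := exists_measurable_partition (fun i ↦ (hKc i).measurableSet)
    (by simpa using hK.symm)
  have hcov : ∀ A : Set M, A = ⋃ i, A ∩ {x | idx x = i} := fun A ↦ by
    rw [← inter_iUnion]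
    refine (inter_eq_left.2 fun x _ ↦ mem_iUnion.2 ⟨idx x, rfl⟩).symm
  have hm : AEStronglyMeasurable (fun x ↦ u (idx x) x) (riemannianVolume n M) := by
    rw [← Measure.restrict_univ (μ := riemannianVolume n M), hcov univ,
      aestronglyMeasurable_iUnion_iff]
    intro i
    have h1 : univ ∩ {x | idx x = i} ⊆ G i := by
      rintro x ⟨-, rfl⟩
      exact hKG _ (hidx x)
    refine ((hu i).1.mono_measure (Measure.restrict_mono h1 le_rfl)).congr ?_
    filter_upwards [ae_restrict_mem (MeasurableSet.univ.inter (hmeas i))] with x hx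
    have hx' : idx x = i := hx.2
    rw [hx']
  refine ⟨fun x ↦ u (idx x) x, fun j ↦ ⟨hm.mono_measure Measure.restrict_le_self,
    fun A hA hAc ↦ ?_⟩⟩
  have hsum := tendsto_finsetSum Finset.univ fun i _ ↦ (hij i j).2 (A ∩ K i)
    (fun x hx ↦ ⟨hKG i hx.2, hA hx.1⟩) (hAc.inter (hKc i))
  simp only [Finset.sum_const_zero] at hsum
  refine tendsto_of_tendsto_of_tendsto_of_le_of_le tendsto_const_nhds hsum
    (fun _ ↦ zero_le) fun ε ↦ ?_
  simp only [← Finset.mul_sum]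
  refine mul_le_mul_right ?_ _
  have h1 : A ×ˢ Ioo 0 ε = ⋃ i, (A ∩ {x | idx x = i}) ×ˢ Ioo 0 ε := by
    conv_lhs => rw [hcov A]
    rw [iUnion_prod_const]
  rw [h1]
  refine (lintegral_iUnion_le _ _).trans ?_
  rw [tsum_fintype]
  refine Finset.sum_le_sum fun i _ ↦ ?_
  refine le_trans (le_of_eq (setLIntegral_congr_fun (g := fun z ↦ ‖U j z - u i z.1‖ₑ)
    ((hAc.measurableSet.inter (hmeas i)).prod measurableSet_Ioo) fun z hz ↦ ?_))
    (lintegral_mono_set (prod_mono ?_ le_rfl))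
  · have hz' : idx z.1 = i := hz.1.2
    simp only [hz']
  · rintro x ⟨hx, rfl⟩
    exact ⟨hx, hidx x⟩

end Trace

variable [RiemannianBundle (fun x : M ↦ TangentSpace (𝓡 n) x)] [MeasurableSpace M]

lemma energy_mono {p : ℝ} {G G' : Set M} (h : G' ⊆ G)
    (DU : ∀ z : M × ℝ, TangentSpace (𝓡 n) z.1 × ℝ →L[ℝ] F) :
    energy p G' DU ≤ energy p G DU :=
  lintegral_mono_set (prod_mono h le_rfl)

lemma HasSobolevDeriv.mono {p : ℝ} {G G' : Set M} (h : G' ⊆ G) {U : M × ℝ → F}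
    {DU : ∀ z : M × ℝ, TangentSpace (𝓡 n) z.1 × ℝ →L[ℝ] F} (hU : HasSobolevDeriv p G U DU) :
    HasSobolevDeriv p G' U DU :=
  ⟨fun x₀ ↦ (hU.1 x₀).mono (prod_mono (inter_subset_inter_right _ (preimage_mono h)) le_rfl),
    (energy_mono h DU).trans_lt hU.2⟩

/-- The gluing of Sobolev maps with a common trace, one after the other: the maps with indices in
`S` are glued to a map on the union of the sets where one of the functions `ψ i`, `i ∈ S`,
exceeds `2`. -/
lemma exists_glue_finset [BorelSpace M] [IsManifold (𝓡 n) ∞ M] [T2Space M] [CompactSpace M]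
    [IsContMDiffRiemannianBundle (𝓡 n) ∞ (EuclideanSpace ℝ (Fin n))
      (fun x : M ↦ TangentSpace (𝓡 n) x)] {I : Type*} [Fintype I] [Nonempty I]
    {G : I → Set M} (hG_open : ∀ i, IsOpen (G i)) {p : ℝ} (hp : 1 ≤ p) {ψ : I → M → ℝ}
    (hψ : ∀ i, ContMDiff (𝓡 n) 𝓘(ℝ) ∞ (ψ i)) (hψ0 : ∀ i x, 0 ≤ ψ i x)
    (hψG : ∀ i, tsupport (ψ i) ⊆ G i) (S : Finset I) :
    ∃ C : ℝ≥0, ∀ {F : Type*} [NormedAddCommGroup F] [NormedSpace ℝ F] [CompleteSpace F]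
      {N : Type*} (e : N → F) (U : I → M × ℝ → N)
      (DU : I → ∀ z : M × ℝ, TangentSpace (𝓡 n) z.1 × ℝ →L[ℝ] F) (u : M → F),
      (∀ i, HasSobolevDeriv p (G i) (e ∘ U i) (DU i)) →
      (∀ i, HasTrace n (G i) (e ∘ U i) u) →
      ∃ (V : M × ℝ → N) (DV : ∀ z : M × ℝ, TangentSpace (𝓡 n) z.1 × ℝ →L[ℝ] F),
        HasSobolevDeriv p (⋃ i ∈ S, {x | 2 < ψ i x}) (e ∘ V) DV ∧
        HasTrace n (⋃ i ∈ S, {x | 2 < ψ i x}) (e ∘ V) u ∧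
        energy p (⋃ i ∈ S, {x | 2 < ψ i x}) DV ≤ C * ∑ i, energy p (G i) (DU i) := by
  classical
  induction S using Finset.induction_on with
  | empty =>
    refine ⟨0, fun {F} _ _ _ {N} e U DU u hU hu ↦ ?_⟩
    have h0 : (⋃ i ∈ (∅ : Finset I), {x | 2 < ψ i x}) = ∅ := by simp
    obtain ⟨i₀⟩ := ‹Nonempty I›
    refine ⟨U i₀, DU i₀, ?_⟩
    rw [h0]
    refine ⟨(hU i₀).mono (empty_subset _), (hu i₀).mono (empty_subset _), ?_⟩
    simp [energy]
  | insert j S hj ih =>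
    obtain ⟨C, hC⟩ := ih
    obtain ⟨D, hD⟩ := exists_energy_glueDeriv_le hp (hψ j) (hψ0 j)
    refine ⟨D * (2 + C), fun {F} _ _ _ {N} e U DU u hU hu ↦ ?_⟩
    obtain ⟨V, DV, hV, hVu, hVe⟩ := hC e U DU u hU hu
    set O := ⋃ i ∈ S, {x | 2 < ψ i x} with hO
    set O' := ⋃ i ∈ insert j S, {x | 2 < ψ i x} with hO'
    have hopen : ∀ S : Finset I, IsOpen (⋃ i ∈ S, {x | 2 < ψ i x}) := fun S ↦
      isOpen_biUnion fun i _ ↦ isOpen_lt continuous_const (hψ i).continuous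
    have hO'O : ∀ x ∈ O', ψ j x < 2 → x ∈ O := by
      intro x hx h
      rw [hO', Finset.set_biUnion_insert] at hx
      rcases hx with hx | hx
      · exact absurd h (not_lt.2 (le_of_lt hx))
      · exact hx
    have hO'G : ∀ x ∈ O', 0 < ψ j x → x ∈ G j := fun x _ h ↦
      hψG j (subset_tsupport _ h.ne')
    have hen : energy p O' (glueDeriv (ψ j) (realDeriv (ψ j)) DV (DU j)) ≤
        (D * (2 + C) : ℝ≥0) * ∑ i, energy p (G i) (DU i) := by
      refine (hD (hopen _).measurableSet hO'O hO'G DV (DU j)).trans ?_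
      rw [ENNReal.coe_mul, mul_assoc]
      refine mul_le_mul_right ?_ _
      rw [ENNReal.coe_add, add_mul]
      refine add_le_add (mul_le_mul_right ?_ _) hVe
      exact Finset.single_le_sum (f := fun i ↦ energy p (G i) (DU i)) (fun _ _ ↦ zero_le)
        (Finset.mem_univ j)
    refine ⟨glueMap (ψ j) V (U j), glueDeriv (ψ j) (realDeriv (ψ j)) DV (DU j), ?_, ?_, hen⟩
    · rw [glueMap_comp]
      refine ⟨HasSobolevDeriv.hasWeakDeriv_glueMap hp (hψ j) (hψ0 j) (hopen S) (hG_open j)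
        (hopen _) hO'O hO'G hV (hU j) hVu (hu j), hen.trans_lt ?_⟩
      exact ENNReal.mul_lt_top ENNReal.coe_lt_top
        (ENNReal.sum_lt_top.2 fun i _ ↦ (hU i).2)
    · rw [glueMap_comp]
      exact HasTrace.glueMap (hψ j).continuous (hψ0 j) hO'O (hψG j) hVu (hu j)

end

end FoldingSobolev

end

theorem proposition2p2 {n : ℕ} {M : Type*} [TopologicalSpace M] [T2Space M] [CompactSpace M]
    [ChartedSpace (EuclideanSpace ℝ (Fin n)) M] [IsManifold (𝓡 n) ∞ M]
    [RiemannianBundle (fun x : M ↦ TangentSpace (𝓡 n) x)]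
    [IsContMDiffRiemannianBundle (𝓡 n) ∞ (EuclideanSpace ℝ (Fin n))
      (fun x : M ↦ TangentSpace (𝓡 n) x)]
    [MeasurableSpace M] [BorelSpace M]
    {I : Type*} [Fintype I] (G : I → Set M) (hG_open : ∀ i, IsOpen (G i))
    (hG_cover : ⋃ i, G i = univ) (p : ℝ) (hp : 1 ≤ p) :
    ∃ C : ℝ≥0, ∀ {d ν : ℕ} {N : Type*} [TopologicalSpace N]
      [ChartedSpace (EuclideanSpace ℝ (Fin d)) N] [IsManifold (𝓡 d) ∞ N]
      [RiemannianBundle (fun y : N ↦ TangentSpace (𝓡 d) y)]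
      [IsContMDiffRiemannianBundle (𝓡 d) ∞ (EuclideanSpace ℝ (Fin d))
        (fun y : N ↦ TangentSpace (𝓡 d) y)]
      (e : N → EuclideanSpace ℝ (Fin ν)) (_he : FoldingSobolev.IsIsometricEmbedding (d := d) e)
      (U : I → M × ℝ → N)
      (DU : I → ∀ z : M × ℝ, TangentSpace (𝓡 n) z.1 × ℝ →L[ℝ] EuclideanSpace ℝ (Fin ν))
      (_hU : ∀ i, FoldingSobolev.HasSobolevDeriv p (G i) (e ∘ U i) (DU i))
      (_htrace : ∀ i j, ∀ u : M → EuclideanSpace ℝ (Fin ν),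
        FoldingSobolev.HasTrace n (G i ∩ G j) (e ∘ U i) u ↔
          FoldingSobolev.HasTrace n (G i ∩ G j) (e ∘ U j) u),
      ∃ (V : M × ℝ → N)
        (DV : ∀ z : M × ℝ, TangentSpace (𝓡 n) z.1 × ℝ →L[ℝ] EuclideanSpace ℝ (Fin ν)),
        FoldingSobolev.HasSobolevDeriv p univ (e ∘ V) DV ∧
        (∃ u : M → EuclideanSpace ℝ (Fin ν), FoldingSobolev.HasTrace n univ (e ∘ V) u ∧
          ∀ i, FoldingSobolev.HasTrace n (G i) (e ∘ U i) u) ∧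
        FoldingSobolev.energy p univ DV ≤
          C * ∑ i, FoldingSobolev.energy p (G i) (DU i) := by
  classical
  cases isEmpty_or_nonempty I with
  | inl hI =>
    -- the empty family covers the empty manifold only
    have hM : IsEmpty M := by
      rw [iUnion_of_empty, eq_comm, univ_eq_empty_iff] at hG_cover
      exact hG_cover
    refine ⟨0, fun {d ν N} _ _ _ _ _ e _ U DU _ _ ↦
      ⟨fun z ↦ isEmptyElim z.1, fun z ↦ 0, ?_, ⟨fun _ ↦ 0, ?_, fun i ↦ isEmptyElim i⟩, ?_⟩⟩
    · exact ⟨fun x₀ ↦ isEmptyElim x₀, by simp [FoldingSobolev.energy, Measure.eq_zero_of_isEmpty]⟩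
    · refine ⟨aestronglyMeasurable_const, fun K _ _ ↦ ?_⟩
      simp [Measure.eq_zero_of_isEmpty]
    · simp [FoldingSobolev.energy, Measure.eq_zero_of_isEmpty]
  | inr hI =>
    obtain ⟨ψ, hψ, hψ0, hψG, hψ2⟩ :=
      FoldingSobolev.exists_contMDiff_cover (n := n) hG_open hG_cover
    obtain ⟨C, hC⟩ :=
      FoldingSobolev.exists_glue_finset hG_open hp hψ hψ0 hψG Finset.univ
    have hcover : (⋃ i ∈ (Finset.univ : Finset I), {x | 2 < ψ i x}) = univ := by
      refine eq_univ_of_forall fun x ↦ ?_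
      obtain ⟨i, hi⟩ := hψ2 x
      exact mem_iUnion₂.2 ⟨i, Finset.mem_univ i, hi⟩
    rw [hcover] at hC
    refine ⟨C, fun {d ν N} _ _ _ _ _ e _ U DU hU htrace ↦ ?_⟩
    choose u hu using fun i ↦ (hU i).exists_hasTrace hp (hG_open i)
    obtain ⟨v, hv⟩ := FoldingSobolev.exists_common_trace hG_open hG_cover hu
      fun i j ↦ (htrace i j (u i)).1 ((hu i).mono inter_subset_left)
    obtain ⟨V, DV, hV, hVv, hVe⟩ := hC e U DU v hU hv
    exact ⟨V, DV, hV, ⟨v, hVv, hv⟩, hVe⟩
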